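/- All digraphs are finite, given with vertex set $\{0,\dots,n-1\}$. An *out-branching* of a digraph $D$ with root $r$ is a spanning subgraph $T$ of $D$ in which $r$ has in-degree $0$, every other vertex has in-degree $1$, and every vertex is reachable from $r$; a *leaf* of $T$ is a vertex of out-degree $0$ in $T$. *Directed Spanning $k$-Leaf* asks, for a digraph $D$ and $k\in\mathbb N$, whether $D$ has an out-branching with at least $k$ leaves. For an out-branching $T$ write $u\preceq_T v$ if $v$ is reachable from $u$ in $T$, and $u\prec_T v$ if moreover $u\ne v$. Let $\mathrm{BrSucc}(T)$ be the set of vertices whose in-neighbour in $T$ has out-degree at least $2$ in $T$, and let $\mathrm{HB}^T_D(x,l)$ be the set of all $v\notin \mathrm{BrSucc}(T)$ for which $D$ has an arc $(u,v)$ with $v\prec_T x\preceq_T u\preceq_T l$. An arc of $D$ is *useless for $r$* if no out-branching of $D$ with root $r$ contains it. An out-branching $T$ of $D$ is *1-optimal* if one cannot obtain an out-branching of $D$ with more leaves by adding to $T$ an arc $(u,v)$ of $D$ that is not in $T$, where $v$ is not the root, and deleting the arc of $T$ that enters $v$. Consider the following algorithm with input $(D,k)$. For every vertex $r$ from which all vertices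 of $D$ are reachable: 1. remove from $D$ all arcs that are useless for $r$, obtaining $D'$; 2. compute a 1-optimal out-branching $T$ of $D'$ with root $r$; 3. if $T$ has at least $k$ leaves, return YES; 4. if $T$ has a leaf $l$ and a vertex $x\prec_T l$ with $|\mathrm{HB}^T_{D'}(x,l)|\ge 6k^2$, return YES; 5. construct a path decomposition of width at most $6k^3$ of the underlying undirected graph of $D'$; 6. decide from this path decomposition (by dynamic programming) whether $D'$ has an out-branching with at least $k$ leaves; if so, return YES. If no vertex $r$ leads to YES, return NO. **Theorem.** (a) However its steps are implemented correctly, the algorithm halts on every digraph $D$ and every $k$, and it returns YES if and only if $D$ has an out-branching with at least $k$ leaves. (b) All steps (in particular Step 5, whenever it is reached) can be implemented so that on every digraph with $n$ vertices and every $k$ the algorithm takes time $2^{O(k^3\log k)}\cdot n^{O(1)}$. (c) Hence Directed Spanning $k$-Leaf is fixed-parameter tractable on the class of all digraphs: for some function $f$ it can be decided in time $f(k)\cdot n^{O(1)}$. Running time is the number of steps of a WHILE program over binary trees with unit-cost operations (a model polynomially equivalent to Turing machines); a digraph is given by its adjacency matrix and numbers are written in unary. -/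

import Mathlib

namespace SpanningLeaf

/-! ### Out-branchings, leaves, backward arcs

A digraph on the vertex type `V` is Mathlib's `Digraph V`; an out-branching, being spanning, is
given by its set of arcs, that is, again by a `Digraph V`. -/

section Graphs

variable {V : Type*}

/-- `v` is reachable from `u` in `D` (every vertex is reachable from itself). -/
def Reach (D : Digraph V) (u v : V) : Prop := Relation.ReflTransGen D.Adj u v

/-- `T` is an out-branching of `D` with root `r`: a spanning subgraph in which `r` has in-degree 0,
every other vertex has in-degree 1, and every vertex is reachable from `r`. -/
structure IsOutBranching (D : Digraph V) (r : V) (T : Digraph V) : Prop where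
  subgraph : ∀ u v, T.Adj u v → D.Adj u v
  root : ∀ u, ¬ T.Adj u r
  indegree : ∀ v, v ≠ r → ∃! u, T.Adj u v
  reach : ∀ v, Reach T r v

/-- The set of vertices of out-degree 0. -/
def leaves (T : Digraph V) : Set V := {v | ∀ w, ¬ T.Adj v w}

/-- The problem Directed Spanning `k`-Leaf: is there an out-branching with at least `k` leaves? -/
def HasLeafyOutBranching (D : Digraph V) (k : ℕ) : Prop :=
  ∃ r T, IsOutBranching D r T ∧ k ≤ (leaves T).ncard

/-- The set of vertices with an in-neighbour that is a branch vertex (has out-degree at least 2). -/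
def brSucc (T : Digraph V) : Set V := {v | ∃ u, T.Adj u v ∧ 2 ≤ {w | T.Adj u w}.ncard}

/-- The heads, not in `brSucc T`, of the arcs `(u, v)` of `D` with `v ≺ z ≼ u ≼ l`, where `≼` is
reachability in `T`. -/
def backwardHeads (D T : Digraph V) (z l : V) : Set V :=
  {v | ∃ u, D.Adj u v ∧ (Reach T v z ∧ v ≠ z) ∧ Reach T z u ∧ Reach T u l} \ brSucc T

/-- Some leaf `l` of `T` and some `x ≺ l` have at least `6 * k ^ 2` backward heads. -/
def HasManyBackwardHeads (D T : Digraph V) (k : ℕ) : Prop :=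
  ∃ l x, l ∈ leaves T ∧ (Reach T x l ∧ x ≠ l) ∧ 6 * k ^ 2 ≤ (backwardHeads D T x l).ncard

/-- The arc `(u, v)` of `D` is useless for `r`: no out-branching with root `r` contains it. -/
def IsUseless (D : Digraph V) (r u v : V) : Prop :=
  D.Adj u v ∧ ¬ ∃ T, IsOutBranching D r T ∧ T.Adj u v

/-- `D` without the arcs that are useless for `r`. -/
def removeUseless (D : Digraph V) (r : V) : Digraph V where
  Adj u v := D.Adj u v ∧ ¬ IsUseless D r u v

/-- The 1-change for `(u, v)`: add the arc `(u, v)` and delete the arc of `T` that enters `v`. -/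
def oneChange (T : Digraph V) (u v : V) : Digraph V where
  Adj a b := (T.Adj a b ∧ b ≠ v) ∨ (a = u ∧ b = v)

/-- `T` is a 1-optimal out-branching of `D` with root `r`: no 1-change for an arc of `D` that is
not in `T` and does not enter the root gives an out-branching with more leaves. -/
def IsOneOptimal (D : Digraph V) (r : V) (T : Digraph V) : Prop :=
  IsOutBranching D r T ∧
    ∀ u v, D.Adj u v → ¬ T.Adj u v → v ≠ r →
      ∀ s, IsOutBranching D s (oneChange T u v) →
        (leaves (oneChange T u v)).ncard ≤ (leaves T).ncard

/-- `X` is a path decomposition of the underlying undirected graph of `D`. -/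
structure IsPathDecomposition (D : Digraph V) (X : List (Finset V)) : Prop where
  vertex : ∀ v, ∃ B ∈ X, v ∈ B
  edge : ∀ u v, D.Adj u v → ∃ B ∈ X, u ∈ B ∧ v ∈ B
  interval : ∀ (v : V) (i j l : Fin X.length), i ≤ j → j ≤ l → v ∈ X[i] → v ∈ X[l] → v ∈ X[j]

/-- The width `max |B| - 1` of the sequence of bags `X` is at most `w`. -/
def WidthLE (X : List (Finset V)) (w : ℕ) : Prop := ∀ B ∈ X, B.card ≤ w + 1

end Graphs

/-! ### The machine model: WHILE programs over binary trees, with unit cost per operation -/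

/-- The data: finite binary trees. -/
inductive Val where
  | nil : Val
  | cons : Val → Val → Val

namespace Val

/-- Head of a pair; the head of `nil` is `nil`. -/
def hd : Val → Val
  | nil => nil
  | cons a _ => a

/-- Tail of a pair; the tail of `nil` is `nil`. -/
def tl : Val → Val
  | nil => nil
  | cons _ b => b

end Val

/-- Expressions over the program variables, which are numbered by `ℕ`. -/
inductive Expr where
  | var : ℕ → Expr
  | nil : Expr
  | cons : Expr → Expr → Expr
  | hd : Expr → Expr
  | tl : Expr → Expr

/-- A store assigns a value to every variable. -/
abbrev Store := ℕ → Val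

/-- The value of an expression. -/
def Expr.eval (σ : Store) : Expr → Val
  | .var x => σ x
  | .nil => Val.nil
  | .cons a b => Val.cons (a.eval σ) (b.eval σ)
  | .hd a => (a.eval σ).hd
  | .tl a => (a.eval σ).tl

/-- The time to evaluate an expression: the number of its operations. -/
def Expr.cost : Expr → ℕ
  | .var _ => 1
  | .nil => 1
  | .cons a b => a.cost + b.cost + 1
  | .hd a => a.cost + 1
  | .tl a => a.cost + 1

/-- Programs. A test counts as true if its value is not `nil`. The command `call x p e` runs the
program `p` on the value of `e`, with variables of its own, and stores the output in `x`. -/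
inductive Prog where
  | skip : Prog
  | assign : ℕ → Expr → Prog
  | seq : Prog → Prog → Prog
  | cond : Expr → Prog → Prog → Prog
  | loop : Expr → Prog → Prog
  | call : ℕ → Prog → Expr → Prog

/-- The store in which a program starts: the input in variable 0, and `nil` elsewhere. -/
def Store.start (a : Val) : Store := fun x => if x = 0 then a else Val.nil

/-- `Exec p σ σ' t`: started in the store `σ`, the program `p` halts in the store `σ'` after
exactly `t` steps. -/
inductive Exec : Prog → Store → Store → ℕ → Prop where
  | skip (σ : Store) : Exec .skip σ σ 1
  | assign (σ : Store) (x : ℕ) (e : Expr) :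
      Exec (.assign x e) σ (Function.update σ x (e.eval σ)) (e.cost + 1)
  | seq {p q : Prog} {σ σ₁ σ₂ : Store} {s t : ℕ} :
      Exec p σ σ₁ s → Exec q σ₁ σ₂ t → Exec (.seq p q) σ σ₂ (s + t + 1)
  | cond_true {e : Expr} {p q : Prog} {σ σ₁ : Store} {t : ℕ} :
      e.eval σ ≠ Val.nil → Exec p σ σ₁ t → Exec (.cond e p q) σ σ₁ (e.cost + t + 1)
  | cond_false {e : Expr} {p q : Prog} {σ σ₁ : Store} {t : ℕ} :
      e.eval σ = Val.nil → Exec q σ σ₁ t → Exec (.cond e p q) σ σ₁ (e.cost + t + 1)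
  | loop_done {e : Expr} {p : Prog} {σ : Store} :
      e.eval σ = Val.nil → Exec (.loop e p) σ σ (e.cost + 1)
  | loop_step {e : Expr} {p : Prog} {σ σ₁ σ₂ : Store} {s t : ℕ} :
      e.eval σ ≠ Val.nil → Exec p σ σ₁ s → Exec (.loop e p) σ₁ σ₂ t →
        Exec (.loop e p) σ σ₂ (e.cost + s + t + 1)
  | call {x : ℕ} {p : Prog} {e : Expr} {σ σ₁ : Store} {t : ℕ} :
      Exec p (Store.start (e.eval σ)) σ₁ t →
        Exec (.call x p e) σ (Function.update σ x (σ₁ 0)) (e.cost + t + 1)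

/-- On input `a` the program `p` halts after exactly `t` steps with output `b`. -/
def Prog.RunsTo (p : Prog) (a b : Val) (t : ℕ) : Prop :=
  ∃ σ, Exec p (Store.start a) σ t ∧ σ 0 = b

/-- On input `a` the program `p` halts with output `b`. -/
def Prog.Computes (p : Prog) (a b : Val) : Prop := ∃ t, p.RunsTo a b t

/-! ### Encodings -/

/-- Natural numbers, and vertices from `Fin n`, are written in unary. -/
def encNat : ℕ → Val
  | 0 => Val.nil
  | m + 1 => Val.cons Val.nil (encNat m)

/-- Truth values: `nil` for false (NO), the pair of two `nil`s for true (YES). -/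
noncomputable def encProp (P : Prop) : Val :=
  open Classical in if P then Val.cons Val.nil Val.nil else Val.nil

/-- Lists. -/
def encList : List Val → Val
  | [] => Val.nil
  | a :: l => Val.cons a (encList l)

/-- A digraph is given by the list of the rows of its adjacency matrix. -/
noncomputable def encDigraph {n : ℕ} (D : Digraph (Fin n)) : Val :=
  encList (List.ofFn fun u => encList (List.ofFn fun v => encProp (D.Adj u v)))

/-- A sequence of sets of vertices is given by the list of their characteristic vectors. -/
noncomputable def encBags {n : ℕ} (X : List (Finset (Fin n))) : Val :=
  encList (X.map fun B => encList (List.ofFn fun v => encProp (v ∈ B)))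

/-- An instance: a digraph and a natural number (the parameter, or a vertex). -/
noncomputable def encInstance {n : ℕ} (D : Digraph (Fin n)) (k : ℕ) : Val :=
  Val.cons (encDigraph D) (encNat k)

/-! ### The algorithm -/

/-- Programs for the individual steps of the algorithm. -/
structure Steps where
  spans : Prog
  removal : Prog
  oneOpt : Prog
  enoughLeaves : Prog
  manyBackward : Prog
  pathDecomp : Prog
  dynProg : Prog

/-- The programs perform the steps of the algorithm. -/
structure Steps.Correct (s : Steps) : Prop where
  /-- Test whether every vertex is reachable from `r`. -/
  spans : ∀ (n : ℕ) (D : Digraph (Fin n)) (r : Fin n),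
    s.spans.Computes (encInstance D r) (encProp (∀ v, Reach D r v))
  /-- Remove all arcs that are useless for `r`. -/
  removal : ∀ (n : ℕ) (D : Digraph (Fin n)) (r : Fin n), (∀ v, Reach D r v) →
    s.removal.Computes (encInstance D r) (encDigraph (removeUseless D r))
  /-- Compute a 1-optimal out-branching with root `r`. -/
  oneOpt : ∀ (n : ℕ) (D : Digraph (Fin n)) (r : Fin n), (∀ v, Reach D r v) →
    (∀ u v, ¬ IsUseless D r u v) →
    ∃ T, IsOneOptimal D r T ∧ s.oneOpt.Computes (encInstance D r) (encDigraph T)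
  /-- Test whether `T` has at least `k` leaves. -/
  enoughLeaves : ∀ (n : ℕ) (T : Digraph (Fin n)) (k : ℕ),
    s.enoughLeaves.Computes (encInstance T k) (encProp (k ≤ (leaves T).ncard))
  /-- Test whether there are many backward heads somewhere. -/
  manyBackward : ∀ (n : ℕ) (D T : Digraph (Fin n)) (r : Fin n) (k : ℕ), IsOutBranching D r T →
    s.manyBackward.Computes (Val.cons (encDigraph D) (encInstance T k))
      (encProp (HasManyBackwardHeads D T k))
  /-- Construct a path decomposition of width at most `6 * k ^ 3`. -/
  pathDecomp : ∀ (n : ℕ) (D T : Digraph (Fin n)) (r : Fin n) (k : ℕ),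
    (∀ u v, ¬ IsUseless D r u v) → IsOneOptimal D r T →
    ¬ k ≤ (leaves T).ncard → ¬ HasManyBackwardHeads D T k →
    ∃ X, IsPathDecomposition D X ∧ WidthLE X (6 * k ^ 3) ∧
      s.pathDecomp.Computes (Val.cons (encDigraph D) (encInstance T k)) (encBags X)
  /-- Decide, from a path decomposition, whether there is an out-branching with at least `k`
  leaves. -/
  dynProg : ∀ (n : ℕ) (D : Digraph (Fin n)) (X : List (Finset (Fin n))) (k : ℕ),
    IsPathDecomposition D X →
    s.dynProg.Computes (Val.cons (encInstance D k) (encBags X))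
      (encProp (HasLeafyOutBranching D k))

namespace Var

/-- Input and output. -/
abbrev io : ℕ := 0
/-- The given digraph. -/
abbrev D : ℕ := 1
/-- The parameter. -/
abbrev k : ℕ := 2
/-- The rows of the adjacency matrix from the current root on; `nil` ends the main loop. -/
abbrev todo : ℕ := 3
/-- The current root. -/
abbrev r : ℕ := 4
/-- The digraph without useless arcs. -/
abbrev E : ℕ := 5
/-- The 1-optimal out-branching. -/
abbrev T : ℕ := 6
/-- The path decomposition. -/
abbrev X : ℕ := 7
/-- The result of a test. -/
abbrev test : ℕ := 8

end Var

/-- Execute the listed programs one after the other. -/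
def block : List Prog → Prog
  | [] => .skip
  | p :: l => .seq p (block l)

/-- Answer YES and leave the main loop. -/
def returnYes : Prog :=
  block [.assign Var.io (.cons .nil .nil), .assign Var.todo .nil]

/-- The algorithm, whose steps are performed by the programs `s`. The input is a digraph `D` and a
number `k`; the vertices `r` of `D` are tried as roots one after the other. -/
def algorithm (s : Steps) : Prog :=
  block
    [ .assign Var.D (.hd (.var Var.io)),
      .assign Var.k (.tl (.var Var.io)),
      .assign Var.io .nil,
      .assign Var.todo (.var Var.D),
      .assign Var.r .nil,
      .loop (.var Var.todo) (block
        [ .call Var.test s.spans (.cons (.var Var.D) (.var Var.r)),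
          .cond (.var Var.test)
            (block
              [ .call Var.E s.removal (.cons (.var Var.D) (.var Var.r)),
                .call Var.T s.oneOpt (.cons (.var Var.E) (.var Var.r)),
                .call Var.test s.enoughLeaves (.cons (.var Var.T) (.var Var.k)),
                .cond (.var Var.test) returnYes (block
                  [ .call Var.test s.manyBackward
                      (.cons (.var Var.E) (.cons (.var Var.T) (.var Var.k))),
                    .cond (.var Var.test) returnYes (block
                      [ .call Var.X s.pathDecomp
                          (.cons (.var Var.E) (.cons (.var Var.T) (.var Var.k))),
                        .call Var.test s.dynProg
                          (.cons (.cons (.var Var.E) (.var Var.k)) (.var Var.X)),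
                        .cond (.var Var.test) returnYes .skip ]) ]) ])
            .skip,
          .assign Var.todo (.tl (.var Var.todo)),
          .assign Var.r (.cons .nil (.var Var.r)) ]) ]

/-- Fixed-parameter tractability of a parameterized decision problem on digraphs: some program
decides it in time `f k * n ^ O(1)` on digraphs with `n` vertices, for some function `f`. -/
def FixedParameterTractable (Q : (n : ℕ) → Digraph (Fin n) → ℕ → Prop) : Prop :=
  ∃ (p : Prog) (f : ℕ → ℕ) (c : ℕ), ∀ (n : ℕ) (D : Digraph (Fin n)) (k : ℕ),
    ∃ t ≤ f k * (n + 1) ^ c, p.RunsTo (encInstance D k) (encProp (Q n D k)) t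

end SpanningLeaf

open SpanningLeaf

/-! Deleting the useless arcs for `r` loses no out-branching with root `r`, and an out-branching of
`D'` is one of `D`, so it suffices to search `D'` for every root that reaches everything
(`hasLeafyOutBranching_iff_exists_root`). Two claims carry the weight: YES is right when there are
many backward heads, and otherwise small bags exist.

Backward heads (`hasLeafyOutBranching_of_manyBackwardHeads`). Let `w` be a backward head, by the arc
`(u, w)`. As this arc is useful, some walk from `r` to `u` avoids `w`. Let `(p, q)` be the last arc
by which it enters the subtree of `T` at `w`. It is not in `T`, and 1-optimality forces `p` to be a
leaf or `q` to be a child of a branch vertex (`exists_bypass`). If `T` has fewer than `k` leaves,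
there are fewer than `3k` such labels, so more than `k` of the heads share one. These heads lie on
one path of `T`; let `a` be the highest and `m` the lowest. The shared label supplies an arc from
outside the subtree of `a` into the subtree of `m`, through which that whole subtree is reached
without the vertices between `a` and `m`. The remaining heads are then out-neighbours of a set that
is connected from the root, and such out-neighbours can be made pairwise incomparable
(`exists_outBranching_boundary_le`), which gives at least `k` leaves.

Path decomposition (`isPathDecomposition_bags`, `widthLE_bags`). The bags follow the depth in `T`:
leaves and children of branch vertices are in every bag, the bag at `i` contains the levels `i` and
`i + 1`, and also each head of a backward arc that crosses level `i`. By 1-optimality no other arcs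
occur. Levels are antichains, hence no larger than the number of leaves; the crossing heads are
covered by one set of backward heads per leaf.

Dynamic programming (`hasLeafyOutBranching_iff`). A partial solution is a set of arcs, remembered
only through its in- and out-degrees being zero or not on the bag, its connected components on the
bag, and a count of finished leaves. With bags of size `b` there are at most `(4b)^b (n + 1)` states
(`ncard_isStateAt_le`), which for `b = 6k³ + 1` is the source of the exponential factor.

Running time. `PolyTime` is closed under composition, branching, loops and folds. The
graph-theoretic steps are formulas with counting and reachability, evaluated in polynomial time
(`Fml.polyTime`), or iterations of such formulas. The main loop is analysed once for an arbitrary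
bound on its steps (`runsWithin_algorithm`): mere termination of the steps yields correctness of
every implementation, and explicit bounds yield the running time. -/

namespace SpanningLeaf

/-! ### Functions computable in polynomial time -/

/-- Some program maps `a i` to `b i` in time polynomial in `N i`, for all `i`. -/
def PolyTime {ι : Type} (N : ι → ℕ) (a b : ι → Val) : Prop :=
  ∃ (p : Prog) (c : ℕ), ∀ i, ∃ t ≤ (N i + 2) ^ c, p.RunsTo (a i) (b i) t

/-- The base `N + 2` is at least 2 even for `N = 0`, so that constants, and the factor 2 in sums,
are absorbed by the exponent. -/
theorem const_le_pow (N m : ℕ) : m ≤ (N + 2) ^ m :=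
  (Nat.lt_two_pow_self (n := m)).le.trans (Nat.pow_le_pow_left (by omega) m)

theorem pow_add_pow_le (N a b : ℕ) : (N + 2) ^ a + (N + 2) ^ b ≤ (N + 2) ^ (a + b + 1) := by
  have h1 : (N + 2) ^ a ≤ (N + 2) ^ (a + b) := Nat.pow_le_pow_right (by omega) (by omega)
  have h2 : (N + 2) ^ b ≤ (N + 2) ^ (a + b) := Nat.pow_le_pow_right (by omega) (by omega)
  rw [pow_succ]
  nlinarith [Nat.zero_le ((N + 2) ^ (a + b) * N)]

/-- `f` is bounded by a polynomial in `N`. -/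
def PolyBdd {ι : Type} (N f : ι → ℕ) : Prop := ∃ c, ∀ i, f i ≤ (N i + 2) ^ c

/-! ### Polynomially bounded functions -/

section PolyBdd

variable {ι : Type} {N f g : ι → ℕ}

theorem PolyBdd.const (m : ℕ) : PolyBdd N fun _ => m := ⟨m, fun i => const_le_pow (N i) m⟩

theorem PolyBdd.of_le (h : ∀ i, f i ≤ N i) : PolyBdd N f :=
  ⟨1, fun i => (h i).trans (by rw [pow_one]; omega)⟩

theorem PolyBdd.self : PolyBdd N N := .of_le fun _ => le_rfl

theorem PolyBdd.add (hf : PolyBdd N f) (hg : PolyBdd N g) : PolyBdd N fun i => f i + g i := by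
  obtain ⟨c, hc⟩ := hf
  obtain ⟨d, hd⟩ := hg
  exact ⟨c + d + 1, fun i => (add_le_add (hc i) (hd i)).trans (pow_add_pow_le _ _ _)⟩

theorem PolyBdd.mul (hf : PolyBdd N f) (hg : PolyBdd N g) : PolyBdd N fun i => f i * g i := by
  obtain ⟨c, hc⟩ := hf
  obtain ⟨d, hd⟩ := hg
  exact ⟨c + d, fun i => (Nat.mul_le_mul (hc i) (hd i)).trans (by rw [pow_add])⟩

theorem PolyBdd.pow (hf : PolyBdd N f) (m : ℕ) : PolyBdd N fun i => f i ^ m := by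
  obtain ⟨c, hc⟩ := hf
  exact ⟨c * m, fun i => (Nat.pow_le_pow_left (hc i) m).trans (by rw [pow_mul])⟩

theorem PolyBdd.mono (hf : PolyBdd N f) (h : ∀ i, g i ≤ f i) : PolyBdd N g := by
  obtain ⟨c, hc⟩ := hf
  exact ⟨c, fun i => (h i).trans (hc i)⟩

theorem PolyBdd.reindex {κ : Type} (φ : κ → ι) (hf : PolyBdd N f) :
    PolyBdd (fun j => N (φ j)) fun j => f (φ j) := by
  obtain ⟨c, hc⟩ := hf
  exact ⟨c, fun j => hc (φ j)⟩

end PolyBdd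

@[simp] theorem Store.start_zero (a : Val) : Store.start a 0 = a := if_pos rfl

theorem PolyTime.of_bdd {ι : Type} {N f : ι → ℕ} {a b : ι → Val} (p : Prog) (hf : PolyBdd N f)
    (h : ∀ i, ∃ t ≤ f i, p.RunsTo (a i) (b i) t) : PolyTime N a b := by
  obtain ⟨c, hc⟩ := hf
  refine ⟨p, c, fun i => ?_⟩
  obtain ⟨t, ht, hr⟩ := h i
  exact ⟨t, ht.trans (hc i), hr⟩

/-! ### Closure properties of polynomial-time computability -/

section PolyTime

variable {ι : Type} {N : ι → ℕ} {a b c : ι → Val}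

/-- The index types are arbitrary so that a computation inside a loop or below a quantifier is an
old statement pulled back to the type of loop positions, or of bound vertices. -/
theorem PolyTime.reindex {κ : Type} (φ : κ → ι) (h : PolyTime N a b) :
    PolyTime (fun j => N (φ j)) (fun j => a (φ j)) fun j => b (φ j) := by
  obtain ⟨p, c, h⟩ := h
  exact ⟨p, c, fun j => h (φ j)⟩

theorem PolyTime.mono {M : ι → ℕ} (h : PolyTime M a b) (hM : PolyBdd N M) : PolyTime N a b := by
  obtain ⟨p, c, h⟩ := h
  exact .of_bdd p ((hM.add (.const 2)).pow c) h

theorem PolyTime.id : PolyTime N a a :=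
  .of_bdd .skip (.const 1) fun _ => ⟨1, le_rfl, _, .skip _, rfl⟩

theorem PolyTime.expr (e : Expr) (h : ∀ i, e.eval (Store.start (a i)) = b i) : PolyTime N a b :=
  .of_bdd (.assign 0 e) (.const (e.cost + 1)) fun i => ⟨_, le_rfl, _, .assign _ _ _, by simp [h]⟩

theorem PolyTime.nil : PolyTime N a fun _ => Val.nil := .expr .nil fun _ => rfl

theorem PolyTime.comp (hb : PolyTime N a b) (hc : PolyTime N b c) : PolyTime N a c := by
  obtain ⟨p, m, hp⟩ := hb
  obtain ⟨q, l, hq⟩ := hc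
  refine .of_bdd (.seq (.call 0 p (.var 0)) (.call 0 q (.var 0)))
    (f := fun i => (N i + 2) ^ m + (N i + 2) ^ l + 5)
    (.add (.add ⟨m, fun _ => le_rfl⟩ ⟨l, fun _ => le_rfl⟩) (.const 5)) fun i => ?_
  obtain ⟨t, ht, σ, hσ, e⟩ := hp i
  obtain ⟨s, hs, τ, hτ, e'⟩ := hq i
  have h1 : Exec (.call 0 p (.var 0)) (Store.start (a i)) _ (1 + t + 1) :=
    Exec.call (e := .var 0) (x := 0) (p := p) (σ := Store.start (a i)) hσ
  have h2 : Exec (.call 0 q (.var 0)) (Function.update (Store.start (a i)) 0 (σ 0)) _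
      (1 + s + 1) := Exec.call (e := .var 0) (x := 0) (p := q) (by simpa [Expr.eval, e] using hτ)
  exact ⟨_, by omega, _, h1.seq h2, by simp [e']⟩

theorem PolyTime.cons (hb : PolyTime N a b) (hc : PolyTime N a c) :
    PolyTime N a fun i => Val.cons (b i) (c i) := by
  obtain ⟨p, m, hp⟩ := hb
  obtain ⟨q, l, hq⟩ := hc
  refine .of_bdd (.seq (.call 1 p (.var 0)) (.seq (.call 2 q (.var 0))
    (.assign 0 (.cons (.var 1) (.var 2)))))
    (f := fun i => (N i + 2) ^ m + (N i + 2) ^ l + 10)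
    (.add (.add ⟨m, fun _ => le_rfl⟩ ⟨l, fun _ => le_rfl⟩) (.const 10)) fun i => ?_
  obtain ⟨t, ht, σ, hσ, e⟩ := hp i
  obtain ⟨s, hs, τ, hτ, e'⟩ := hq i
  have h1 : Exec (.call 1 p (.var 0)) (Store.start (a i)) _ (1 + t + 1) :=
    Exec.call (e := .var 0) (x := 1) (p := p) (σ := Store.start (a i)) hσ
  have h2 : Exec (.call 2 q (.var 0)) (Function.update (Store.start (a i)) 1 (σ 0)) _
      (1 + s + 1) :=
    Exec.call (e := .var 0) (x := 2) (p := q) (by simpa [Expr.eval, e] using hτ)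
  refine ⟨_, ?_, _, h1.seq (h2.seq (.assign _ _ _)), by simp [Expr.eval, e, e']⟩
  simp only [Expr.cost]
  omega

theorem PolyTime.hd (h : PolyTime N a b) : PolyTime N a fun i => (b i).hd :=
  h.comp (.expr (.hd (.var 0)) fun _ => rfl)

theorem PolyTime.tl (h : PolyTime N a b) : PolyTime N a fun i => (b i).tl :=
  h.comp (.expr (.tl (.var 0)) fun _ => rfl)

theorem PolyTime.congr (h : PolyTime N a b) (hbc : ∀ i, b i = c i) : PolyTime N a c := by
  rwa [← funext hbc]

open Classical in
/-- Only the branch that is taken has to be computable. -/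
theorem PolyTime.dite {P : ι → Prop} (hP : PolyTime N a fun i => encProp (P i))
    (hb : PolyTime (fun i : {i // P i} => N i) (fun i => a i) fun i => b i)
    (hc : PolyTime (fun i : {i // ¬ P i} => N i) (fun i => a i) fun i => c i) :
    PolyTime N a fun i => if P i then b i else c i := by
  obtain ⟨o, n, ho⟩ := hP
  obtain ⟨p, m, hp⟩ := hb
  obtain ⟨q, l, hq⟩ := hc
  refine .of_bdd (.seq (.call 1 o (.var 0)) (.cond (.var 1) (.call 0 p (.var 0))
    (.call 0 q (.var 0)))) (f := fun i => (N i + 2) ^ n + (N i + 2) ^ m + (N i + 2) ^ l + 10)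
    (.add (.add (.add ⟨n, fun _ => le_rfl⟩ ⟨m, fun _ => le_rfl⟩) ⟨l, fun _ => le_rfl⟩)
      (.const 10)) fun i => ?_
  obtain ⟨t, ht, σ, hσ, e⟩ := ho i
  have h1 : Exec (.call 1 o (.var 0)) (Store.start (a i)) _ (1 + t + 1) :=
    Exec.call (e := .var 0) (x := 1) (p := o) (σ := Store.start (a i)) hσ
  by_cases hi : P i
  · obtain ⟨s, hs, τ, hτ, e'⟩ := hp ⟨i, hi⟩
    have h2 : Exec (.call 0 p (.var 0)) (Function.update (Store.start (a i)) 1 (σ 0)) _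
      (1 + s + 1) := Exec.call (e := .var 0) (x := 0) (p := p) (by simpa [Expr.eval] using hτ)
    refine ⟨_, ?_, _, h1.seq (.cond_true ?_ h2), by simp [hi, e']⟩
    · simp only [Expr.cost]
      simp only at hs
      omega
    · simp [Expr.eval, e, encProp, hi]
  · obtain ⟨s, hs, τ, hτ, e'⟩ := hq ⟨i, hi⟩
    have h2 : Exec (.call 0 q (.var 0)) (Function.update (Store.start (a i)) 1 (σ 0)) _
      (1 + s + 1) := Exec.call (e := .var 0) (x := 0) (p := q) (by simpa [Expr.eval] using hτ)
    refine ⟨_, ?_, _, h1.seq (.cond_false ?_ h2), by simp [hi, e']⟩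
    · simp only [Expr.cost]
      simp only at hs
      omega
    · simp [Expr.eval, e, encProp, hi]

open Classical in
theorem PolyTime.ite {P : ι → Prop} (hP : PolyTime N a fun i => encProp (P i))
    (hb : PolyTime N a b) (hc : PolyTime N a c) :
    PolyTime N a fun i => if P i then b i else c i :=
  .dite hP (hb.reindex Subtype.val) (hc.reindex Subtype.val)

theorem PolyTime.true : PolyTime N a fun _ => encProp True :=
  .congr (.cons .nil .nil) fun _ => by simp [encProp]

theorem PolyTime.false : PolyTime N a fun _ => encProp False :=
  .congr .nil fun _ => by simp [encProp]

theorem PolyTime.not {P : ι → Prop} (hP : PolyTime N a fun i => encProp (P i)) :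
    PolyTime N a fun i => encProp (¬ P i) :=
  .congr (.ite hP .false .true) fun i => by by_cases h : P i <;> simp [h]

theorem PolyTime.and {P Q : ι → Prop} (hP : PolyTime N a fun i => encProp (P i))
    (hQ : PolyTime N a fun i => encProp (Q i)) : PolyTime N a fun i => encProp (P i ∧ Q i) :=
  .congr (.ite hP hQ .false) fun i => by by_cases h : P i <;> simp [h]

theorem PolyTime.or {P Q : ι → Prop} (hP : PolyTime N a fun i => encProp (P i))
    (hQ : PolyTime N a fun i => encProp (Q i)) : PolyTime N a fun i => encProp (P i ∨ Q i) :=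
  .congr (.ite hP .true hQ) fun i => by by_cases h : P i <;> simp [h]

/-- A loop along a list `l i`, which turns `b i j` into `b i (j + 1)` for the successive `j`. -/
theorem PolyTime.loop {l : ι → List Val} {b : ι → ℕ → Val}
    (hl : PolyTime N a fun i => encList (l i)) (hlen : PolyBdd N fun i => (l i).length)
    (h0 : PolyTime N a fun i => b i 0)
    (hs : PolyTime (fun q : Σ i, Fin (l i).length => N q.1)
      (fun q => Val.cons (Val.cons ((l q.1)[q.2]) (b q.1 q.2)) (a q.1))
      (fun q => b q.1 (q.2 + 1))) :
    PolyTime N a fun i => b i (l i).length := by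
  obtain ⟨pl, cl, hpl⟩ := hl
  obtain ⟨p0, c0, hp0⟩ := h0
  obtain ⟨ps, cs, hps⟩ := hs
  -- Variable 0 keeps the input, 1 holds the current `b i j`, and 2 holds the rest of the list. The
  -- time bound of the body is uniform in `j`.
  refine .of_bdd (.seq (.call 2 pl (.var 0)) (.seq (.call 1 p0 (.var 0)) (.seq
    (.loop (.var 2) (.seq (.call 1 ps (.cons (.cons (.hd (.var 2)) (.var 1)) (.var 0)))
      (.assign 2 (.tl (.var 2))))) (.assign 0 (.var 1)))))
    (f := fun i => (N i + 2) ^ cl + (N i + 2) ^ c0 + (l i).length * ((N i + 2) ^ cs + 20) + 20)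
    (.add (.add (.add ⟨cl, fun _ => le_rfl⟩ ⟨c0, fun _ => le_rfl⟩)
      (.mul hlen (.add ⟨cs, fun _ => le_rfl⟩ (.const 20)))) (.const 20)) fun i => ?_
  -- Induction on the number `m` of elements that remain from position `j` on.
  have key : ∀ m j, j + m = (l i).length → ∀ σ : Store, σ 0 = a i → σ 1 = b i j →
      σ 2 = encList ((l i).drop j) → ∃ t ≤ m * ((N i + 2) ^ cs + 20) + 2, ∃ σ',
      Exec (.loop (.var 2) (.seq (.call 1 ps (.cons (.cons (.hd (.var 2)) (.var 1)) (.var 0)))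
      (.assign 2 (.tl (.var 2))))) σ σ' t ∧ σ' 1 = b i (l i).length := by
    intro m
    induction m with
    | zero =>
      intro j hj σ _ h1 h2
      refine ⟨2, by omega, σ, .loop_done ?_, ?_⟩
      · rw [Expr.eval, h2, List.drop_of_length_le (by omega)]
        rfl
      · rw [h1]
        congr 1
    | succ m ih =>
      intro j hj σ h0 h1 h2
      have hjl : j < (l i).length := by omega
      rw [List.drop_eq_getElem_cons hjl] at h2
      obtain ⟨s, hs, τ, hτ, e⟩ := hps ⟨i, ⟨j, hjl⟩⟩
      have hc : Exec (.call 1 ps (.cons (.cons (.hd (.var 2)) (.var 1)) (.var 0))) σ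
          (Function.update σ 1 (τ 0)) (6 + s + 1) :=
        Exec.call (e := .cons (.cons (.hd (.var 2)) (.var 1)) (.var 0)) (x := 1) (p := ps)
          (by simpa [Expr.eval, h0, h1, h2, encList, Val.hd] using hτ)
      have hb := hc.seq (.assign (Function.update σ 1 (τ 0)) 2 (.tl (.var 2)))
      obtain ⟨t, ht, σ', hσ', e'⟩ := ih (j + 1) (by omega)
        (Function.update (Function.update σ 1 (τ 0)) 2
          (Expr.eval (Function.update σ 1 (τ 0)) (.tl (.var 2))))
        (by simp [h0]) (by simp [e]) (by simp [Expr.eval, h2, encList, Val.tl])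
      refine ⟨_, ?_, σ', .loop_step ?_ hb hσ', e'⟩
      · simp only [Expr.cost, Nat.succ_mul]
        simp only at hs
        omega
      · simp [Expr.eval, h2, encList]
  obtain ⟨t, ht, σ, hσ, e⟩ := hpl i
  obtain ⟨s, hs, τ, hτ, e'⟩ := hp0 i
  have h1 : Exec (.call 2 pl (.var 0)) (Store.start (a i)) _ (1 + t + 1) :=
    Exec.call (e := .var 0) (x := 2) (p := pl) (σ := Store.start (a i)) hσ
  have h2 : Exec (.call 1 p0 (.var 0)) (Function.update (Store.start (a i)) 2 (σ 0)) _
      (1 + s + 1) := Exec.call (e := .var 0) (x := 1) (p := p0) (by simpa [Expr.eval] using hτ)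
  obtain ⟨u, hu, ρ, hρ, e''⟩ := key (l i).length 0 (by omega)
    (Function.update (Function.update (Store.start (a i)) 2 (σ 0)) 1 (τ 0))
    (by simp [Store.start]) (by simp [e']) (by simp [e])
  refine ⟨_, ?_, _, h1.seq (h2.seq (hρ.seq (.assign _ _ _))), by simp [Expr.eval, e'']⟩
  simp only [Expr.cost]
  omega

end PolyTime

/-! ### Numbers, tables, quantifiers, cardinalities, reachability -/

theorem encNat_eq_encList (m : ℕ) : encNat m = encList (List.replicate m Val.nil) := by
  induction m with
  | zero => rfl
  | succ m ih => rw [encNat, ih, List.replicate_succ, encList]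

section Derived

variable {ι : Type} {N : ι → ℕ} {a : ι → Val}

/-- A loop that is executed `m i` times. -/
theorem PolyTime.iterate {m : ι → ℕ} {b : ι → ℕ → Val} (hm : PolyTime N a fun i => encNat (m i))
    (hlen : PolyBdd N m) (h0 : PolyTime N a fun i => b i 0)
    (hs : PolyTime (fun q : Σ i, Fin (m i) => N q.1)
      (fun q => Val.cons (b q.1 q.2) (a q.1)) (fun q => b q.1 (q.2 + 1))) :
    PolyTime N a fun i => b i (m i) := by
  have h := PolyTime.loop (N := N) (a := a) (b := b) (l := fun i => List.replicate (m i) Val.nil)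
    (hm.congr fun i => encNat_eq_encList _) (by simpa using hlen) h0
    (.comp (.cons (.tl (.hd .id)) (.tl .id))
      (hs.reindex fun q : Σ i, Fin (List.replicate (m i) Val.nil).length =>
        (⟨q.1, q.2.cast (by simp)⟩ : Σ i, Fin (m i))))
  simpa using h

theorem PolyTime.const_nat (m : ℕ) : PolyTime N a fun _ => encNat m := by
  induction m with
  | zero => exact .nil
  | succ m ih => exact .cons .nil ih

theorem PolyTime.tl_iterate {b : ι → Val} {m : ι → ℕ} (hm : PolyTime N a fun i => encNat (m i))
    (hlen : PolyBdd N m) (hb : PolyTime N a b) : PolyTime N a fun i => Val.tl^[m i] (b i) :=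
  .iterate (b := fun i j => Val.tl^[j] (b i)) hm hlen hb
    (.congr (.tl (.hd .id)) fun q => by rw [Function.iterate_succ_apply']; rfl)

theorem tl_iterate_encList (l : List Val) (j : ℕ) : Val.tl^[j] (encList l) = encList (l.drop j) := by
  induction j with
  | zero => rfl
  | succ j ih =>
    rw [Function.iterate_succ_apply', ih]
    by_cases h : j < l.length
    · rw [List.drop_eq_getElem_cons h]; rfl
    · rw [List.drop_of_length_le (by omega), List.drop_of_length_le (by omega)]; rfl

/-- Drop `y` cells of the unary number `x` and test for `nil`. Only `y` needs a bound; this permits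
comparing an arbitrarily large parameter with a number of vertices in time polynomial in `n`. -/
theorem PolyTime.nat_le {x y : ι → ℕ} (hx : PolyTime N a fun i => encNat (x i))
    (hy : PolyTime N a fun i => encNat (y i)) (h : PolyBdd N y) :
    PolyTime N a fun i => encProp (x i ≤ y i) := by
  have h := PolyTime.tl_iterate hy h hx
  obtain ⟨p, c, hp⟩ : PolyTime N (fun i => Val.tl^[y i] (encNat (x i)))
      (fun i => encProp (x i ≤ y i)) := by
    refine .of_bdd (.cond (.var 0) (.assign 0 .nil) (.assign 0 (.cons .nil .nil))) (.const 10)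
      fun i => ?_
    rw [encNat_eq_encList, tl_iterate_encList]
    by_cases hi : x i ≤ y i
    · refine ⟨_, ?_, _, .cond_false ?_ (.assign _ _ _), ?_⟩
      · simp [Expr.cost]
      · rw [List.drop_of_length_le (by simpa using hi)]; rfl
      · simp [encProp, hi, Expr.eval]
    · refine ⟨_, ?_, _, .cond_true ?_ (.assign _ _ _), ?_⟩
      · simp [Expr.cost]
      · rw [List.drop_eq_getElem_cons (by simpa using hi)]; simp [encList, Expr.eval, Store.start]
      · simp [encProp, hi, Expr.eval]
  exact h.comp ⟨p, c, hp⟩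

theorem PolyTime.getElem {n : ι → ℕ} {f : ∀ i, Fin (n i) → Val} {v : ∀ i, Fin (n i)}
    (hf : PolyTime N a fun i => encList (List.ofFn (f i)))
    (hv : PolyTime N a fun i => encNat (v i)) (hn : PolyBdd N n) :
    PolyTime N a fun i => f i (v i) := by
  refine (PolyTime.hd (.tl_iterate hv (hn.mono fun i => (v i).2.le) hf)).congr fun i => ?_
  rw [tl_iterate_encList, List.drop_eq_getElem_cons (by simp)]
  simp [encList, Val.hd]

theorem PolyTime.length {l : ι → List Val} (hl : PolyTime N a fun i => encList (l i))
    (h : PolyBdd N fun i => (l i).length) : PolyTime N a fun i => encNat (l i).length :=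
  .loop (b := fun _ j => encNat j) hl h .nil (.cons .nil (.tl (.hd .id)))

/-- The numbers `j - 1, …, 0`. -/
theorem PolyTime.range {n : ι → ℕ} (hn : PolyTime N a fun i => encNat (n i)) (h : PolyBdd N n) :
    PolyTime N a fun i => encList ((List.range (n i)).reverse.map encNat) := by
  refine PolyTime.tl (b := fun i => Val.cons (encNat (n i))
    (encList ((List.range (n i)).reverse.map encNat))) ?_
  refine .iterate (b := fun i j => Val.cons (encNat j) (encList ((List.range j).reverse.map encNat)))
    hn h (.cons .nil .nil) ?_
  refine .congr (.cons (.cons .nil (.hd (.hd .id))) (.cons (.hd (.hd .id)) (.tl (.hd .id))))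
    fun q => ?_
  simp [List.range_succ, Val.hd, Val.tl, encNat, encList]

/-- A list grows at its front, so the loop runs through `n - 1, …, 0` and after `j` rounds holds the
last `j` entries. -/
theorem PolyTime.table {n : ι → ℕ} {f : ∀ i, Fin (n i) → Val}
    (hn : PolyTime N a fun i => encNat (n i)) (h : PolyBdd N n)
    (hf : PolyTime (fun q : Σ i, Fin (n i) => N q.1) (fun q => Val.cons (encNat q.2) (a q.1))
      (fun q => f q.1 q.2)) : PolyTime N a fun i => encList (List.ofFn (f i)) := by
  have h := PolyTime.loop (N := N) (a := a)
    (b := fun i j => encList ((List.ofFn (f i)).drop (n i - j)))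
    (l := fun i => (List.range (n i)).reverse.map encNat) (.range hn h) (by simpa using h)
    (PolyTime.nil.congr fun i => by simp [List.drop_of_length_le, encList]) ?_
  · simpa using h
  · have hq : ∀ q : Σ i, Fin ((List.range (n i)).reverse.map encNat).length,
        n q.1 - 1 - q.2 < n q.1 := fun q => by
      have := q.2.2
      simp only [List.length_map, List.length_reverse, List.length_range] at this
      omega
    have hd : PolyTime (fun q : Σ i, Fin ((List.range (n i)).reverse.map encNat).length => N q.1)
        (fun q => Val.cons (Val.cons (((List.range (n q.1)).reverse.map encNat)[q.2])
          (encList ((List.ofFn (f q.1)).drop (n q.1 - q.2)))) (a q.1))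
        fun q => f q.1 ⟨n q.1 - 1 - q.2, hq q⟩ :=
      .comp (.congr (.cons (.hd (.hd .id)) (.tl .id)) fun q => by
        simp only [Fin.getElem_fin, List.getElem_map, List.getElem_reverse, List.getElem_range,
          List.length_range, Val.hd, Val.tl])
        (hf.reindex fun q => (⟨q.1, ⟨n q.1 - 1 - q.2, hq q⟩⟩ : Σ i, Fin (n i)))
    refine .congr (.cons hd (.tl (.hd .id))) fun q => ?_
    have := q.2.2
    simp only [List.length_map, List.length_reverse, List.length_range] at this
    have e : n q.1 - (q.2 + 1) = n q.1 - 1 - q.2 := by omega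
    have e' : n q.1 - 1 - q.2 + 1 = n q.1 - q.2 := by omega
    rw [e, List.drop_eq_getElem_cons (i := n q.1 - 1 - q.2) (by simpa only [List.length_ofFn] using hq q), e']
    simp only [List.getElem_ofFn]
    rfl

theorem PolyTime.exists {n : ι → ℕ} {P : ∀ i, Fin (n i) → Prop}
    (hn : PolyTime N a fun i => encNat (n i)) (h : PolyBdd N n)
    (hP : PolyTime (fun q : Σ i, Fin (n i) => N q.1) (fun q => Val.cons (encNat q.2) (a q.1))
      (fun q => encProp (P q.1 q.2))) : PolyTime N a fun i => encProp (∃ v, P i v) := by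
  have h := PolyTime.loop (N := N) (a := a)
    (b := fun i j => encProp (∃ v : Fin (n i), (v : ℕ) < j ∧ P i v))
    (l := fun i => List.ofFn fun v => encProp (P i v)) (.table hn h hP) (by simpa using h)
    (PolyTime.false.congr fun i => by simp) ?_
  · refine h.congr fun i => ?_
    simp
  · refine .congr (.or (P := fun q => P q.1 (q.2.cast (by simp)))
      (Q := fun q => ∃ v : Fin (n q.1), (v : ℕ) < q.2 ∧ P q.1 v)
      ((PolyTime.hd (.hd .id)).congr fun q => ?_) (.tl (.hd .id))) fun q => ?_
    · simp [Val.hd]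
      rfl
    · congr 1
      refine propext ⟨?_, ?_⟩
      · rintro (h | ⟨v, h, h'⟩)
        · exact ⟨_, by simp, h⟩
        · exact ⟨v, by omega, h'⟩
      · rintro ⟨v, h, h'⟩
        rcases Nat.lt_succ_iff_lt_or_eq.1 h with h | h
        · exact .inr ⟨v, h, h'⟩
        · left
          convert h'
          exact Fin.ext h.symm

theorem PolyTime.count {n : ι → ℕ} {P : ∀ i, Fin (n i) → Prop}
    (hn : PolyTime N a fun i => encNat (n i)) (h : PolyBdd N n)
    (hP : PolyTime (fun q : Σ i, Fin (n i) => N q.1) (fun q => Val.cons (encNat q.2) (a q.1))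
      (fun q => encProp (P q.1 q.2))) : PolyTime N a fun i => encNat {v | P i v}.ncard := by
  classical
  have h := PolyTime.loop (N := N) (a := a)
    (b := fun i j => encNat {v : Fin (n i) | (v : ℕ) < j ∧ P i v}.ncard)
    (l := fun i => List.ofFn fun v => encProp (P i v)) (.table hn h hP) (by simpa using h)
    (PolyTime.nil.congr fun i => by simp [encNat]) ?_
  · refine h.congr fun i => ?_
    simp
  · refine .congr (.ite (P := fun q => P q.1 (q.2.cast (by simp)))
      ((PolyTime.hd (.hd .id)).congr fun q => ?_) (.cons .nil (.tl (.hd .id)))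
      (.tl (.hd .id))) fun q => ?_
    · simp [Val.hd]
      rfl
    · have e : {v : Fin (n q.1) | (v : ℕ) < q.2 + 1 ∧ P q.1 v} =
          if P q.1 (q.2.cast (by simp)) then
            insert (q.2.cast (by simp)) {v : Fin (n q.1) | (v : ℕ) < q.2 ∧ P q.1 v}
          else {v : Fin (n q.1) | (v : ℕ) < q.2 ∧ P q.1 v} := by
        ext v
        by_cases hv : v = q.2.cast (by simp)
        · subst hv
          split_ifs with h <;> simp [h]
        · have : (v : ℕ) < q.2 + 1 ↔ (v : ℕ) < q.2 := by
            have : (v : ℕ) ≠ q.2 := fun h => hv (Fin.ext h)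
            omega
          split_ifs with h <;> simp only [Set.mem_ofPred_eq, Set.mem_insert_iff, hv, this, false_or]
      rw [e]
      split_ifs with h
      · rw [Set.ncard_insert_of_notMem (by simp)]
        rfl
      · rfl

end Derived
end SpanningLeaf
namespace SpanningLeaf

/-! ### Digraphs and reachability -/

section Digraphs

variable {ι : Type} {N : ι → ℕ} {a : ι → Val}

/-- The characteristic vector of a set of vertices. -/
noncomputable def encSet {n : ℕ} (S : Set (Fin n)) : Val := encList (List.ofFn fun v => encProp (v ∈ S))

theorem PolyTime.mem {n : ι → ℕ} {S : ∀ i, Set (Fin (n i))} {v : ∀ i, Fin (n i)}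
    (hS : PolyTime N a fun i => encSet (S i)) (hv : PolyTime N a fun i => encNat (v i))
    (hn : PolyBdd N n) : PolyTime N a fun i => encProp (v i ∈ S i) :=
  .getElem (f := fun i v => encProp (v ∈ S i)) hS hv hn

theorem PolyTime.adj {n : ι → ℕ} {D : ∀ i, Digraph (Fin (n i))} {u v : ∀ i, Fin (n i)}
    (hD : PolyTime N a fun i => encDigraph (D i)) (hu : PolyTime N a fun i => encNat (u i))
    (hv : PolyTime N a fun i => encNat (v i)) (hn : PolyBdd N n) :
    PolyTime N a fun i => encProp ((D i).Adj (u i) (v i)) :=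
  .getElem (f := fun i v => encProp ((D i).Adj (u i) v))
    (.getElem (f := fun i u => encList (List.ofFn fun v => encProp ((D i).Adj u v))) hD hu hn) hv hn

theorem PolyTime.set {n : ι → ℕ} {S : ∀ i, Set (Fin (n i))}
    (hn : PolyTime N a fun i => encNat (n i)) (h : PolyBdd N n)
    (hS : PolyTime (fun q : Σ i, Fin (n i) => N q.1) (fun q => Val.cons (encNat q.2) (a q.1))
      (fun q => encProp (q.2 ∈ S q.1))) : PolyTime N a fun i => encSet (S i) :=
  .table hn h hS

theorem PolyTime.digraph {n : ι → ℕ} {D : ∀ i, Digraph (Fin (n i))}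
    (hn : PolyTime N a fun i => encNat (n i)) (h : PolyBdd N n)
    (hD : PolyTime (fun q : Σ p : Σ i, Fin (n i), Fin (n p.1) => N q.1.1)
      (fun q => Val.cons (encNat q.2) (Val.cons (encNat q.1.2) (a q.1.1)))
      (fun q => encProp ((D q.1.1).Adj q.1.2 q.2))) : PolyTime N a fun i => encDigraph (D i) :=
  .table hn h (.table (.comp (.tl .id) (hn.reindex Sigma.fst)) (h.reindex Sigma.fst) hD)

/-- The order is not a separate part of the input; it is recovered as the number of rows. -/
theorem PolyTime.order {n : ι → ℕ} {D : ∀ i, Digraph (Fin (n i))}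
    (hD : PolyTime N a fun i => encDigraph (D i)) (hn : PolyBdd N n) :
    PolyTime N a fun i => encNat (n i) := by
  have h := PolyTime.length hD (by simpa using hn)
  simpa using h

/-- The vertices that are reachable from `x` in at most `j` steps. -/
def reachIn {V : Type*} (D : Digraph V) (x : V) : ℕ → Set V
  | 0 => {x}
  | j + 1 => {v | v ∈ reachIn D x j ∨ ∃ u, u ∈ reachIn D x j ∧ D.Adj u v}

/-- Each round adds a vertex until the set is closed under arcs; with only `n` vertices it must be
closed after `n` rounds. -/
theorem reachIn_closed_or {n : ℕ} (D : Digraph (Fin n)) (x : Fin n) (j : ℕ) :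
    (∀ u v, u ∈ reachIn D x j → D.Adj u v → v ∈ reachIn D x j) ∨ j + 1 ≤ (reachIn D x j).ncard := by
  induction j with
  | zero => right; simp [reachIn]
  | succ j ih =>
    by_cases hc : ∀ u v, u ∈ reachIn D x j → D.Adj u v → v ∈ reachIn D x j
    · have : reachIn D x (j + 1) = reachIn D x j := by
        ext v
        exact ⟨fun h => h.elim id fun ⟨u, hu, huv⟩ => hc u v hu huv, Or.inl⟩
      rw [this]
      exact .inl hc
    · right
      have h := ih.resolve_left hc
      push Not at hc
      obtain ⟨u, v, hu, huv, hv⟩ := hc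
      have : reachIn D x j ⊂ reachIn D x (j + 1) :=
        ⟨fun w hw => .inl hw, fun hs => hv (hs (.inr ⟨u, hu, huv⟩))⟩
      have := Set.ncard_lt_ncard this (Set.toFinite _)
      omega

theorem reach_iff_mem_reachIn {n : ℕ} (D : Digraph (Fin n)) (x y : Fin n) :
    Reach D x y ↔ y ∈ reachIn D x n := by
  constructor
  · intro h
    have hc := (reachIn_closed_or D x n).resolve_right (by
      have := Set.ncard_le_card (reachIn D x n)
      simp at this
      omega)
    have hx : ∀ j, x ∈ reachIn D x j := fun j => by
      induction j with
      | zero => rfl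
      | succ j ih => exact .inl ih
    induction h with
    | refl => exact hx n
    | tail _ h ih => exact hc _ _ ih h
  · have : ∀ j y, y ∈ reachIn D x j → Reach D x y := fun j => by
      induction j with
      | zero => rintro y rfl; exact .refl
      | succ j ih =>
        rintro y (h | ⟨u, hu, huy⟩)
        · exact ih y h
        · exact (ih u hu).tail huy
    exact this n y

theorem PolyTime.reach {n : ι → ℕ} {D : ∀ i, Digraph (Fin (n i))} {u v : ∀ i, Fin (n i)}
    (hD : PolyTime N a fun i => encDigraph (D i)) (hu : PolyTime N a fun i => encNat (u i))
    (hv : PolyTime N a fun i => encNat (v i)) (hn : PolyBdd N n) :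
    PolyTime N a fun i => encProp (Reach (D i) (u i) (v i)) := by
  refine .congr (.mem (S := fun i => reachIn (D i) (u i) (n i)) ?_ hv hn)
    fun i => by rw [reach_iff_mem_reachIn]
  refine .iterate (b := fun i j => encSet (reachIn (D i) (u i) j)) (hD.order hn) hn ?_ ?_
  · refine .set (hD.order hn) hn (.congr (.and
      -- The search starts from the singleton of `u i`, whose characteristic vector is computed by
      -- two comparisons.
      (.nat_le (.comp (.tl .id) (hu.reindex Sigma.fst)) (.hd .id)
        ((hn.reindex Sigma.fst).mono fun q => q.2.2.le))
      (.nat_le (.hd .id) (.comp (.tl .id) (hu.reindex Sigma.fst))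
        ((hn.reindex Sigma.fst).mono fun q => (u q.1).2.le))) fun q => ?_)
    congr 1
    simp only [reachIn, Set.mem_singleton_iff, Fin.ext_iff, eq_iff_iff]
    omega
  · have hn' := hn.reindex (fun q : Σ i, Fin (n i) => q.1)
    have ho : PolyTime (fun q : Σ i, Fin (n i) => N q.1)
      (fun q => Val.cons (encSet (reachIn (D q.1) (u q.1) q.2)) (a q.1)) fun q => encNat (n q.1) :=
        .comp (.tl .id) ((hD.order hn).reindex _)
    let φ := fun q : Σ p : (Σ q : (Σ i, Fin (n i)), Fin (n q.1)), Fin (n p.1.1) => q.1.1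
    refine .set ho hn' (.or (.mem (.hd (.tl .id)) (.hd .id) (hn'.reindex Sigma.fst))
      (.exists (.comp (.tl .id) (ho.reindex Sigma.fst)) (hn'.reindex Sigma.fst) (.and
        (.mem (.hd (.tl (.tl .id))) (.hd .id) (hn'.reindex φ))
        (.adj (.comp (.tl (.tl (.tl .id))) (hD.reindex fun q => (φ q).1))
          (.hd .id) (.hd (.tl .id)) (hn'.reindex φ)))))

end Digraphs

/-! ### Formulas -/

/-- Four digraphs on the same vertices, and two numbers. -/
structure Str where
  n : ℕ
  rel : Fin 4 → Digraph (Fin n)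
  num : Fin 2 → ℕ

/-- The encoding of a structure. -/
noncomputable def encStr (S : Str) : Val :=
  Val.cons (encNat S.n) (Val.cons (encList (List.ofFn fun j => encDigraph (S.rel j)))
    (encList (List.ofFn fun j => encNat (S.num j))))

/-- Formulas with `m` free variables, for vertices of a structure; variable `0` is the one that
has been bound last. -/
inductive Fml : ℕ → Type where
  /-- There is an arc of the `j`-th digraph from `x` to `y`. -/
  | rel {m : ℕ} : Fin 4 → Fin m → Fin m → Fml m
  | le {m : ℕ} : Fin m → Fin m → Fml m
  | not {m : ℕ} : Fml m → Fml m
  | and {m : ℕ} : Fml m → Fml m → Fml m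
  | ex {m : ℕ} : Fml (m + 1) → Fml m
  /-- At most as many vertices satisfy the first formula as the second one. -/
  | cle {m : ℕ} : Fml (m + 1) → Fml (m + 1) → Fml m
  /-- The `j`-th number is at most the number of vertices that satisfy the formula. -/
  | kle {m : ℕ} : Fin 2 → Fml (m + 1) → Fml m
  /-- The vertex `y` is reachable from `x` by arcs `(v₁, v₀)` that satisfy the formula. -/
  | tc {m : ℕ} : Fml (m + 2) → Fin m → Fin m → Fml m

namespace Fml

/-- The meaning of a formula. -/
def sem (S : Str) : {m : ℕ} → Fml m → (Fin m → Fin S.n) → Prop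
  | _, rel j x y, s => (S.rel j).Adj (s x) (s y)
  | _, le x y, s => s x ≤ s y
  | _, not φ, s => ¬ φ.sem S s
  | _, and φ ψ, s => φ.sem S s ∧ ψ.sem S s
  | _, ex φ, s => ∃ v, φ.sem S (Matrix.vecCons v s)
  | _, cle φ ψ, s => {v | φ.sem S (Matrix.vecCons v s)}.ncard ≤ {v | ψ.sem S (Matrix.vecCons v s)}.ncard
  | _, kle j φ, s => S.num j ≤ {v | φ.sem S (Matrix.vecCons v s)}.ncard
  | _, tc φ x y, s => Reach ⟨fun u v => φ.sem S (Matrix.vecCons v (Matrix.vecCons u s))⟩ (s x) (s y)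

/-- The digraph whose arcs `(v₁, v₀)` are given by a formula. -/
def digraph (S : Str) (φ : Fml 2) : Digraph (Fin S.n) := ⟨fun u v => φ.sem S ![v, u]⟩

variable {m : ℕ}

/-- Disjunction. -/
def or (φ ψ : Fml m) : Fml m := not (and (not φ) (not ψ))
/-- Universal quantification. -/
def all (φ : Fml (m + 1)) : Fml m := not (ex (not φ))
/-- Equality. -/
def eq (x y : Fin m) : Fml m := and (le x y) (le y x)
/-- Strict inequality. -/
def lt (x y : Fin m) : Fml m := not (le y x)
/-- The vertex `x` is the `j`-th number. -/
def isNum (j : Fin 2) (x : Fin m) : Fml m :=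
  and (kle j (lt 0 x.succ)) (not (ex (and (lt 0 x.succ) (kle j (lt 0 1)))))

variable (S : Str) (s : Fin m → Fin S.n)

@[simp] theorem sem_rel (j : Fin 4) (x y : Fin m) :
    (rel j x y).sem S s ↔ (S.rel j).Adj (s x) (s y) := Iff.rfl
@[simp] theorem sem_le (x y : Fin m) : (le x y).sem S s ↔ s x ≤ s y := Iff.rfl
@[simp] theorem sem_not (φ : Fml m) : (not φ).sem S s ↔ ¬ φ.sem S s := Iff.rfl
@[simp] theorem sem_and (φ ψ : Fml m) : (and φ ψ).sem S s ↔ φ.sem S s ∧ ψ.sem S s := Iff.rfl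
@[simp] theorem sem_ex (φ : Fml (m + 1)) :
    (ex φ).sem S s ↔ ∃ v, φ.sem S (Matrix.vecCons v s) := Iff.rfl
@[simp] theorem sem_cle (φ ψ : Fml (m + 1)) : (cle φ ψ).sem S s ↔
    {v | φ.sem S (Matrix.vecCons v s)}.ncard ≤ {v | ψ.sem S (Matrix.vecCons v s)}.ncard := Iff.rfl
@[simp] theorem sem_kle (j : Fin 2) (φ : Fml (m + 1)) :
    (kle j φ).sem S s ↔ S.num j ≤ {v | φ.sem S (Matrix.vecCons v s)}.ncard := Iff.rfl
@[simp] theorem sem_tc (φ : Fml (m + 2)) (x y : Fin m) : (tc φ x y).sem S s ↔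
    Reach ⟨fun u v => φ.sem S (Matrix.vecCons v (Matrix.vecCons u s))⟩ (s x) (s y) := Iff.rfl
@[simp] theorem sem_or (φ ψ : Fml m) : (or φ ψ).sem S s ↔ φ.sem S s ∨ ψ.sem S s := by
  simp only [or, sem_not, sem_and]; tauto
@[simp] theorem sem_all (φ : Fml (m + 1)) :
    (all φ).sem S s ↔ ∀ v, φ.sem S (Matrix.vecCons v s) := by simp [all]
@[simp] theorem sem_eq (x y : Fin m) : (eq x y).sem S s ↔ s x = s y := by
  simp [eq, le_antisymm_iff]
@[simp] theorem sem_lt (x y : Fin m) : (lt x y).sem S s ↔ s x < s y := by simp [lt]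

-- A vertex is equal to the number of smaller vertices, so the formula says that `x` is the least
-- vertex that is at least the `j`-th number. In this way a root given as a number becomes available
-- to formulas.
@[simp] theorem sem_isNum (j : Fin 2) (x : Fin m) :
    (isNum j x).sem S s ↔ ((s x : Fin S.n) : ℕ) = S.num j := by
  have h : ∀ x : Fin S.n, {v | v < x}.ncard = (x : ℕ) := fun x => by
    rw [show {v | v < x} = ((Finset.Iio x : Finset (Fin S.n)) : Set (Fin S.n)) by ext; simp,
      Set.ncard_coe_finset, Fin.card_Iio]
  simp only [isNum, sem_and, sem_kle, sem_lt, sem_not, sem_ex, Matrix.cons_val_zero,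
    Matrix.cons_val_succ, Matrix.cons_val_one, h]
  constructor
  · rintro ⟨h1, h2⟩
    by_contra hne
    exact h2 ⟨⟨S.num j, by omega⟩, by simp only [Fin.lt_def]; omega, le_rfl⟩
  · intro h
    refine ⟨h.ge, ?_⟩
    rintro ⟨v, hv, h'⟩
    rw [Fin.lt_def] at hv
    omega

end Fml

/-- The encoding of a structure with an assignment of vertices to variables. -/
noncomputable def encAsg {m : ℕ} (q : Σ S : Str, Fin m → Fin S.n) : Val :=
  Val.cons (encList (List.ofFn fun x => encNat (q.2 x))) (encStr q.1)

/-- Extend an assignment. -/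
def extendAsg {m : ℕ} (q : Σ p : (Σ S : Str, Fin m → Fin S.n), Fin p.1.n) :
    Σ S : Str, Fin (m + 1) → Fin S.n := ⟨q.1.1, Matrix.vecCons q.2 q.1.2⟩

/-! ### Evaluation of formulas -/

section Eval

variable {m : ℕ}

theorem PolyTime.nth {ι : Type} {N : ι → ℕ} {a : ι → Val} {l : ι → List Val} (j : ℕ)
    (hl : PolyTime N a fun i => encList (l i)) (h : ∀ i, j < (l i).length) :
    PolyTime N a fun i => (l i)[j]'(h i) :=
  (PolyTime.hd (.tl_iterate (.const_nat j) (.const j) hl)).congr fun i => by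
    rw [tl_iterate_encList, List.drop_eq_getElem_cons (h i)]
    rfl

theorem polyTime_order : PolyTime (fun q : Σ S : Str, Fin m → Fin S.n => q.1.n) encAsg
    fun q => encNat q.1.n := .hd (.tl .id)

theorem polyTime_var (x : Fin m) : PolyTime (fun q : Σ S : Str, Fin m → Fin S.n => q.1.n) encAsg
    fun q => encNat (q.2 x) :=
  (PolyTime.nth (l := fun q : Σ S : Str, Fin m → Fin S.n => List.ofFn fun x => encNat (q.2 x)) x
    (.hd .id) (by simp)).congr (by simp only [List.getElem_ofFn, Fin.eta, implies_true])

theorem polyTime_rel (j : Fin 4) : PolyTime (fun q : Σ S : Str, Fin m → Fin S.n => q.1.n) encAsg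
    fun q => encDigraph (q.1.rel j) :=
  (PolyTime.nth (l := fun q : Σ S : Str, Fin m → Fin S.n => List.ofFn fun j => encDigraph (q.1.rel j))
    j (.hd (.tl (.tl .id))) (fun _ => by
      simp only [List.length_ofFn, j.2])).congr
    (by simp only [List.getElem_ofFn, Fin.eta, implies_true])

theorem polyTime_num (j : Fin 2) : PolyTime (fun q : Σ S : Str, Fin m → Fin S.n => q.1.n) encAsg
    fun q => encNat (q.1.num j) :=
  (PolyTime.nth (l := fun q : Σ S : Str, Fin m → Fin S.n => List.ofFn fun j => encNat (q.1.num j))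
    j (.tl (.tl (.tl .id))) (fun _ => by
      simp only [List.length_ofFn, j.2])).congr
    (by simp only [List.getElem_ofFn, Fin.eta, implies_true])

/-- The bound vertex, which stands in front of the encoded assignment, is moved to the head of its
list; this is why variable `0` is the last one bound. -/
theorem PolyTime.extendAsg
    {b : (Σ S : Str, Fin (m + 1) → Fin S.n) → Val}
    (h : PolyTime (fun q : Σ S : Str, Fin (m + 1) → Fin S.n => q.1.n) encAsg b) :
    PolyTime (fun q : Σ p : (Σ S : Str, Fin m → Fin S.n), Fin p.1.n => q.1.1.n)
      (fun q => Val.cons (encNat q.2) (encAsg q.1)) fun q => b (extendAsg q) := by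
  refine PolyTime.comp ?_ (h.reindex SpanningLeaf.extendAsg)
  refine .congr (.cons (.cons (.hd .id) (.hd (.tl .id))) (.tl (.tl .id))) fun q => ?_
  simp [SpanningLeaf.extendAsg, encAsg, Val.hd, Val.tl, List.ofFn_succ, encList]

/-- Every formula is evaluated in time polynomial in the number of vertices. -/
theorem Fml.polyTime (φ : Fml m) : PolyTime (fun q : Σ S : Str, Fin m → Fin S.n => q.1.n) encAsg
    fun q => encProp (φ.sem q.1 q.2) := by
  induction φ with
  | rel j x y => exact .adj (polyTime_rel j) (polyTime_var x) (polyTime_var y) .self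
  | le x y => exact .nat_le (polyTime_var x) (polyTime_var y) (.of_le fun q => (q.2 y).2.le)
  | not φ ih => exact ih.not
  | and φ ψ ih ih' => exact ih.and ih'
  | ex φ ih => exact .exists polyTime_order .self ih.extendAsg
  | cle φ ψ ih ih' =>
    refine .nat_le (.count polyTime_order .self ih.extendAsg)
      (.count polyTime_order .self ih'.extendAsg) (.of_le fun q => ?_)
    exact (Set.ncard_le_card _).trans (by simp)
  | kle j φ ih =>
    -- The number itself may be huge compared with `n`; only the cardinality on the right is
    -- bounded.
    refine .nat_le (polyTime_num j)
      (.count polyTime_order .self ih.extendAsg) (.of_le fun q => ?_)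
    exact (Set.ncard_le_card _).trans (by simp)
  | @tc m φ x y ih =>
    refine .reach (.digraph polyTime_order .self ?_) (polyTime_var x) (polyTime_var y) .self
    exact .comp (.congr (.cons (.hd .id) (.cons (.cons (.hd (.tl .id)) (.hd (.tl (.tl .id))))
      (.tl (.tl (.tl .id))))) fun q => by
        simp [SpanningLeaf.extendAsg, encAsg, Val.hd, Val.tl, List.ofFn_succ, encList])
      (ih.extendAsg.reindex fun q : Σ p : (Σ q : (Σ S : Str, Fin m → Fin S.n), Fin q.1.n),
        Fin p.1.1.n => ⟨SpanningLeaf.extendAsg q.1, q.2⟩)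

end Eval

/-! ### Decision problems and digraphs defined by formulas -/

section Use

variable {ι : Type} {N : ι → ℕ} {a : ι → Val} {S : ι → Str}

theorem Fml.polyTime_decide (φ : Fml 0) (hS : PolyTime N a fun i => encStr (S i))
    (hn : PolyBdd N fun i => (S i).n) : PolyTime N a fun i => encProp (φ.sem (S i) ![]) := by
  have h := φ.polyTime.reindex fun i : ι => (⟨S i, ![]⟩ : Σ S : Str, Fin 0 → Fin S.n)
  exact .comp (.congr (.cons .nil hS) fun i => by simp [encAsg, encList]) (h.mono hn)

theorem Fml.polyTime_digraph (φ : Fml 2) (hS : PolyTime N a fun i => encStr (S i))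
    (hn : PolyBdd N fun i => (S i).n) : PolyTime N a fun i => encDigraph (φ.digraph (S i)) := by
  refine .digraph (.hd hS) hn ?_
  let ψ := fun q : Σ p : Σ i, Fin (S i).n, Fin (S p.1).n => q.1.1
  have h := φ.polyTime.reindex fun q : Σ p : Σ i, Fin (S i).n, Fin (S p.1).n =>
    (⟨S q.1.1, ![q.2, q.1.2]⟩ : Σ S : Str, Fin 2 → Fin S.n)
  refine .comp (.congr (.cons (.cons (.hd .id) (.cons (.hd (.tl .id)) .nil))
    (.comp (.tl (.tl .id)) (hS.reindex ψ))) fun q => ?_)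
    (h.mono (hn.reindex ψ))
  simp [encAsg, encList, Val.hd, Val.tl, ψ]

theorem PolyTime.str {n : ι → ℕ} {D₀ D₁ D₂ D₃ : ∀ i, Digraph (Fin (n i))} {k l : ι → ℕ}
    (hn : PolyBdd N n) (h₀ : PolyTime N a fun i => encDigraph (D₀ i))
    (h₁ : PolyTime N a fun i => encDigraph (D₁ i)) (h₂ : PolyTime N a fun i => encDigraph (D₂ i))
    (h₃ : PolyTime N a fun i => encDigraph (D₃ i)) (hk : PolyTime N a fun i => encNat (k i))
    (hl : PolyTime N a fun i => encNat (l i)) :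
    PolyTime N a fun i => encStr ⟨n i, ![D₀ i, D₁ i, D₂ i, D₃ i], ![k i, l i]⟩ :=
  .congr (.cons (h₀.order hn) (.cons (.cons h₀ (.cons h₁ (.cons h₂ (.cons h₃ .nil))))
    (.cons hk (.cons hl .nil)))) fun i => by simp [encStr, encList]

end Use
end SpanningLeaf
namespace SpanningLeaf

/-! ### Out-branchings -/

section Trees

variable {V : Type*} {D T : Digraph V} {r u v w : V}

theorem reach_of_mem_reachIn {j : ℕ} (h : v ∈ reachIn D u j) : Reach D u v := by
  induction j generalizing v with
  | zero => rw [show v = u from h]; exact .refl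
  | succ j ih =>
    rcases h with h | ⟨w, hw, hwv⟩
    · exact ih h
    · exact (ih hw).tail hwv

theorem exists_mem_reachIn (h : Reach D u v) : ∃ j, v ∈ reachIn D u j := by
  induction h with
  | refl => exact ⟨0, rfl⟩
  | tail _ h ih =>
    obtain ⟨j, hj⟩ := ih
    exact ⟨j + 1, .inr ⟨_, hj, h⟩⟩

/-- Distances from `r`, as far as they are needed. -/
theorem exists_rank (D : Digraph V) (r : V) : ∃ ρ : V → ℕ, ∀ v, Reach D r v → v ≠ r →
    ∃ u, Reach D r u ∧ D.Adj u v ∧ ρ u < ρ v := by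
  refine ⟨fun v => sInf {j | v ∈ reachIn D r j}, fun v hv hne => ?_⟩
  have hmem : v ∈ reachIn D r (sInf {j | v ∈ reachIn D r j}) :=
    Nat.sInf_mem (s := {j | v ∈ reachIn D r j}) (exists_mem_reachIn hv)
  obtain h | ⟨i, h⟩ : sInf {j | v ∈ reachIn D r j} = 0 ∨
      ∃ i, sInf {j | v ∈ reachIn D r j} = i + 1 := by
    cases sInf {j | v ∈ reachIn D r j} <;> simp
  · rw [h] at hmem
    exact absurd hmem hne
  · rw [h] at hmem
    rcases hmem with hv' | ⟨u, hu, huv⟩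
    · have := Nat.sInf_le (s := {j | v ∈ reachIn D r j}) hv'
      omega
    · have := Nat.sInf_le (s := {j | u ∈ reachIn D r j}) hu
      exact ⟨u, reach_of_mem_reachIn hu, huv, by simp only; omega⟩

/-- Passing to the parent decreases the rank and can only stop at `r`, which gives reachability; a
parent function makes in-neighbours unique. -/
theorem IsOutBranching.of_rank {par : V → V} {ρ : V → ℕ} (hD : ∀ v, v ≠ r → D.Adj (par v) v)
    (hρ : ∀ v, v ≠ r → ρ (par v) < ρ v) :
    IsOutBranching D r ⟨fun u v => v ≠ r ∧ u = par v⟩ where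
  subgraph := by rintro u v ⟨h, rfl⟩; exact hD v h
  root := fun u h => h.1 rfl
  indegree := fun v hv => ⟨par v, ⟨hv, rfl⟩, fun u h => h.2⟩
  reach := by
    intro v
    induction hm : ρ v using Nat.strong_induction_on generalizing v with
    | _ m ih =>
      by_cases hv : v = r
      · rw [hv]; exact .refl
      · exact (ih _ (hm ▸ hρ v hv) (par v) rfl).tail ⟨hv, rfl⟩

namespace IsOutBranching

theorem unique (hT : IsOutBranching D r T) {u' : V} (h : T.Adj u v) (h' : T.Adj u' v) : u = u' :=
  (hT.indegree v fun e => hT.root u (e ▸ h)).unique h h'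

/-- Each arc of `T` is the unique one into its head, hence the one by which the distance from `r`
drops. This is the form in which acyclicity is used. -/
theorem exists_rank (hT : IsOutBranching D r T) : ∃ ρ : V → ℕ, ∀ u v, T.Adj u v → ρ u < ρ v := by
  obtain ⟨ρ, hρ⟩ := SpanningLeaf.exists_rank T r
  refine ⟨ρ, fun u v h => ?_⟩
  obtain ⟨u', _, h', hlt⟩ := hρ v (hT.reach v) fun e => hT.root u (e ▸ h)
  rwa [hT.unique h h']

theorem rank_le {ρ : V → ℕ} (hρ : ∀ u v, T.Adj u v → ρ u < ρ v) (h : Reach T u v) :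
    u = v ∨ ρ u < ρ v := by
  induction h with
  | refl => exact .inl rfl
  | tail _ h ih =>
    right
    have := hρ _ _ h
    rcases ih with rfl | ih <;> omega

theorem antisymm (hT : IsOutBranching D r T) (h : Reach T u v) (h' : Reach T v u) : u = v := by
  obtain ⟨ρ, hρ⟩ := hT.exists_rank
  have h1 := rank_le hρ h
  have h2 := rank_le hρ h'
  rcases h1 with h1 | h1
  · exact h1
  · rcases h2 with h2 | h2
    · exact h2.symm
    · omega

theorem reach_parent (hT : IsOutBranching D r T) (h : T.Adj u v) (hw : Reach T w v) :
    w = v ∨ Reach T w u := by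
  rcases Relation.ReflTransGen.cases_tail hw with rfl | ⟨u', h1, h2⟩
  · exact .inl rfl
  · rw [hT.unique h h2]
    exact .inr h1

theorem not_reach_parent (hT : IsOutBranching D r T) (h : T.Adj u v) : ¬ Reach T v u := by
  intro h'
  obtain ⟨ρ, hρ⟩ := hT.exists_rank
  have h1 := hρ _ _ h
  rcases rank_le hρ h' with rfl | h2 <;> omega

/-- With in-degree at most 1 there is only one way back from `w`, so its ancestors form a chain. -/
theorem total (hT : IsOutBranching D r T) (hu : Reach T u w) (hv : Reach T v w) :
    Reach T u v ∨ Reach T v u := by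
  induction hu with
  | refl => exact .inr hv
  | tail _ h ih =>
    rcases hT.reach_parent h hv with rfl | h'
    · left
      rename_i h0
      exact h0.tail h
    · exact ih h'

theorem exists_leaf [Finite V] (hT : IsOutBranching D r T) (v : V) :
    ∃ l ∈ leaves T, Reach T v l := by
  obtain ⟨ρ, hρ⟩ := hT.exists_rank
  obtain ⟨l, hl, hmax⟩ := Set.exists_max_image {w | Reach T v w} ρ (Set.toFinite _) ⟨v, .refl⟩
  refine ⟨l, fun w hw => ?_, hl⟩
  have := hmax w (Relation.ReflTransGen.tail hl hw)
  have := hρ _ _ hw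
  omega

/-- There are at least as many leaves as pairwise incomparable vertices. -/
theorem ncard_le_leaves [Finite V] (hT : IsOutBranching D r T) {A : Set V}
    (hA : ∀ u ∈ A, ∀ v ∈ A, Reach T u v → u = v) : A.ncard ≤ (leaves T).ncard := by
  choose f hf hf' using hT.exists_leaf
  refine Set.ncard_le_ncard_of_injOn f (fun v _ => hf v) (fun u hu v hv e => ?_) (Set.toFinite _)
  rcases hT.total (hf' u) (e ▸ hf' v) with h | h
  · exact hA u hu v hv h
  · exact (hA v hv u hu h).symm

theorem leaves_pos [Finite V] (hT : IsOutBranching D r T) : 1 ≤ (leaves T).ncard := by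
  have := hT.ncard_le_leaves (A := {r}) (by simp)
  simpa using this

/-- Double counting. The out-degrees sum to `|V| - 1`, and every out-degree `d` satisfies `d·[d ≥ 2]
+ 2 ≤ 2d + 2·[d = 0]`; summing over all vertices gives the claim. -/
theorem ncard_brSucc_le [Finite V] (hT : IsOutBranching D r T) :
    (brSucc T).ncard + 2 ≤ 2 * (leaves T).ncard := by
  classical
  have := Fintype.ofFinite V
  let d : V → ℕ := fun u => (Finset.univ.filter fun w => T.Adj u w).card
  have hd : ∀ u, {w | T.Adj u w}.ncard = d u := fun u => by
    simp [d, ← Set.ncard_coe_finset]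
  obtain ⟨par, hpar⟩ : ∃ par : V → V, ∀ v, v ≠ r → T.Adj (par v) v := by
    have : ∀ v, ∃ u, v ≠ r → T.Adj u v := fun v => by
      by_cases h : v = r
      · exact ⟨r, fun h' => absurd h h'⟩
      · obtain ⟨u, hu, -⟩ := hT.indegree v h
        exact ⟨u, fun _ => hu⟩
    exact ⟨fun v => (this v).choose, fun v => (this v).choose_spec⟩
  have hne : ∀ {u v}, T.Adj u v → v ≠ r := fun h e => hT.root _ (e ▸ h)
  have hp : ∀ {u v}, T.Adj u v ↔ v ≠ r ∧ par v = u := fun {u v} =>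
    ⟨fun h => ⟨hne h, hT.unique (hpar v (hne h)) h⟩, fun ⟨h, e⟩ => e ▸ hpar v h⟩
  -- Arcs correspond to their heads, which are the vertices other than `r`.
  have h1 : ∑ u, d u + 1 = Fintype.card V := by
    have := Finset.card_eq_sum_card_fiberwise (f := par) (s := Finset.univ.erase r)
      (t := Finset.univ) (fun _ _ => Finset.mem_coe.2 (Finset.mem_univ _))
    rw [Finset.card_erase_of_mem (Finset.mem_univ r), Finset.card_univ] at this
    have hpos : 0 < Fintype.card V := Fintype.card_pos_iff.2 ⟨r⟩
    have e : ∀ u, (Finset.univ.erase r |>.filter fun v => par v = u).card = d u := fun u => by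
      congr 1
      ext v
      simp [hp]
    simp only [e] at this
    omega
  have h2 : (brSucc T).ncard = ∑ u, if 2 ≤ d u then d u else 0 := by
    have := Finset.card_eq_sum_card_fiberwise (f := par)
      (s := Finset.univ.filter fun v => v ≠ r ∧ 2 ≤ d (par v))
      (t := Finset.univ) (fun _ _ => Finset.mem_coe.2 (Finset.mem_univ _))
    have e : ∀ u, ((Finset.univ.filter fun v => v ≠ r ∧ 2 ≤ d (par v)).filter
        fun v => par v = u).card = if 2 ≤ d u then d u else 0 := fun u => by
      split_ifs with h
      · congr 1
        ext v
        simp only [Finset.mem_filter, Finset.mem_univ, true_and, hp]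
        constructor
        · rintro ⟨⟨h1, -⟩, h2⟩; exact ⟨h1, h2⟩
        · rintro ⟨h1, rfl⟩; exact ⟨⟨h1, h⟩, rfl⟩
      · rw [Finset.card_eq_zero, Finset.filter_eq_empty_iff]
        rintro v hv rfl
        exact h (Finset.mem_filter.1 hv).2.2
    simp only [e] at this
    rw [← this, ← Set.ncard_coe_finset]
    congr 1
    ext v
    simp only [brSucc, hd, Set.mem_ofPred_eq, Finset.coe_filter, Finset.mem_univ, true_and]
    simp only [hp]
    constructor
    · rintro ⟨u, ⟨h, rfl⟩, h'⟩; exact ⟨h, h'⟩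
    · rintro ⟨h, h'⟩; exact ⟨_, ⟨h, rfl⟩, h'⟩
  have h3 : (leaves T).ncard = ∑ u, if d u = 0 then 1 else 0 := by
    rw [← Finset.card_filter, ← Set.ncard_coe_finset]
    congr 1
    ext v
    simp [leaves, d, Finset.filter_eq_empty_iff]
  have h4 : ∑ u, (if 2 ≤ d u then d u else 0) + 2 * Fintype.card V ≤
      2 * ∑ u, d u + 2 * ∑ u, if d u = 0 then 1 else 0 := by
    rw [← Finset.card_univ, Finset.card_eq_sum_ones, Finset.mul_sum, Finset.mul_sum,
      Finset.mul_sum, ← Finset.sum_add_distrib, ← Finset.sum_add_distrib]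
    refine Finset.sum_le_sum fun u _ => ?_
    split_ifs <;> omega
  omega

/-! ### Depth -/

end IsOutBranching

/-- The number of proper ancestors. -/
noncomputable def depth (T : Digraph V) (v : V) : ℕ := {w | Reach T w v ∧ w ≠ v}.ncard

namespace IsOutBranching

theorem depth_succ [Finite V] (hT : IsOutBranching D r T) (h : T.Adj u v) :
    depth T v = depth T u + 1 := by
  have hv := hT.not_reach_parent h
  have : {w | Reach T w v ∧ w ≠ v} = insert u {w | Reach T w u ∧ w ≠ u} := by
    ext w
    simp only [Set.mem_ofPred_eq, Set.mem_insert_iff]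
    constructor
    · rintro ⟨h1, h2⟩
      have := (hT.reach_parent h h1).resolve_left h2
      tauto
    · rintro (rfl | ⟨h1, h2⟩)
      · exact ⟨.single h, fun e => hv (e ▸ .refl)⟩
      · exact ⟨h1.tail h, fun e => hv (e ▸ h1)⟩
  rw [depth, this, Set.ncard_insert_of_notMem (by simp) (Set.toFinite _), depth]

theorem depth_root (hT : IsOutBranching D r T) : depth T r = 0 := by
  have : {w | Reach T w r ∧ w ≠ r} = ∅ := by
    ext w
    simp only [Set.mem_ofPred_eq, Set.mem_empty_iff_false, iff_false, not_and, not_not]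
    exact fun h => hT.antisymm h (hT.reach w)
  rw [depth, this, Set.ncard_empty]

theorem depth_lt [Finite V] (hT : IsOutBranching D r T) (h : Reach T u v) (hne : u ≠ v) :
    depth T u < depth T v :=
  (rank_le (ρ := depth T) (fun _ _ h => by rw [hT.depth_succ h]; omega) h).resolve_left hne

theorem depth_lt_card [Finite V] (v : V) : depth T v < Nat.card V := by
  rw [← Set.ncard_univ]
  refine Set.ncard_lt_ncard ⟨Set.subset_univ _, fun h => ?_⟩ (Set.toFinite _)
  exact (h (Set.mem_univ v)).2 rfl

theorem exists_ancestor [Finite V] (hT : IsOutBranching D r T) {i : ℕ} (h : i ≤ depth T v) :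
    ∃ w, Reach T w v ∧ depth T w = i := by
  induction hT.reach v with
  | refl =>
    rw [hT.depth_root] at h
    exact ⟨r, .refl, by rw [hT.depth_root]; omega⟩
  | tail _ huv ih =>
    rcases Nat.lt_or_ge i (depth T _) with hlt | hge
    · rw [hT.depth_succ huv] at hlt
      obtain ⟨w, hw, e⟩ := ih (by omega)
      exact ⟨w, hw.tail huv, e⟩
    · exact ⟨_, .refl, by omega⟩

/-- Depth increases strictly along `T`, so the vertices of one level are pairwise incomparable. -/
theorem ncard_level_le [Finite V] (hT : IsOutBranching D r T) (i : ℕ) :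
    {v | depth T v = i}.ncard ≤ (leaves T).ncard := by
  refine hT.ncard_le_leaves fun u hu v hv h => ?_
  by_contra hne
  have := hT.depth_lt h hne
  simp only [Set.mem_ofPred_eq] at hu hv
  omega

/-! ### Changing one arc -/

/-- Vertices that are not below `v` keep their paths from `r`. In particular `u` does, so `v` is
reached by the new arc, and everything below `v` follows. -/
theorem oneChange (hT : IsOutBranching D r T) (huv : D.Adj u v) (hv : v ≠ r)
    (h : ¬ Reach T v u) : IsOutBranching D r (oneChange T u v) := by
  have h1 : ∀ w, ¬ Reach T v w → Reach (SpanningLeaf.oneChange T u v) r w := by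
    intro w hw
    induction hT.reach w with
    | refl => exact .refl
    | tail _ hab ih =>
      exact (ih fun h => hw (h.tail hab)).tail (.inl ⟨hab, fun e => hw (e ▸ .refl)⟩)
  refine ⟨?_, ?_, fun w hw => ?_, fun w => ?_⟩
  · rintro a b (⟨hab, -⟩ | ⟨rfl, rfl⟩)
    exacts [hT.subgraph _ _ hab, huv]
  · rintro a (⟨hab, -⟩ | ⟨-, e⟩)
    exacts [hT.root _ hab, hv e.symm]
  · by_cases e : w = v
    · exact ⟨u, .inr ⟨rfl, e⟩, fun a ha => ha.elim (fun ha => absurd e ha.2) fun ha => ha.1⟩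
    · obtain ⟨a, ha, -⟩ := hT.indegree w hw
      exact ⟨a, .inl ⟨ha, e⟩, fun b hb =>
        hb.elim (fun hb => hT.unique hb.1 ha) fun hb => absurd hb.2 e⟩
  · induction hT.reach w with
    | refl => exact .refl
    | @tail a b _ hab ih =>
      by_cases e : b = v
      · exact (h1 u h).tail (.inr ⟨rfl, e⟩)
      · exact ih.tail (.inl ⟨hab, e⟩)

end IsOutBranching

/-- Otherwise the 1-change for `(u, v)` wins a leaf: the parent of `v` has no other child and
becomes a leaf, while `u`, which loses nothing, was not a leaf before. -/
theorem IsOneOptimal.leaf_or_brSucc [Finite V] (hT : IsOneOptimal D r T) (huv : D.Adj u v)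
    (hn : ¬ T.Adj u v) (hv : v ≠ r) (h : ¬ Reach T v u) : u ∈ leaves T ∨ v ∈ brSucc T := by
  by_contra! hc
  have hle := hT.2 u v huv hn hv r (hT.1.oneChange huv hv h)
  obtain ⟨p, hp, -⟩ := hT.1.indegree v hv
  have hp' : ∀ b, T.Adj p b → b = v := by
    intro b hb
    by_contra hne
    refine hc.2 ⟨p, hp, ?_⟩
    rw [← Set.ncard_pair hne]
    refine Set.ncard_le_ncard ?_ (Set.toFinite _)
    rintro x (rfl | rfl)
    exacts [hb, hp]
  have hsub : insert p (leaves T) ⊆ leaves (oneChange T u v) := by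
    rintro x (rfl | hx) b (⟨hb, hbv⟩ | ⟨rfl, rfl⟩)
    exacts [hbv (hp' b hb), hn hp, hx b hb, hc.1 hx]
  have h1 := Set.ncard_le_ncard hsub (Set.toFinite _)
  rw [Set.ncard_insert_of_notMem (show p ∉ leaves T from fun h => h v hp) (Set.toFinite _)] at h1
  omega

/-! ### Constructing out-branchings -/

/-- The digraph `D` restricted to the vertices in `I`. -/
def within (D : Digraph V) (I : Set V) : Digraph V := ⟨fun u v => D.Adj u v ∧ u ∈ I ∧ v ∈ I⟩

/-- The heads outside `I` of arcs that leave `I`. -/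
def boundary (D : Digraph V) (I : Set V) : Set V := {v | v ∉ I ∧ ∃ u ∈ I, D.Adj u v}

theorem Reach.mem {I : Set V} (h : Reach (within D I) u v) (hu : u ∈ I) : v ∈ I := by
  induction h with
  | refl => exact hu
  | tail _ h _ => exact h.2.2

theorem Reach.mono {D' : Digraph V} (h : Reach D u v) (hD : ∀ u v, D.Adj u v → D'.Adj u v) :
    Reach D' u v := Relation.ReflTransGen.mono (fun u v => hD u v) _ _ h

/-- An out-branching that first spans `I`, then takes an arc to some vertices, then the rest. -/
theorem exists_outBranching_extending [Finite V] (hD : ∀ v, Reach D r v) {I : Set V} (hr : r ∈ I)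
    (hI : ∀ v ∈ I, Reach (within D I) r v) {B : Set V} {par : V → V}
    (hB : ∀ v ∈ B, v ∉ I ∧ par v ∈ I ∧ D.Adj (par v) v) :
    ∃ T, IsOutBranching D r T ∧ (∀ u v, T.Adj u v → v ∈ I → u ∈ I) ∧
      ∀ v ∈ B, T.Adj (par v) v := by
  classical
  obtain ⟨ρ, hρ⟩ := exists_rank (within D I) r
  obtain ⟨τ, hτ⟩ := exists_rank D r
  have h1 : ∀ v, ∃ u, v ∈ I → v ≠ r → u ∈ I ∧ D.Adj u v ∧ ρ u < ρ v := fun v => by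
    by_cases h : v ∈ I ∧ v ≠ r
    · obtain ⟨u, -, h2, h3⟩ := hρ v (hI v h.1) h.2
      exact ⟨u, fun _ _ => ⟨h2.2.1, h2.1, h3⟩⟩
    · exact ⟨r, fun a b => absurd ⟨a, b⟩ h⟩
  have h2 : ∀ v, ∃ u, v ≠ r → D.Adj u v ∧ τ u < τ v := fun v => by
    by_cases h : v ≠ r
    · obtain ⟨u, -, h2, h3⟩ := hτ v (hD v) h
      exact ⟨u, fun _ => ⟨h2, h3⟩⟩
    · exact ⟨r, fun a => absurd a h⟩
  choose f hf using h1
  choose g hg using h2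
  obtain ⟨M, hM⟩ := (Set.finite_range ρ).bddAbove
  replace hM : ∀ v, ρ v ≤ M := fun v => hM ⟨v, rfl⟩
  -- Three layers of ranks: distances inside `I`, at most `M`; the value `M + 1` on `B`; and
  -- distances in `D` shifted by `M + 2` elsewhere. A parent may lie in an earlier layer at no cost.
  let σ : V → ℕ := fun v => if v ∈ I then ρ v else if v ∈ B then M + 1 else M + 2 + τ v
  let π : V → V := fun v => if v ∈ I then f v else if v ∈ B then par v else g v
  refine ⟨_, .of_rank (par := π) (ρ := σ) (fun v hv => ?_) (fun v hv => ?_), ?_, ?_⟩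
  · by_cases h1 : v ∈ I
    · simpa [π, h1] using (hf v h1 hv).2.1
    · by_cases h2 : v ∈ B
      · simpa [π, h1, h2] using (hB v h2).2.2
      · simpa [π, h1, h2] using (hg v hv).1
  · by_cases h1 : v ∈ I
    · simpa [π, σ, h1, (hf v h1 hv).1] using (hf v h1 hv).2.2
    · by_cases h2 : v ∈ B
      · simpa [π, σ, h1, h2, (hB v h2).2.1] using Nat.lt_succ_of_le (hM (par v))
      · simp only [π, σ, h1, h2, if_false]
        have h3 := hM (g v)
        have h4 := (hg v hv).2
        split_ifs <;> omega
  · rintro u v ⟨hv, rfl⟩ h1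
    simpa [π, h1] using (hf v h1 hv).1
  · intro v hv
    have h1 := (hB v hv).1
    exact ⟨fun e => h1 (e ▸ hr), by simp [π, h1, hv]⟩

/-- A set that is connected from the root yields as many leaves as it has out-neighbours. -/
theorem exists_outBranching_boundary_le [Finite V] (hD : ∀ v, Reach D r v) {I : Set V} (hr : r ∈ I)
    (hI : ∀ v ∈ I, Reach (within D I) r v) :
    ∃ T, IsOutBranching D r T ∧ (boundary D I).ncard ≤ (leaves T).ncard := by
  have : ∀ v, ∃ u, v ∈ boundary D I → u ∈ I ∧ D.Adj u v := fun v => by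
    by_cases h : v ∈ boundary D I
    · obtain ⟨-, u, h⟩ := h
      exact ⟨u, fun _ => h⟩
    · exact ⟨v, fun h' => absurd h' h⟩
  choose par hpar using this
  obtain ⟨T, hT, hTI, hTB⟩ := exists_outBranching_extending hD hr hI (B := boundary D I)
    (par := par) fun v hv => ⟨hv.1, hpar v hv⟩
  -- Boundary vertices are incomparable: a proper ancestor of one is an ancestor of its parent,
  -- which lies in `I`, and all ancestors of vertices of `I` are in `I`.
  refine ⟨T, hT, hT.ncard_le_leaves fun u hu v hv huv => ?_⟩
  rcases hT.reach_parent (hTB v hv) huv with h | h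
  · exact h
  · have : ∀ w, Reach T u w → w ∈ I → u ∈ I := fun w hw => by
      induction hw with
      | refl => exact id
      | tail _ hab ih => exact fun hb => ih (hTI _ _ hab hb)
    exact absurd (this _ h (hpar v hv).1) hu.1

theorem IsOutBranching.reach_within (hT : IsOutBranching D r T) (h : ¬ Reach T v w) :
    Reach (within D {y | ¬ Reach T v y}) r w := by
  induction hT.reach w with
  | refl => exact .refl
  | tail _ hab ih =>
    have h' := fun h' => h (Relation.ReflTransGen.tail h' hab)
    exact (ih h').tail ⟨hT.subgraph _ _ hab, h', h⟩

/-- The arcs that are not useless. -/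
theorem exists_outBranching_adj_iff [Finite V] (hD : ∀ v, Reach D r v) :
    (∃ T, IsOutBranching D r T ∧ T.Adj u v) ↔
      D.Adj u v ∧ v ≠ r ∧ u ≠ v ∧ Reach (within D {y | y ≠ v}) r u := by
  constructor
  · rintro ⟨T, hT, huv⟩
    have h1 := hT.not_reach_parent huv
    refine ⟨hT.subgraph _ _ huv, fun e => hT.root u (e ▸ huv), fun e => h1 (e ▸ .refl),
      (hT.reach_within h1).mono fun a b h => ⟨h.1, ?_, ?_⟩⟩
    · exact fun e => h.2.1 (e ▸ .refl)
    · exact fun e => h.2.2 (e ▸ .refl)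
  · rintro ⟨huv, hv, hne, hu⟩
    have hI : ∀ w, Reach (within D {y | y ≠ v}) r w →
        Reach (within D {w | Reach (within D {y | y ≠ v}) r w}) r w := fun w hw => by
      induction hw with
      | refl => exact .refl
      | tail h hab ih => exact ih.tail ⟨hab.1, h, h.tail hab⟩
    -- All that can be reached without `v` is spanned before `v` is attached to `u`; so `u` is not
    -- below `v`.
    obtain ⟨T, hT, -, h⟩ := exists_outBranching_extending hD
      (I := {w | Reach (within D {y | y ≠ v}) r w}) .refl hI (B := {v}) (par := fun _ => u) (by
        rintro w rfl
        exact ⟨fun h => Reach.mem h (I := {y | y ≠ w}) hv.symm rfl, hu, huv⟩)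
    exact ⟨T, hT, h v rfl⟩

end Trees
end SpanningLeaf
namespace SpanningLeaf

/-! ### Many backward heads yield many leaves -/

section Backward

variable {V : Type*} {D T : Digraph V} {r u v w x l : V} {k : ℕ}

/-- The last arc by which a walk that avoids `w` enters the set of proper descendants of `w`. -/
theorem exists_last_entry {S : Set V} (hr : r ∉ S) (hu : u ∈ S) (huw : u ≠ w)
    (h : Reach (within D {y | y ≠ w}) r u) :
    ∃ p q, D.Adj p q ∧ p ∉ S ∧ q ∈ S ∧ q ≠ w ∧ Reach (within D (S \ {w})) q u := by
  -- The induction runs backwards from `u`: either the part of the walk seen so far stays in `S \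
  -- {w}`, or an entering arc has been found.
  have : (r ∈ S \ {w} ∧ Reach (within D (S \ {w})) r u) ∨
      ∃ p q, D.Adj p q ∧ p ∉ S ∧ q ∈ S ∧ q ≠ w ∧ Reach (within D (S \ {w})) q u := by
    clear hr
    induction h using Relation.ReflTransGen.head_induction_on with
    | refl => exact .inl ⟨⟨hu, huw⟩, .refl⟩
    | @head a b hab _ ih =>
      rcases ih with ⟨hb, h⟩ | h
      · by_cases ha : a ∈ S
        · exact .inl ⟨⟨ha, hab.2.1⟩, .head ⟨hab.1, ⟨ha, hab.2.1⟩, hb⟩ h⟩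
        · exact .inr ⟨a, b, hab.1, ha, hb.1, hb.2, h⟩
      · exact .inr h
  exact this.resolve_left fun h => hr h.1.1

/-- An arc by which the proper descendants of `w`, and from them `u`, are reached without `w`. -/
structure IsBypass (D T : Digraph V) (w u p q : V) : Prop where
  adj : D.Adj p q
  above : ¬ Reach T w p
  below : Reach T w q
  reach : Reach (within D ({y | Reach T w y} \ {w})) q u
  special : p ∈ leaves T ∨ q ∈ brSucc T

/-- Usefulness of `(u, w)` provides a walk from `r` to `u` that avoids `w`. It starts outside the
subtree at `w` and ends inside; 1-optimality is applied to its last entering arc. -/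
theorem exists_bypass [Finite V] (hD : ∀ u v, ¬ IsUseless D r u v) (hT : IsOneOptimal D r T)
    (huw : D.Adj u w) (h : Reach T w u) : ∃ p q, IsBypass D T w u p q := by
  obtain ⟨T', hT', hadj⟩ : ∃ T, IsOutBranching D r T ∧ T.Adj u w :=
    by_contra fun h => hD u w ⟨huw, h⟩
  obtain ⟨-, hwr, hne, hru⟩ := (exists_outBranching_adj_iff fun v =>
    (hT'.reach v).mono hT'.subgraph).1 ⟨T', hT', hadj⟩
  obtain ⟨p, q, h1, h2, h3, h4, h5⟩ := exists_last_entry (S := {y | Reach T w y}) (r := r)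
    (fun h => hwr (hT.1.antisymm h (hT.1.reach w))) h hne hru
  -- The side conditions of the 1-change: the tree arc into `q ≠ w` would start in the subtree; `r`
  -- is not a proper descendant of `w`; and `p` is not below `q`, being outside the subtree.
  refine ⟨p, q, h1, h2, h3, h5, hT.leaf_or_brSucc h1 (fun hpq => ?_) (fun e => ?_) fun hqp => ?_⟩
  · exact h2 ((hT.1.reach_parent hpq h3).resolve_left h4.symm)
  · exact h4 (hT.1.antisymm (e ▸ hT.1.reach w) h3)
  · exact h2 (Relation.ReflTransGen.trans h3 hqp)

/-- Discard the vertices that are below the top `w` of `W` but not below its bottom `m`. What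
remains is connected from `r` by way of `(p, q)`, and it has every element of `W` except `m` as an
out-neighbour, since the tails `up y` lie below `x` and thus below `m`. -/
theorem IsOutBranching.exists_leafy_of_bypass [Finite V] (hT : IsOutBranching D r T) {W : Set V}
    {up : V → V} (hW : ∀ w ∈ W, D.Adj (up w) w ∧ w ≠ r ∧ Reach T w x ∧ w ≠ x ∧ Reach T x (up w))
    {w m p q : V} (hmW : m ∈ W) (hw : ∀ y ∈ W, Reach T w y) (hwW : w ∈ W)
    (hm : ∀ y ∈ W, Reach T y m) (hpq : D.Adj p q)
    (hp : ¬ Reach T w p) (hq : Reach T m q)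
    (hqu : Reach (within D ({y | Reach T m y} \ {m})) q (up m)) :
    ∃ T', IsOutBranching D r T' ∧ W.ncard ≤ (leaves T').ncard + 1 := by
  have hD : ∀ v, Reach D r v := fun v => (hT.reach v).mono hT.subgraph
  set I : Set V := {y | ¬ Reach T w y} ∪ {y | Reach T m y} with hI
  have h1 : ∀ y, ¬ Reach T w y → Reach (within D I) r y := fun y hy =>
    (hT.reach_within hy).mono fun a b h => ⟨h.1, .inl h.2.1, .inl h.2.2⟩
  have h2 : Reach (within D I) r q := (h1 p hp).tail ⟨hpq, .inl hp, .inr hq⟩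
  -- The walk from `q` stays strictly below `m`. The arc from `up m` then enters `m` itself, and
  -- tree arcs reach the rest of its subtree.
  have h3 : Reach (within D I) r (up m) := Relation.ReflTransGen.trans h2
    (hqu.mono fun a b h => ⟨h.1, .inr h.2.1.1, .inr h.2.2.1⟩)
  have hmu : Reach T m (up m) := Relation.ReflTransGen.trans (hW m hmW).2.2.1 (hW m hmW).2.2.2.2
  have h4 : Reach (within D I) r m := h3.tail ⟨(hW m hmW).1, .inr hmu, .inr .refl⟩
  have h5 : ∀ y, Reach T m y → Reach (within D I) r y := fun y hy => by
    induction hy with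
    | refl => exact h4
    | tail h hab ih => exact ih.tail ⟨hT.subgraph _ _ hab, .inr h, .inr (h.tail hab)⟩
  have hwr : ¬ Reach T w r := fun h => (hW w hwW).2.1 (hT.antisymm h (hT.reach w))
  obtain ⟨T', hT', hle⟩ := exists_outBranching_boundary_le hD (I := I) (.inl hwr)
    fun v hv => hv.elim (h1 v) (h5 v)
  refine ⟨T', hT', ?_⟩
  have hsub : W \ {m} ⊆ boundary D I := by
    rintro y ⟨hy, hne⟩
    refine ⟨?_, up y, .inr ?_, (hW y hy).1⟩
    · rintro (h | h)
      · exact h (hw y hy)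
      · exact hne (hT.antisymm (hm y hy) h)
    · exact Relation.ReflTransGen.trans (hW m hmW).2.2.1 (hW y hy).2.2.2.2
  have h6 := Set.ncard_le_ncard hsub (Set.toFinite _)
  have h7 := Set.ncard_sdiff_singleton_add_one hmW (Set.toFinite _)
  omega

theorem hasLeafyOutBranching_of_manyBackwardHeads [Finite V] (hD : ∀ u v, ¬ IsUseless D r u v)
    (hT : IsOneOptimal D r T) (h : HasManyBackwardHeads D T k) : HasLeafyOutBranching D k := by
  classical
  by_cases hk : k ≤ (leaves T).ncard
  · exact ⟨r, T, hT.1, hk⟩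
  have := Fintype.ofFinite V
  obtain ⟨l, x, hl, ⟨hxl, hne⟩, hmany⟩ := h
  have hup : ∀ w, ∃ u p q, w ∈ backwardHeads D T x l →
      (D.Adj u w ∧ w ≠ r ∧ Reach T w x ∧ w ≠ x ∧ Reach T x u) ∧ IsBypass D T w u p q := by
    intro w
    by_cases hw : w ∈ backwardHeads D T x l
    · obtain ⟨⟨u, huw, ⟨hwx, hne⟩, hxu, hul⟩, hbr⟩ := hw
      obtain ⟨p, q, hpq⟩ := exists_bypass hD hT huw (Relation.ReflTransGen.trans hwx hxu)
      refine ⟨u, p, q, fun _ => ⟨⟨huw, ?_, hwx, hne, hxu⟩, hpq⟩⟩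
      rintro rfl
      exact hD u w ⟨huw, fun ⟨T', hT', h⟩ => hT'.root u h⟩
    · exact ⟨w, w, w, fun h => absurd h hw⟩
  choose up p q hup using hup
  -- The label of a head is the leaf `p` or, failing that, the child `q` of a branch vertex.
  let f : V → V ⊕ V := fun w => if p w ∈ leaves T then .inl (p w) else .inr (q w)
  have hbr := hT.1.ncard_brSucc_le
  have hcard : ((leaves T).toFinset.disjSum (brSucc T).toFinset).card * k <
      (backwardHeads D T x l).toFinset.card := by
    rw [Finset.card_disjSum, ← Set.ncard_eq_toFinset_card', ← Set.ncard_eq_toFinset_card',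
      ← Set.ncard_eq_toFinset_card']
    refine lt_of_lt_of_le ?_ hmany
    -- Fewer than `k` leaves leave room for fewer than `2k` children of branch vertices. The `6 * k
    -- ^ 2` heads exceed `k` per label with room to spare.
    have h1 : (leaves T).ncard + (brSucc T).ncard ≤ 3 * k := by omega
    have h2 := Nat.mul_le_mul_right k h1
    have h3 : 0 < k := by omega
    nlinarith
  obtain ⟨y, -, hy⟩ := Finset.exists_lt_card_fiber_of_mul_lt_card_of_maps_to (f := f) (fun w hw => by
    have := (hup w (by simpa using hw)).2.special
    by_cases h : p w ∈ leaves T <;> simp [f, h, this.resolve_left]) hcard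
  set W : Set V := {w | w ∈ backwardHeads D T x l ∧ f w = y} with hWdef
  have hWk : k < W.ncard := by
    convert hy
    rw [← Set.ncard_coe_finset]
    congr 1
    ext w
    simp [hWdef]
  have hWne : W.Nonempty := Set.nonempty_of_ncard_ne_zero (by omega)
  have hWW : ∀ w ∈ W, D.Adj (up w) w ∧ w ≠ r ∧ Reach T w x ∧ w ≠ x ∧ Reach T x (up w) :=
    fun w hw => (hup w hw.1).1
  have hle : ∀ a ∈ W, ∀ b ∈ W, depth T a ≤ depth T b → Reach T a b := by
    intro a ha b hb hab
    rcases hT.1.total (hWW a ha).2.2.1 (hWW b hb).2.2.1 with h | h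
    · exact h
    · by_cases e : b = a
      · exact e ▸ .refl
      · have := hT.1.depth_lt h e
        omega
  obtain ⟨a, ha, hmin⟩ := Set.exists_min_image W (depth T) (Set.toFinite _) hWne
  obtain ⟨m, hm, hmax⟩ := Set.exists_max_image W (depth T) (Set.toFinite _) hWne
  have hba := (hup a ha.1).2
  have hbm := (hup m hm.1).2
  -- If the labels agree in `p`, the bypass of `m` already starts outside the subtree of `a`; if
  -- they agree in `q`, the bypass of `a` enters at `q m`.
  obtain ⟨p', hp', hp''⟩ : ∃ p', D.Adj p' (q m) ∧ ¬ Reach T a p' := by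
    have hf : f a = f m := ha.2.trans hm.2.symm
    by_cases h1 : p a ∈ leaves T <;> by_cases h2 : p m ∈ leaves T
    · simp only [f, h1, h2, if_true, Sum.inl.injEq] at hf
      exact ⟨p m, hbm.adj, hf ▸ hba.above⟩
    · simp [f, h1, h2] at hf
    · simp [f, h1, h2] at hf
    · simp only [f, h1, h2, if_false, Sum.inr.injEq] at hf
      exact ⟨p a, hf ▸ hba.adj, hba.above⟩
  obtain ⟨T', hT', hle'⟩ := hT.1.exists_leafy_of_bypass hWW hm
    (fun y hy => hle a ha y hy (hmin y hy)) ha (fun y hy => hle y hy m hm (hmax y hy))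
    hp' hp'' hbm.below hbm.reach
  exact ⟨r, T', hT', by omega⟩

end Backward

/-! ### The path decomposition -/

section Bags

variable {V : Type*} {D T : Digraph V} {r u v w x l : V} {k : ℕ}

/-- The `i`-th bag, without the vertices that are in every bag. -/
def spanSet (D T : Digraph V) (i : ℕ) : Set V :=
  {v | v ∉ brSucc T ∧ ∃ u, D.Adj u v ∧ Reach T v u ∧ u ∉ leaves T ∧ depth T v < i ∧ i ≤ depth T u}

/-- The `i`-th bag of the path decomposition. -/
def bag (D T : Digraph V) (i : ℕ) : Set V :=
  (leaves T ∪ brSucc T) ∪ ({v | depth T v = i} ∪ {v | depth T v = i + 1}) ∪ spanSet D T i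

/-- If `(u, v)` crosses level `i`, let `y` be the ancestor of `u` at depth `i` and `l` a leaf below
`u`; then `v` is a backward head for `y` and `l`. Since `y` is determined by `l`, one set of fewer
than `6 * k ^ 2` heads per leaf suffices. -/
theorem ncard_spanSet_le [Finite V] (hT : IsOutBranching D r T)
    (hk : ¬ HasManyBackwardHeads D T k) (i : ℕ) :
    (spanSet D T i).ncard ≤ (leaves T).ncard * (6 * k ^ 2 - 1) := by
  classical
  have := Fintype.ofFinite V
  have hx : ∀ l, ∃ x, ∀ y, Reach T y l → depth T y = i → y = x := fun l => by
    by_cases h : ∃ x, Reach T x l ∧ depth T x = i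
    · obtain ⟨x, hx, e⟩ := h
      -- Ancestors of `l` form a chain on which the depth is injective. If none has depth `i`, any
      -- value of `x l` will do.
      refine ⟨x, fun y hy e' => by_contra fun hne => ?_⟩
      rcases hT.total hx hy with h | h
      · have := hT.depth_lt h (Ne.symm hne); omega
      · have := hT.depth_lt h hne; omega
    · exact ⟨l, fun y hy e => absurd ⟨y, hy, e⟩ h⟩
  choose x hx using hx
  let g : V → Finset V := fun l => if Reach T (x l) l ∧ x l ≠ l then
    (backwardHeads D T (x l) l).toFinset else ∅
  have hsub : spanSet D T i ⊆ ((leaves T).toFinset.biUnion g : Finset V) := by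
    rintro v ⟨hv, u, huv, hvu, hul, h1, h2⟩
    obtain ⟨y, hyu, hy⟩ := hT.exists_ancestor h2
    obtain ⟨l, hl, hul'⟩ := hT.exists_leaf u
    have hyl : Reach T y l := Relation.ReflTransGen.trans hyu hul'
    have hyx := hx l y hyl hy
    -- Here the condition `u ∉ leaves T` is needed: `y = l` would force `u = l`.
    have hne : y ≠ l := by
      rintro rfl
      exact hul (hT.antisymm hyu hul' ▸ hl)
    have hvy : Reach T v y ∧ v ≠ y := by
      refine ⟨?_, fun e => by rw [e] at h1; omega⟩
      rcases hT.total hvu hyu with h | h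
      · exact h
      · by_cases e : y = v
        · exact e ▸ .refl
        · have := hT.depth_lt h e; omega
    subst hyx
    simp only [Finset.coe_biUnion, Set.mem_iUnion, Set.coe_toFinset]
    refine ⟨l, hl, ?_⟩
    simp only [g, hyl, hne, ne_eq, not_false_eq_true, and_self, if_true, Set.coe_toFinset]
    exact ⟨⟨u, huv, hvy, hyu, hul'⟩, hv⟩
  have h1 := Set.ncard_le_ncard hsub (Set.toFinite _)
  rw [Set.ncard_coe_finset] at h1
  refine h1.trans ((Finset.card_biUnion_le_card_mul _ _ (6 * k ^ 2 - 1) fun l hl => ?_).trans ?_)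
  · by_cases h : Reach T (x l) l ∧ x l ≠ l
    · simp only [g, h, ne_eq, not_false_eq_true, and_self, if_true]
      by_contra hc
      refine hk ⟨l, x l, by simpa using hl, h, ?_⟩
      rw [Set.ncard_eq_toFinset_card']
      omega
    · simp [g, h]
  · rw [Set.ncard_eq_toFinset_card']

/-- With `L ≤ k - 1` leaves the parts of a bag add up to at most `L + (2L - 2) + 2L + L (6k² - 1)`,
which is below `6k³ + 1`. -/
theorem ncard_bag_le [Finite V] (hT : IsOutBranching D r T) (hl : ¬ k ≤ (leaves T).ncard)
    (hk : ¬ HasManyBackwardHeads D T k) (i : ℕ) : (bag D T i).ncard ≤ 6 * k ^ 3 + 1 := by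
  have h1 := hT.ncard_brSucc_le
  have h2 := hT.ncard_level_le i
  have h3 := hT.ncard_level_le (i + 1)
  have h4 := ncard_spanSet_le hT hk i
  have h5 : (bag D T i).ncard ≤ ((leaves T).ncard + (brSucc T).ncard) +
      ({v | depth T v = i}.ncard + {v | depth T v = i + 1}.ncard) + (spanSet D T i).ncard := by
    refine (Set.ncard_union_le _ _).trans (add_le_add ((Set.ncard_union_le _ _).trans
      (add_le_add (Set.ncard_union_le _ _) (Set.ncard_union_le _ _))) le_rfl)
  obtain ⟨K, rfl⟩ : ∃ K, k = K + 1 := ⟨k - 1, by omega⟩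
  have h6 : (leaves T).ncard * (6 * (K + 1) ^ 2 - 1) ≤ K * (6 * (K + 1) ^ 2 - 1) :=
    Nat.mul_le_mul_right _ (by omega)
  have h7 : 6 * (K + 1) ^ 2 - 1 = 6 * K ^ 2 + 12 * K + 5 := by
    have : 6 * (K + 1) ^ 2 = 6 * K ^ 2 + 12 * K + 6 := by ring
    omega
  rw [h7] at h4 h6
  have h8 : 6 * (K + 1) ^ 3 = K * (6 * K ^ 2 + 12 * K + 5) + (6 * K ^ 2 + 13 * K + 6) := by ring
  have h9 : 0 ≤ K ^ 2 := Nat.zero_le _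
  omega

/-- A vertex `v` that is not in all bags enters one bag before its own level. After its level it
stays as long as some backward arc into it has its tail at the current depth or deeper, so there are
no gaps. -/
theorem bag_interval {i j m : ℕ} (hij : i ≤ j) (hjm : j ≤ m) (hi : v ∈ bag D T i)
    (hm : v ∈ bag D T m) : v ∈ bag D T j := by
  by_cases h : v ∈ leaves T ∪ brSucc T
  · exact .inl (.inl h)
  have hi' := (hi.imp_left fun h' => h'.resolve_left h)
  have hm' := (hm.imp_left fun h' => h'.resolve_left h)
  have h1 : depth T v ≤ i + 1 := by
    rcases hi' with (h | h) | ⟨-, -, -, -, -, h, -⟩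
    · exact (le_of_eq h).trans (Nat.le_succ i)
    · exact le_of_eq h
    · omega
  by_cases h2 : depth T v = j
  · exact .inl (.inr (.inl h2))
  by_cases h3 : depth T v = j + 1
  · exact .inl (.inr (.inr h3))
  rcases hm' with (h | h) | ⟨h4, u, h5, h6, h7, h8, h9⟩
  · have : depth T v = m := h
    omega
  · have : depth T v = m + 1 := h
    omega
  · exact .inr ⟨h4, u, h5, h6, h7, by omega, by omega⟩

/-- Arcs out of leaves and arcs into children of branch vertices have one end in every bag, and tree
arcs join consecutive levels. Any other arc is backward by 1-optimality and is caught at the depth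
of its tail. -/
theorem exists_bag [Finite V] (hT : IsOneOptimal D r T) (huv : D.Adj u v) :
    ∃ i < Nat.card V, u ∈ bag D T i ∧ v ∈ bag D T i := by
  have hself : ∀ y, y ∈ bag D T (depth T y) := fun y => .inl (.inr (.inl rfl))
  have hlt : ∀ y, depth T y < Nat.card V := IsOutBranching.depth_lt_card
  by_cases h1 : u ∈ leaves T
  · exact ⟨_, hlt v, .inl (.inl (.inl h1)), hself v⟩
  by_cases h2 : v ∈ brSucc T
  · exact ⟨_, hlt u, hself u, .inl (.inl (.inr h2))⟩
  by_cases h3 : T.Adj u v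
  · exact ⟨_, hlt u, hself u, .inl (.inr (.inr (hT.1.depth_succ h3)))⟩
  have h4 : Reach T v u := by
    by_contra h
    by_cases e : v = r
    · exact h (e ▸ hT.1.reach u)
    · rcases hT.leaf_or_brSucc huv h3 e h with h | h <;> contradiction
  by_cases e : v = u
  · subst e
    exact ⟨_, hlt v, hself v, hself v⟩
  · exact ⟨_, hlt u, hself u, .inr ⟨h2, u, huv, h4, h1, hT.1.depth_lt h4 e, le_rfl⟩⟩

open Classical in
/-- The path decomposition. -/
noncomputable def bags {n : ℕ} (D T : Digraph (Fin n)) : List (Finset (Fin n)) :=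
  List.ofFn fun i : Fin n => Finset.univ.filter (· ∈ bag D T i)

theorem isPathDecomposition_bags {n : ℕ} {D T : Digraph (Fin n)} {r : Fin n}
    (hT : IsOneOptimal D r T) : IsPathDecomposition D (bags D T) where
  vertex v := ⟨_, List.mem_ofFn.2 ⟨⟨depth T v, by
    simpa using IsOutBranching.depth_lt_card (T := T) v⟩, rfl⟩, by
      simpa using .inl (.inr (.inl rfl))⟩
  edge u v h := by
    obtain ⟨i, hi, hu, hv⟩ := exists_bag hT h
    exact ⟨_, List.mem_ofFn.2 ⟨⟨i, by simpa using hi⟩, rfl⟩, by simpa using hu, by simpa using hv⟩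
  interval v i j l hij hjl hi hl := by
    have h : ∀ j : Fin (bags D T).length, v ∈ (bags D T)[j] ↔ v ∈ bag D T j := fun j => by
      rw [Fin.getElem_fin]
      simp only [bags, List.getElem_ofFn, Finset.mem_filter, Finset.mem_univ, true_and]
    rw [h] at hi hl ⊢
    exact bag_interval hij hjl hi hl

theorem widthLE_bags {n : ℕ} {D T : Digraph (Fin n)} {r : Fin n} (hT : IsOutBranching D r T)
    (hl : ¬ k ≤ (leaves T).ncard) (hk : ¬ HasManyBackwardHeads D T k) :
    WidthLE (bags D T) (6 * k ^ 3) := by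
  intro B hB
  obtain ⟨i, rfl⟩ := List.mem_ofFn.1 hB
  have h := ncard_bag_le hT hl hk i
  rw [← Set.ncard_coe_finset]
  simpa using h

end Bags
end SpanningLeaf
namespace SpanningLeaf

/-! ### Formulas for the steps of the algorithm -/

namespace Fml

variable {m : ℕ} (S : Str) (s : Fin m → Fin S.n)

/-- `x` is a leaf of the `j`-th digraph. -/
def leaf (j : Fin 4) (x : Fin m) : Fml m := all (not (rel j x.succ 0))
/-- `y` is reachable from `x` in the `j`-th digraph. -/
def reach (j : Fin 4) (x y : Fin m) : Fml m := tc (rel j 1 0) x y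
/-- `x` has an in-neighbour in the `j`-th digraph with another out-neighbour. -/
def brSucc (j : Fin 4) (x : Fin m) : Fml m :=
  ex (and (rel j 0 x.succ) (ex (and (rel j 1 0) (not (eq 0 x.succ.succ)))))

@[simp] theorem sem_leaf (j : Fin 4) (x : Fin m) : (leaf j x).sem S s ↔ s x ∈ leaves (S.rel j) := by
  simp [leaf, leaves]

@[simp] theorem sem_reach (j : Fin 4) (x y : Fin m) :
    (reach j x y).sem S s ↔ Reach (S.rel j) (s x) (s y) := by
  simp [reach]

/-- This replaces the out-degree of the parent by the existence of a sibling, which needs no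
counting in the formula. -/
theorem _root_.SpanningLeaf.mem_brSucc_iff {V : Type*} [Finite V] {T : Digraph V} {v : V} :
    v ∈ SpanningLeaf.brSucc T ↔ ∃ u, T.Adj u v ∧ ∃ w, T.Adj u w ∧ w ≠ v := by
  constructor
  · rintro ⟨u, huv, h⟩
    refine ⟨u, huv, ?_⟩
    obtain ⟨w, hw, hne⟩ := Set.exists_ne_of_one_lt_ncard (s := {w | T.Adj u w}) (by omega) v
    exact ⟨w, hw, hne⟩
  · rintro ⟨u, huv, w, huw, hne⟩
    refine ⟨u, huv, ?_⟩
    rw [← Set.ncard_pair hne]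
    refine Set.ncard_le_ncard ?_ (Set.toFinite _)
    rintro x (rfl | rfl)
    exacts [huw, huv]

@[simp] theorem sem_brSucc (j : Fin 4) (x : Fin m) :
    (brSucc j x).sem S s ↔ s x ∈ SpanningLeaf.brSucc (S.rel j) := by
  simp [brSucc, mem_brSucc_iff]

end Fml

/-! ### Programs for the tests, the useful arcs and the bags -/

section Steps

variable {ι : Type} {N : ι → ℕ} {a : ι → Val} {n : ι → ℕ} {D T : ∀ i, Digraph (Fin (n i))}
  {r : ∀ i, Fin (n i)} {k : ι → ℕ}

theorem PolyTime.add {x y : ι → ℕ} (hx : PolyTime N a fun i => encNat (x i))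
    (hy : PolyTime N a fun i => encNat (y i)) (h : PolyBdd N x) :
    PolyTime N a fun i => encNat (x i + y i) := by
  have := PolyTime.iterate (b := fun i j => encNat (j + y i)) hx h (by simpa using hy)
    (.congr (.cons .nil (.hd .id)) fun q => by rw [Nat.add_right_comm]; rfl)
  exact this

theorem PolyTime.mul {x y : ι → ℕ} (hx : PolyTime N a fun i => encNat (x i))
    (hy : PolyTime N a fun i => encNat (y i)) (h : PolyBdd N x) (h' : PolyBdd N y) :
    PolyTime N a fun i => encNat (x i * y i) :=
  .iterate (b := fun i j => encNat (j * y i)) hx h (.congr .nil fun i => by simp [encNat])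
    (.congr (.add (.comp (.tl .id) (hy.reindex Sigma.fst)) (.hd .id) (h'.reindex Sigma.fst))
      fun q => by rw [Nat.succ_mul, Nat.add_comm])

theorem PolyTime.spans (hn : PolyBdd N n) (hD : PolyTime N a fun i => encDigraph (D i))
    (hr : PolyTime N a fun i => encNat (r i)) :
    PolyTime N a fun i => encProp (∀ v, Reach (D i) (r i) v) := by
  refine .congr (Fml.polyTime_decide (.ex (.and (.isNum 0 0) (.all (.reach 0 1 0))))
    (.str hn hD hD hD hD hr hr) hn) fun i => ?_
  simp [← Fin.ext_iff]

/-- The arcs of `D` that lie in an out-branching with root `r`, provided that `r` spans `D`. -/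
def usefulArcs {V : Type*} (D : Digraph V) (r : V) : Digraph V :=
  ⟨fun u v => D.Adj u v ∧ v ≠ r ∧ u ≠ v ∧ Reach (within D {y | y ≠ v}) r u⟩

/-- Uselessness quantifies over all out-branchings; the right-hand side is a reachability condition
and thus within the scope of formulas. -/
theorem removeUseless_eq {V : Type*} [Finite V] {D : Digraph V} {r : V} (hD : ∀ v, Reach D r v) :
    removeUseless D r = usefulArcs D r := by
  ext u v
  simp only [removeUseless, IsUseless, exists_outBranching_adj_iff hD, usefulArcs]
  tauto

theorem PolyTime.usefulArcs (hn : PolyBdd N n) (hD : PolyTime N a fun i => encDigraph (D i))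
    (hr : PolyTime N a fun i => encNat (r i)) :
    PolyTime N a fun i => encDigraph (usefulArcs (D i) (r i)) := by
  refine .congr (Fml.polyTime_digraph (.ex (.and (.isNum 0 0) (.and (.rel 0 2 1)
    (.and (.not (.eq 1 0)) (.and (.not (.eq 2 1))
      (.tc (.and (.rel 0 1 0) (.and (.not (.eq 1 3)) (.not (.eq 0 3)))) 0 2))))))
    (.str hn hD hD hD hD hr hr) hn) fun i => ?_
  simp [Fml.digraph, SpanningLeaf.usefulArcs, within, ← Fin.ext_iff]

theorem PolyTime.enoughLeaves (hn : PolyBdd N n) (hT : PolyTime N a fun i => encDigraph (T i))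
    (hk : PolyTime N a fun i => encNat (k i)) :
    PolyTime N a fun i => encProp (k i ≤ (leaves (T i)).ncard) := by
  refine .congr (Fml.polyTime_decide (.kle 0 (.leaf 0 0)) (.str hn hT hT hT hT hk hk) hn)
    fun i => ?_
  simp

/-- The threshold `6 * k ^ 2` is written out in unary, so here `k` itself has to be polynomially
bounded. -/
theorem PolyTime.hasManyBackwardHeads (hn : PolyBdd N n)
    (hD : PolyTime N a fun i => encDigraph (D i)) (hT : PolyTime N a fun i => encDigraph (T i))
    (hk : PolyTime N a fun i => encNat (k i)) (hkN : PolyBdd N k) :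
    PolyTime N a fun i => encProp (HasManyBackwardHeads (D i) (T i) (k i)) := by
  have hk2 : PolyTime N a fun i => encNat (6 * k i ^ 2) :=
    (PolyTime.mul (.const_nat 6) (.mul hk hk hkN hkN) (.const 6) (hkN.mul hkN)).congr
      fun i => by rw [sq]
  refine .congr (Fml.polyTime_decide (.ex (.ex (.and (.leaf 1 1) (.and
    (.and (.reach 1 0 1) (.not (.eq 0 1))) (.kle 1 (.and (.ex (.and (.rel 0 0 1) (.and
      (.and (.reach 1 1 2) (.not (.eq 1 2))) (.and (.reach 1 2 0) (.reach 1 0 3)))))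
      (.not (.brSucc 1 0))))))))
    (.str hn hD hT hT hT hk hk2) hn) fun i => ?_
  simp [HasManyBackwardHeads, backwardHeads, Set.sdiff_eq]
  rfl

/-- There are exactly `n` bags, so the list of their characteristic vectors has the shape of an
adjacency matrix: variable `1` is the index of the bag, variable `0` the vertex. -/
theorem PolyTime.bags (hn : PolyBdd N n)
    (hD : PolyTime N a fun i => encDigraph (D i)) (hT : PolyTime N a fun i => encDigraph (T i)) :
    PolyTime N a fun i => encBags (bags (D i) (T i)) := by
  -- Depths are compared with the index `i` by cardinalities: the proper ancestors of a vertex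
  -- against the vertices `< i`, or `≤ i` for level `i + 1`.
  let anc {m : ℕ} (x : Fin m) : Fml (m + 1) := .and (.reach 1 0 x.succ) (.not (.eq 0 x.succ))
  let lts {m : ℕ} (x : Fin m) : Fml (m + 1) := .lt 0 x.succ
  let les {m : ℕ} (x : Fin m) : Fml (m + 1) := .le 0 x.succ
  refine .congr (Fml.polyTime_digraph (.or (.or (.or (.leaf 1 0) (.brSucc 1 0))
    (.or (.and (.cle (anc 0) (lts 1)) (.cle (lts 1) (anc 0)))
      (.and (.cle (anc 0) (les 1)) (.cle (les 1) (anc 0)))))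
    (.and (.not (.brSucc 1 0)) (.ex (.and (.rel 0 0 1) (.and (.reach 1 1 0) (.and
      (.not (.leaf 1 0)) (.and (.not (.cle (lts 2) (anc 1))) (.cle (lts 2) (anc 0)))))))))
    (.str hn hD hT hT hT .nil .nil (k := fun _ => 0) (l := fun _ => 0)) hn) fun i => ?_
  simp [Fml.digraph, SpanningLeaf.bags, encBags, encDigraph, List.map_ofFn, anc, lts, les]
  refine congrArg encList (congrArg List.ofFn (funext fun u => congrArg encList
    (congrArg List.ofFn (funext fun v => congrArg encProp (propext ?_)))))
  have h1 : {v | v < u}.ncard = (u : ℕ) := by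
    rw [show {v | v < u} = ((Finset.Iio u : Finset (Fin (n i))) : Set (Fin (n i))) by ext; simp,
      Set.ncard_coe_finset, Fin.card_Iio]
  have h2 : {v | v ≤ u}.ncard = (u : ℕ) + 1 := by
    rw [show {v | v ≤ u} = ((Finset.Iic u : Finset (Fin (n i))) : Set (Fin (n i))) by ext; simp,
      Set.ncard_coe_finset, Fin.card_Iic]
  simp only [h1, h2, ← le_antisymm_iff]
  simp only [Finset.mem_filter, Finset.mem_univ, true_and]
  rfl

end Steps
end SpanningLeaf
namespace SpanningLeaf

/-! ### Computing a 1-optimal out-branching -/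

/-- A step that increases a bounded measure until a goal is attained attains it. -/
theorem iterate_attains {α : Type*} {f : α → α} {I P : α → Prop} {μ : α → ℕ} {m : ℕ}
    (hI : ∀ x, I x → I (f x)) (hP : ∀ x, I x → P x → P (f x))
    (hf : ∀ x, I x → ¬ P x → μ x < μ (f x)) (hμ : ∀ x, I x → μ x ≤ m) {x : α} (hx : I x) :
    I (f^[m + 1] x) ∧ P (f^[m + 1] x) := by
  have hIj : ∀ j, I (f^[j] x) := fun j => by
    induction j with
    | zero => exact hx
    | succ j ih => rw [Function.iterate_succ_apply']; exact hI _ ih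
  -- As long as the goal is missed, each step raises the measure by at least 1, so after `m + 1`
  -- steps the bound `m` would be exceeded.
  have h : ∀ j, P (f^[j] x) ∨ j ≤ μ (f^[j] x) := fun j => by
    induction j with
    | zero => exact .inr (Nat.zero_le _)
    | succ j ih =>
      rw [Function.iterate_succ_apply']
      by_cases h : P (f^[j] x)
      · exact .inl (hP _ (hIj j) h)
      · have := hf _ (hIj j) h
        have := ih.resolve_left h
        right; omega
  refine ⟨hIj _, (h _).resolve_right fun h => ?_⟩
  have := hμ _ (hIj (m + 1))
  omega

/-! ### Singling out one arc by a formula -/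

section FirstArc

variable {n : ℕ} {D : Digraph (Fin n)}

/-- The digraph that consists of the first arc of `D`, if there is any. -/
def firstArc (D : Digraph (Fin n)) : Digraph (Fin n) :=
  ⟨fun u v => D.Adj u v ∧ ∀ u' v', D.Adj u' v' → v < v' ∨ v = v' ∧ u ≤ u'⟩

theorem firstArc_unique {u v u' v' : Fin n} (h : (firstArc D).Adj u v)
    (h' : (firstArc D).Adj u' v') : u = u' ∧ v = v' := by
  have h1 := h.2 _ _ h'.1
  have h2 := h'.2 _ _ h.1
  omega

/-- The minimum is lexicographic, by head and then by tail. -/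
theorem exists_firstArc {u v : Fin n} (h : D.Adj u v) : ∃ u v, (firstArc D).Adj u v := by
  obtain ⟨⟨v', u'⟩, h1, h2⟩ := Set.exists_min_image {p : Fin n × Fin n | D.Adj p.2 p.1}
    (fun p => toLex p) (Set.toFinite _) ⟨(v, u), h⟩
  refine ⟨u', v', h1, fun u v h => ?_⟩
  have := h2 (v, u) h
  rwa [Prod.Lex.toLex_le_toLex] at this

end FirstArc

/-! ### Growing an out-branching and improving it by 1-changes -/

section Grow

variable {n : ℕ} {D T : Digraph (Fin n)} {r : Fin n}

/-- The arcs of `D` that leave the part of `T` that is reachable from `r`. -/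
def leavingArcs (D : Digraph (Fin n)) (r : Fin n) (T : Digraph (Fin n)) : Digraph (Fin n) :=
  ⟨fun u v => D.Adj u v ∧ Reach T r u ∧ ¬ Reach T r v⟩

/-- Add an arc of `D` to the tree `T`. -/
def growStep (D : Digraph (Fin n)) (r : Fin n) (T : Digraph (Fin n)) : Digraph (Fin n) :=
  ⟨fun u v => T.Adj u v ∨ (firstArc (leavingArcs D r T)).Adj u v⟩

/-- `T` is a tree in `D` with root `r`. -/
structure IsOutTree (D : Digraph (Fin n)) (r : Fin n) (T : Digraph (Fin n)) : Prop where
  subgraph : ∀ u v, T.Adj u v → D.Adj u v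
  reach : ∀ u v, T.Adj u v → Reach T r u
  root : ∀ u, ¬ T.Adj u r
  unique : ∀ u u' v, T.Adj u v → T.Adj u' v → u = u'

/-- The head of the new arc was not reached before, so no arc of the tree enters it: the tails of
all arcs are reached, and hence so are their heads. -/
theorem IsOutTree.growStep (hT : IsOutTree D r T) : IsOutTree D r (growStep D r T) := by
  have hmono : ∀ v, Reach T r v → Reach (SpanningLeaf.growStep D r T) r v :=
    fun v h => h.mono fun _ _ h => .inl h
  refine ⟨?_, ?_, ?_, ?_⟩
  · rintro u v (h | h)
    exacts [hT.subgraph u v h, h.1.1]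
  · rintro u v (h | h)
    exacts [hmono _ (hT.reach u v h), hmono _ h.1.2.1]
  · rintro u (h | h)
    exacts [hT.root u h, h.1.2.2 .refl]
  · rintro u u' v (h | h) (h' | h')
    · exact hT.unique u u' v h h'
    · exact absurd ((hT.reach u v h).tail h) h'.1.2.2
    · exact absurd ((hT.reach u' v h').tail h') h.1.2.2
    · exact (firstArc_unique h h').1

/-- The out-branching that is constructed arc by arc. -/
def grow (D : Digraph (Fin n)) (r : Fin n) : Digraph (Fin n) := (growStep D r)^[n + 1] ⊥

theorem isOutBranching_grow (hD : ∀ v, Reach D r v) : IsOutBranching D r (grow D r) := by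
  have hstep : ∀ T, IsOutTree D r T → (¬ ∀ v, Reach T r v) →
      {v | Reach T r v}.ncard < {v | Reach (growStep D r T) r v}.ncard := by
    intro T hT hP
    push Not at hP
    obtain ⟨w, hw⟩ := hP
    have : ∃ u v, (leavingArcs D r T).Adj u v := by
      by_contra! hc
      have : ∀ v, Reach D r v → Reach T r v := fun v hv => by
        induction hv with
        | refl => exact .refl
        | tail _ h ih => exact by_contra fun hn => hc _ _ ⟨h, ih, hn⟩
      exact hw (this w (hD w))
    obtain ⟨u, v, h⟩ := this
    obtain ⟨u, v, h⟩ := exists_firstArc h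
    refine Set.ncard_lt_ncard ⟨fun x hx => ?_, fun hs => h.1.2.2 (hs ?_)⟩ (Set.toFinite _)
    · exact Reach.mono hx fun _ _ h => .inl h
    · exact Relation.ReflTransGen.tail (h.1.2.1.mono fun _ _ h => .inl h) (.inr h)
  obtain ⟨h1, h2⟩ := iterate_attains (f := growStep D r) (I := IsOutTree D r)
    (P := fun T => ∀ v, Reach T r v) (μ := fun T => {v | Reach T r v}.ncard) (m := n) (x := ⊥)
    (fun T hT => hT.growStep) (fun T _ hT v => (hT v).mono fun _ _ h => .inl h) hstep
    (fun T _ => (Set.ncard_le_card _).trans (by simp))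
    ⟨fun _ _ h => h.elim, fun _ _ h => h.elim, fun _ h => h.elim, fun _ _ _ h => h.elim⟩
  refine ⟨h1.subgraph, h1.root, fun v hv => ?_, h2⟩
  rcases Relation.ReflTransGen.cases_tail (h2 v) with rfl | ⟨u, -, hu⟩
  · exact absurd rfl hv
  · exact ⟨u, hu, fun u' hu' => h1.unique _ _ _ hu' hu⟩

/-- The arcs of `D` whose 1-changes give better out-branchings. -/
def improvingArcs (D : Digraph (Fin n)) (r : Fin n) (T : Digraph (Fin n)) : Digraph (Fin n) :=
  ⟨fun u v => D.Adj u v ∧ v ≠ r ∧ ¬ Reach T v u ∧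
    (leaves T).ncard < (leaves (oneChange T u v)).ncard⟩

/-- Carry out an improving 1-change. -/
def improveStep (D : Digraph (Fin n)) (r : Fin n) (T : Digraph (Fin n)) : Digraph (Fin n) :=
  ⟨fun a b => (T.Adj a b ∧ ∀ u, ¬ (firstArc (improvingArcs D r T)).Adj u b) ∨
    (firstArc (improvingArcs D r T)).Adj a b⟩

theorem improveStep_eq_or (D : Digraph (Fin n)) (r : Fin n) (T : Digraph (Fin n)) :
    (improveStep D r T = T ∧ ∀ u v, ¬ (improvingArcs D r T).Adj u v) ∨
      ∃ u v, (improvingArcs D r T).Adj u v ∧ improveStep D r T = oneChange T u v := by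
  by_cases h : ∃ u v, (improvingArcs D r T).Adj u v
  · obtain ⟨u, v, h⟩ := h
    obtain ⟨u, v, h⟩ := exists_firstArc h
    refine .inr ⟨u, v, h.1, ?_⟩
    have he : ∀ a b, (firstArc (improvingArcs D r T)).Adj a b ↔ a = u ∧ b = v := fun a b =>
      ⟨fun h' => firstArc_unique h' h, by rintro ⟨rfl, rfl⟩; exact h⟩
    ext a b
    simp [improveStep, oneChange, he]
  · push Not at h
    refine .inl ⟨?_, h⟩
    ext a b
    have : ∀ a b, ¬ (firstArc (improvingArcs D r T)).Adj a b := fun a b h' => h a b h'.1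
    simp [improveStep, this]

theorem IsOutBranching.improveStep (hT : IsOutBranching D r T) :
    IsOutBranching D r (improveStep D r T) := by
  rcases improveStep_eq_or D r T with ⟨h, -⟩ | ⟨u, v, h, e⟩
  · rwa [h]
  · rw [e]
    exact hT.oneChange h.1 h.2.1 h.2.2.1

/-- The 1-optimal out-branching that is computed by successive 1-changes. -/
def optimize (D : Digraph (Fin n)) (r : Fin n) : Digraph (Fin n) :=
  (improveStep D r)^[n + 1] (grow D r)

/-- Each improving change raises the number of leaves, which is at most `n`; `n + 1` rounds
therefore end at an out-branching without improving arcs. -/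
theorem isOneOptimal_optimize (hD : ∀ v, Reach D r v) : IsOneOptimal D r (optimize D r) := by
  obtain ⟨h1, h2⟩ : IsOutBranching D r (optimize D r) ∧
      ∀ u v, ¬ (improvingArcs D r (optimize D r)).Adj u v := by
    refine iterate_attains (f := improveStep D r) (I := IsOutBranching D r)
      (P := fun T => ∀ u v, ¬ (improvingArcs D r T).Adj u v) (μ := fun T => (leaves T).ncard)
      (m := n) (x := grow D r) (fun T hT => hT.improveStep) (fun T _ hT => ?_) (fun T _ hT => ?_)
      (fun T _ => (Set.ncard_le_card _).trans (by simp)) (isOutBranching_grow hD)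
    · rcases improveStep_eq_or D r T with ⟨h, -⟩ | ⟨u, v, h, -⟩
      · rwa [h]
      · exact absurd h (hT u v)
    · rcases improveStep_eq_or D r T with ⟨-, h⟩ | ⟨u, v, h, e⟩
      · exact absurd h hT
      · rw [e]
        exact h.2.2.2
  -- `improvingArcs` admits only arcs with `u` not below `v`. Nothing is lost: if `u` is below `v`,
  -- the 1-change creates a cycle and is an out-branching for no root `s`.
  refine ⟨h1, fun u v huv hn hv s hs => not_lt.1 fun hlt => h2 u v ⟨huv, hv, fun h => ?_, hlt⟩⟩
  have key : ∀ w, Reach (optimize D r) v w → Reach (oneChange (optimize D r) u v) v w :=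
    fun w hw => by
      induction hw with
      | refl => exact .refl
      | tail h hab ih => exact ih.tail (.inl ⟨hab, fun e => h1.not_reach_parent hab (e ▸ h)⟩)
  exact hs.not_reach_parent (u := u) (v := v) (.inr ⟨rfl, rfl⟩) (key u h)

end Grow

/-! ### Programs for the 1-optimal out-branching -/

section Programs

variable {ι : Type} {N : ι → ℕ} {a : ι → Val} {n : ι → ℕ} {D T : ∀ i, Digraph (Fin (n i))}
  {r : ∀ i, Fin (n i)}

theorem PolyTime.firstArc (hn : PolyBdd N n) (hD : PolyTime N a fun i => encDigraph (D i)) :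
    PolyTime N a fun i => encDigraph (firstArc (D i)) := by
  refine .congr (Fml.polyTime_digraph (.and (.rel 0 1 0) (.all (.all (.or (.not (.rel 0 1 0))
    (.or (.lt 2 0) (.and (.eq 2 0) (.le 3 1)))))))
    (.str hn hD hD hD hD .nil .nil (k := fun _ => 0) (l := fun _ => 0)) hn) fun i => ?_
  simp [Fml.digraph, SpanningLeaf.firstArc, imp_iff_not_or]

theorem PolyTime.growStep (hn : PolyBdd N n) (hD : PolyTime N a fun i => encDigraph (D i))
    (hr : PolyTime N a fun i => encNat (r i)) (hT : PolyTime N a fun i => encDigraph (T i)) :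
    PolyTime N a fun i => encDigraph (growStep (D i) (r i) (T i)) := by
  have h : PolyTime N a fun i => encDigraph (leavingArcs (D i) (r i) (T i)) := by
    refine .congr (Fml.polyTime_digraph (.ex (.and (.isNum 0 0) (.and (.rel 0 2 1) (.and
      (.reach 1 0 2) (.not (.reach 1 0 1)))))) (.str hn hD hT hT hT hr hr) hn) fun i => ?_
    simp [Fml.digraph, leavingArcs, ← Fin.ext_iff]
  refine .congr (Fml.polyTime_digraph (.or (.rel 0 1 0) (.rel 1 1 0))
    (.str hn hT (h.firstArc hn) hT hT hr hr) hn) fun i => ?_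
  simp [Fml.digraph, SpanningLeaf.growStep]

theorem PolyTime.improveStep (hn : PolyBdd N n) (hD : PolyTime N a fun i => encDigraph (D i))
    (hr : PolyTime N a fun i => encNat (r i)) (hT : PolyTime N a fun i => encDigraph (T i)) :
    PolyTime N a fun i => encDigraph (improveStep (D i) (r i) (T i)) := by
  have h : PolyTime N a fun i => encDigraph (improvingArcs (D i) (r i) (T i)) := by
    refine .congr (Fml.polyTime_digraph (.ex (.and (.isNum 0 0) (.and (.rel 0 2 1) (.and
      (.not (.eq 1 0)) (.and (.not (.reach 1 1 2)) (.not (.cle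
        (.all (.not (.or (.and (.rel 1 1 0) (.not (.eq 0 3))) (.and (.eq 1 4) (.eq 0 3)))))
        (.leaf 1 0))))))))
      (.str hn hD hT hT hT hr hr) hn) fun i => ?_
    have hl : ∀ u v, leaves (oneChange (T i) u v) =
        {x | ∀ w, ((T i).Adj x w → w = v) ∧ (x = u → ¬ w = v)} := fun u v => by
      ext x; simp [leaves, oneChange]
    simp [Fml.digraph, improvingArcs, ← Fin.ext_iff, hl]
  refine .congr (Fml.polyTime_digraph (.or (.and (.rel 0 1 0) (.all (.not (.rel 1 0 1))))
    (.rel 1 1 0)) (.str hn hT (h.firstArc hn) hT hT hr hr) hn) fun i => ?_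
  simp [Fml.digraph, SpanningLeaf.improveStep]

theorem PolyTime.iterate_digraph {f : ∀ i, Digraph (Fin (n i)) → Digraph (Fin (n i))}
    (hn : PolyBdd N n) (hN : PolyTime N a fun i => encNat (n i))
    (hT : PolyTime N a fun i => encDigraph (T i))
    (hf : PolyTime (fun q : Σ i, Digraph (Fin (n i)) => N q.1)
      (fun q => Val.cons (encDigraph q.2) (a q.1)) (fun q => encDigraph (f q.1 q.2))) :
    PolyTime N a fun i => encDigraph ((f i)^[n i + 1] (T i)) := by
  refine .iterate (b := fun i j => encDigraph ((f i)^[j] (T i))) (m := fun i => n i + 1)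
    (.cons .nil hN) (hn.add (.const 1)) hT ?_
  simp only [Function.iterate_succ_apply']
  exact hf.reindex fun q : Σ i, Fin (n i + 1) => ⟨q.1, (f q.1)^[q.2] (T q.1)⟩

theorem PolyTime.optimize (hn : PolyBdd N n) (hD : PolyTime N a fun i => encDigraph (D i))
    (hr : PolyTime N a fun i => encNat (r i)) :
    PolyTime N a fun i => encDigraph (optimize (D i) (r i)) := by
  have hN := hD.order hn
  refine .iterate_digraph hn hN (.iterate_digraph hn hN ?_ ?_) ?_
  -- An unsatisfiable formula defines the empty digraph from which the tree grows.
  · exact .congr (Fml.polyTime_digraph (.and (.rel 0 1 0) (.not (.rel 0 1 0)))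
      (.str hn hD hD hD hD hr hr) hn) fun i => by
        congr 1; ext u v; simp [Fml.digraph]
  · exact .growStep (hn.reindex Sigma.fst) (.comp (.tl .id) (hD.reindex Sigma.fst))
      (.comp (.tl .id) (hr.reindex Sigma.fst)) (.hd .id)
  · exact .improveStep (hn.reindex Sigma.fst) (.comp (.tl .id) (hD.reindex Sigma.fst))
      (.comp (.tl .id) (hr.reindex Sigma.fst)) (.hd .id)

end Programs
end SpanningLeaf
namespace SpanningLeaf

/-! ### Lists -/

section Lists

variable {ι : Type} {N : ι → ℕ} {a : ι → Val}

/-- Moving cells one by one reverses their order; concatenation is obtained by reversing twice. -/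
theorem PolyTime.reverseAux {l m : ι → List Val} (hl : PolyTime N a fun i => encList (l i))
    (hlen : PolyBdd N fun i => (l i).length) (hm : PolyTime N a fun i => encList (m i)) :
    PolyTime N a fun i => encList ((l i).reverse ++ m i) := by
  have h := PolyTime.loop (b := fun i j => encList (((l i).take j).reverse ++ m i)) hl hlen
    (by simpa using hm) (.congr (.cons (.hd (.hd .id)) (.tl (.hd .id))) fun q => ?_)
  · simpa using h
  · simp [← List.take_append_getElem, Val.hd, Val.tl, encList]

theorem PolyTime.reverse {l : ι → List Val} (hl : PolyTime N a fun i => encList (l i))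
    (hlen : PolyBdd N fun i => (l i).length) : PolyTime N a fun i => encList (l i).reverse :=
  (PolyTime.reverseAux (m := fun _ => []) hl hlen .nil).congr (by simp)

theorem PolyTime.append {l m : ι → List Val} (hl : PolyTime N a fun i => encList (l i))
    (hlen : PolyBdd N fun i => (l i).length) (hm : PolyTime N a fun i => encList (m i)) :
    PolyTime N a fun i => encList (l i ++ m i) :=
  (PolyTime.reverseAux (hl.reverse hlen) (by simpa using hlen) hm).congr (by simp)

theorem PolyTime.flatten {L : ι → List (List Val)}
    (hL : PolyTime N a fun i => encList ((L i).map encList))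
    (hlen : PolyBdd N fun i => (L i).length) (hlen' : PolyBdd N fun i => (L i).flatten.length) :
    PolyTime N a fun i => encList (L i).flatten := by
  have h := PolyTime.loop (b := fun i j => encList ((L i).take j).flatten.reverse) hL
    (by simpa using hlen) (.congr .nil fun i => by simp [encList]) ?_
  · refine PolyTime.congr (.reverse (l := fun i => (L i).flatten.reverse) ?_ (by simpa using hlen'))
      (by simp)
    simpa using h
  · have hj : ∀ q : Σ i, Fin ((L i).map encList).length, (q.2 : ℕ) < (L q.1).length :=
      fun q => by simpa using q.2.2
    refine .congr (.reverseAux (l := fun q => (L q.1)[q.2]'(hj q))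
      (m := fun q => ((L q.1).take q.2).flatten.reverse)
      (.congr (.hd (.hd .id)) fun q => by simp [Val.hd])
      ((hlen'.reindex Sigma.fst).mono fun q => ?_) (.tl (.hd .id))) fun q => ?_
    · exact (List.sublist_flatten_of_mem (List.getElem_mem (hj q))).length_le
    · rw [List.take_add_one, List.getElem?_eq_getElem (hj q)]
      simp only [Option.toList_some, List.flatten_append, List.flatten_cons, List.flatten_nil,
        List.append_nil, List.reverse_append]
      rfl

theorem PolyTime.map {l : ι → List Val} {f : ∀ i, Fin (l i).length → Val}
    (hl : PolyTime N a fun i => encList (l i)) (hlen : PolyBdd N fun i => (l i).length)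
    (hf : PolyTime (fun q : Σ i, Fin (l i).length => N q.1)
      (fun q => Val.cons ((l q.1)[q.2]) (a q.1)) fun q => f q.1 q.2) :
    PolyTime N a fun i => encList (List.ofFn (f i)) := by
  have h := PolyTime.loop (b := fun i j => encList ((List.ofFn (f i)).take j).reverse) hl hlen
    (.congr .nil fun i => by simp [encList]) (.congr (.cons (.comp (.cons (.hd (.hd .id)) (.tl .id)) hf)
      (.tl (.hd .id))) fun q => ?_)
  · refine (PolyTime.reverse (l := fun i => (List.ofFn (f i)).reverse) ?_
      (by simpa using hlen)).congr (by simp)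
    refine h.congr fun i => ?_
    rw [List.take_of_length_le (by simp)]
  · simp [List.take_add_one, Val.hd, Val.tl, encList]

/-- A fold along a list, during which an invariant holds. -/
theorem PolyTime.foldl {α β : ι → Type} {encα : ∀ i, α i → Val} {encβ : ∀ i, β i → Val}
    {l : ∀ i, List (α i)} {f : ∀ i, β i → α i → β i} {x : ∀ i, β i} (I : ∀ i, β i → Prop)
    (hl : PolyTime N a fun i => encList ((l i).map (encα i)))
    (hlen : PolyBdd N fun i => (l i).length) (hx : PolyTime N a fun i => encβ i (x i))
    (hIx : ∀ i, I i (x i)) (hI : ∀ i, ∀ y ∈ l i, ∀ b, I i b → I i (f i b y))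
    (hf : PolyTime (fun q : {q : Σ i, β i × α i // I q.1 q.2.1 ∧ q.2.2 ∈ l q.1} => N q.1.1)
      (fun q => Val.cons (Val.cons (encα _ q.1.2.2) (encβ _ q.1.2.1)) (a q.1.1))
      (fun q => encβ _ (f q.1.1 q.1.2.1 q.1.2.2))) :
    PolyTime N a fun i => encβ i ((l i).foldl (f i) (x i)) := by
  have hinv : ∀ i j, I i (((l i).take j).foldl (f i) (x i)) := fun i j => by
    induction j with
    | zero => simpa using hIx i
    | succ j ih =>
      rw [List.take_add_one, List.foldl_append]
      cases h : (l i)[j]? with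
      | none => simpa using ih
      | some y => simpa using hI i y (List.mem_of_getElem? h) _ ih
  have hj : ∀ q : Σ i, Fin ((l i).map (encα i)).length, (q.2 : ℕ) < (l q.1).length :=
    fun q => by simpa using q.2.2
  have h := PolyTime.loop (b := fun i j => encβ i (((l i).take j).foldl (f i) (x i))) hl
    (by simpa using hlen) (by simpa using hx) (.congr (.comp (.congr .id fun q => ?_) (hf.reindex
      fun q : Σ i, Fin ((l i).map (encα i)).length =>
        (⟨⟨q.1, (((l q.1).take q.2).foldl (f q.1) (x q.1)), (l q.1)[q.2]'(hj q)⟩,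
          hinv _ _, List.getElem_mem _⟩ : {q : Σ i, β i × α i // I q.1 q.2.1 ∧ q.2.2 ∈ l q.1})))
      fun q => ?_)
  · simpa using h
  · simp
  · rw [List.take_add_one, List.getElem?_eq_getElem (hj q), List.foldl_append]
    rfl

theorem PolyTime.list_any {α : ι → Type} {enc : ∀ i, α i → Val} {l : ∀ i, List (α i)}
    {P : ∀ i, α i → Prop} (hl : PolyTime N a fun i => encList ((l i).map (enc i)))
    (hlen : PolyBdd N fun i => (l i).length)
    (hP : PolyTime (fun q : {q : Σ i, α i // q.2 ∈ l q.1} => N q.1.1)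
      (fun q => Val.cons (enc _ q.1.2) (a q.1.1)) (fun q => encProp (P q.1.1 q.1.2))) :
    PolyTime N a fun i => encProp (∃ y ∈ l i, P i y) := by
  have h := PolyTime.foldl (N := N) (a := a) (encβ := fun _ => encProp) (l := l)
    (f := fun i Q y => P i y ∨ Q) (x := fun _ => False) (fun _ _ => True) hl hlen .false
    (fun _ => trivial) (fun _ _ _ _ _ => trivial)
    (.or (.comp (.cons (.hd (.hd .id)) (.tl .id))
      (hP.reindex fun q : {q : Σ i, Prop × α i // True ∧ q.2.2 ∈ l q.1} =>
        ⟨⟨q.1.1, q.1.2.2⟩, q.2.2⟩)) (.tl (.hd .id)))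
  refine h.congr fun i => congrArg encProp ?_
  have : ∀ (m : List (α i)) (Q : Prop), m.foldl (fun Q y => P i y ∨ Q) Q ↔ Q ∨ ∃ y ∈ m, P i y := by
    intro m
    induction m with
    | nil => simp
    | cons y m ih =>
      intro Q
      simp only [List.foldl_cons, ih, List.mem_cons, exists_eq_or_imp]
      tauto
  simp [this]

end Lists

/-! ### Sets of states that are reached by nondeterministic steps -/

section Frontier

open Classical in
/-- Insert an element that is not in the list. -/
noncomputable def insertNew {α : Type*} (l : List α) (x : α) : List α := if x ∈ l then l else x :: l

/-- The successors of all members of a list, without repetitions. -/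
noncomputable def successors {α ε : Type*} (succ : ε → α → List α) (l : List α) (e : ε) : List α :=
  l.foldl (fun acc x => (succ e x).foldl insertNew acc) []

section

variable {α ε : Type*} {succ : ε → α → List α} {l : List α} {x y : α} {e : ε}

theorem mem_insertNew : y ∈ insertNew l x ↔ y = x ∨ y ∈ l := by
  rw [insertNew]
  split_ifs with h
  · exact ⟨.inr, fun h' => h'.elim (fun e => e ▸ h) id⟩
  · exact List.mem_cons

theorem nodup_insertNew (h : l.Nodup) : (insertNew l x).Nodup := by
  rw [insertNew]
  split_ifs with h'
  · exact h
  · exact List.nodup_cons.2 ⟨h', h⟩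

theorem mem_foldl_insertNew {m : List α} : y ∈ m.foldl insertNew l ↔ y ∈ m ∨ y ∈ l := by
  induction m generalizing l with
  | nil => simp
  | cons x m ih =>
    rw [List.foldl_cons, ih, mem_insertNew, List.mem_cons]
    tauto

theorem nodup_foldl_insertNew {m : List α} (h : l.Nodup) : (m.foldl insertNew l).Nodup := by
  induction m generalizing l with
  | nil => exact h
  | cons x m ih => exact ih (nodup_insertNew h)

theorem mem_successors : y ∈ successors succ l e ↔ ∃ x ∈ l, y ∈ succ e x := by
  have : ∀ m : List α, y ∈ l.foldl (fun acc x => (succ e x).foldl insertNew acc) m ↔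
      (∃ x ∈ l, y ∈ succ e x) ∨ y ∈ m := by
    induction l with
    | nil => simp
    | cons x l ih =>
      intro m
      rw [List.foldl_cons, ih, mem_foldl_insertNew]
      simp only [List.mem_cons, exists_eq_or_imp]
      rw [← or_assoc, or_comm (a := ∃ x ∈ l, y ∈ succ e x)]
  rw [successors, this]
  simp

theorem nodup_successors : (successors succ l e).Nodup := by
  have : ∀ m : List α, m.Nodup →
      (l.foldl (fun acc x => (succ e x).foldl insertNew acc) m).Nodup := by
    induction l with
    | nil => exact fun m h => h
    | cons x l ih => exact fun m h => ih _ (nodup_foldl_insertNew h)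
  exact this [] List.nodup_nil

end

variable {ι : Type} {N : ι → ℕ} {a : ι → Val} {α ε : ι → Type} {enc : ∀ i, α i → Val}
  {V : ∀ i, Set (α i)}

/-- A list without repetitions in the finite set `V i` is no longer than `V i` is large. This keeps
the lists of states, and with them the search for duplicates, polynomial. -/
theorem PolyTime.insertNew
    (hbdd : PolyBdd N fun i => (V i).ncard) (hfin : ∀ i, (V i).Finite)
    (heq : PolyTime (fun q : {q : Σ i, α i × α i // q.2.1 ∈ V q.1 ∧ q.2.2 ∈ V q.1} => N q.1.1)
      (fun q => Val.cons (enc _ q.1.2.1) (enc _ q.1.2.2)) fun q => encProp (q.1.2.1 = q.1.2.2))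
    {l : ∀ i, List (α i)} {x : ∀ i, α i} (hl : PolyTime N a fun i => encList ((l i).map (enc i)))
    (hx : PolyTime N a fun i => enc i (x i)) (hlV : ∀ i, (l i).Nodup ∧ ∀ y ∈ l i, y ∈ V i)
    (hxV : ∀ i, x i ∈ V i) :
    PolyTime N a fun i => encList ((SpanningLeaf.insertNew (l i) (x i)).map (enc i)) := by
  have hlen : PolyBdd N fun i => (l i).length := hbdd.mono fun i => by
    classical
    rw [← List.toFinset_card_of_nodup (hlV i).1, ← Set.ncard_coe_finset]
    exact Set.ncard_le_ncard (fun y hy => (hlV i).2 y (by simpa using hy)) (hfin i)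
  refine .congr (.ite (P := fun i => ∃ y ∈ l i, x i = y) (.list_any hl hlen ?_) hl (.cons hx hl))
    fun i => ?_
  · exact .comp (.cons (.comp (.tl .id)
      (hx.reindex fun q : {q : Σ i, α i // q.2 ∈ l q.1} => q.1.1)) (.hd .id)) (heq.reindex
      fun q : {q : Σ i, α i // q.2 ∈ l q.1} =>
        ⟨⟨q.1.1, x q.1.1, q.1.2⟩, hxV _, (hlV _).2 _ q.2⟩)
  · rw [SpanningLeaf.insertNew]
    by_cases h : x i ∈ l i <;> simp [h, encList]

/-- Two nested folds; both carry the invariant that the accumulated list has no repetitions and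
stays inside `V i`, so every single insertion is polynomial. -/
theorem PolyTime.successors {succ : ∀ i, ε i → α i → List (α i)} {c : ℕ}
    (hbdd : PolyBdd N fun i => (V i).ncard) (hfin : ∀ i, (V i).Finite)
    (heq : PolyTime (fun q : {q : Σ i, α i × α i // q.2.1 ∈ V q.1 ∧ q.2.2 ∈ V q.1} => N q.1.1)
      (fun q => Val.cons (enc _ q.1.2.1) (enc _ q.1.2.2)) fun q => encProp (q.1.2.1 = q.1.2.2))
    {l : ∀ i, List (α i)} {e : ∀ i, ε i}
    (hl : PolyTime N a fun i => encList ((l i).map (enc i)))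
    (hlV : ∀ i, (l i).Nodup ∧ ∀ y ∈ l i, y ∈ V i)
    (hV : ∀ i, ∀ x ∈ V i, ∀ y ∈ succ i (e i) x, y ∈ V i) (hc : ∀ i e x, (succ i e x).length ≤ c)
    (hs : PolyTime (fun q : {q : Σ i, α i // q.2 ∈ V q.1} => N q.1.1)
      (fun q => Val.cons (enc _ q.1.2) (a q.1.1))
      fun q => encList ((succ q.1.1 (e q.1.1) q.1.2).map (enc _))) :
    PolyTime N a fun i => encList ((SpanningLeaf.successors (succ i) (l i) (e i)).map (enc i)) := by
  have hlen : PolyBdd N fun i => (l i).length := hbdd.mono fun i => by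
    classical
    rw [← List.toFinset_card_of_nodup (hlV i).1, ← Set.ncard_coe_finset]
    exact Set.ncard_le_ncard (fun y hy => (hlV i).2 y (by simpa using hy)) (hfin i)
  refine .foldl (β := fun i => List (α i)) (encα := enc)
    (encβ := fun i l => encList (l.map (enc i))) (fun i l => l.Nodup ∧ ∀ y ∈ l, y ∈ V i) hl hlen .nil (fun i => ⟨List.nodup_nil, by simp⟩)
    (fun i y hy l h => ⟨nodup_foldl_insertNew h.1, fun z hz => ?_⟩) ?_
  · rcases mem_foldl_insertNew.1 hz with h' | h'
    · exact hV i y ((hlV i).2 y hy) z h'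
    · exact h.2 z h'
  · let κ := {q : Σ i, List (α i) × α i // (q.2.1.Nodup ∧ ∀ y ∈ q.2.1, y ∈ V q.1) ∧ q.2.2 ∈ l q.1}
    let A : κ → Val := fun q => Val.cons (Val.cons (enc _ q.1.2.2)
      (encList (q.1.2.1.map (enc _)))) (a q.1.1)
    have h1 : PolyTime (fun q : κ => N q.1.1) A fun q =>
        encList ((succ q.1.1 (e q.1.1) q.1.2.2).map (enc q.1.1)) :=
      .comp (.cons (.hd (.hd .id)) (.tl .id)) (hs.reindex fun q : κ =>
        ⟨⟨q.1.1, q.1.2.2⟩, (hlV _).2 _ q.2.2⟩)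
    refine PolyTime.foldl (N := fun q : κ => N q.1.1) (a := A) (α := fun q => α q.1.1)
      (β := fun q => List (α q.1.1)) (encα := fun q => enc q.1.1)
      (encβ := fun q l => encList (l.map (enc q.1.1)))
      (l := fun q => succ q.1.1 (e q.1.1) q.1.2.2) (f := fun q => SpanningLeaf.insertNew)
      (x := fun q => q.1.2.1)
      (fun q l => l.Nodup ∧ ∀ y ∈ l, y ∈ V q.1.1) h1 ((PolyBdd.const c).mono fun q => hc _ _ _)
      (.tl (.hd .id)) (fun q => q.2.1) (fun q y hy l h => ⟨nodup_insertNew h.1, fun z hz => ?_⟩) ?_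
    · rcases mem_insertNew.1 hz with rfl | h'
      · exact hV _ _ ((hlV _).2 _ q.2.2) _ hy
      · exact h.2 z h'
    · let K := {p : Σ q : κ, List (α q.1.1) × α q.1.1 //
        (p.2.1.Nodup ∧ ∀ y ∈ p.2.1, y ∈ V p.1.1.1) ∧ p.2.2 ∈ succ p.1.1.1 (e p.1.1.1) p.1.1.2.2}
      exact PolyTime.insertNew (ι := K) (α := fun p => α p.1.1.1.1) (V := fun p => V p.1.1.1.1)
        (enc := fun p => enc p.1.1.1.1)
        (hbdd.reindex fun p : K => p.1.1.1.1) (fun p => hfin _)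
        (heq.reindex fun q : {q : Σ p : K, α p.1.1.1.1 × α p.1.1.1.1 //
          q.2.1 ∈ V q.1.1.1.1.1 ∧ q.2.2 ∈ V q.1.1.1.1.1} =>
          ⟨⟨q.1.1.1.1.1.1, q.1.2⟩, q.2⟩)
        (.tl (.hd .id)) (.hd (.hd .id)) (fun p => p.2.1)
        fun p => hV _ _ ((hlV _).2 _ p.1.1.2.2) _ p.2.2

end Frontier
end SpanningLeaf
namespace SpanningLeaf

/-! ### Dynamic programming along a path decomposition -/

section Runs

variable {α ε : Type*} {succ : ε → α → List α}

/-- The state `t` can be reached from `s` by a sequence of nondeterministic steps. -/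
def Runs (succ : ε → α → List α) : List ε → α → α → Prop
  | [], s, t => s = t
  | e :: es, s, t => ∃ u ∈ succ e s, Runs succ es u t

theorem runs_append {es fs : List ε} {s t : α} :
    Runs succ (es ++ fs) s t ↔ ∃ u, Runs succ es s u ∧ Runs succ fs u t := by
  induction es generalizing s with
  | nil => simp [Runs]
  | cons e es ih =>
    simp only [List.cons_append, Runs, ih]
    exact ⟨fun ⟨u, hu, v, h, h'⟩ => ⟨v, ⟨u, hu, h⟩, h'⟩, fun ⟨v, ⟨u, hu, h⟩, h'⟩ => ⟨u, hu, v, h, h'⟩⟩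

theorem mem_foldl_successors {es : List ε} {l : List α} {t : α} :
    t ∈ es.foldl (successors succ) l ↔ ∃ s ∈ l, Runs succ es s t := by
  induction es generalizing l with
  | nil => simp [Runs]
  | cons e es ih =>
    simp only [List.foldl_cons, ih, mem_successors, Runs]
    exact ⟨fun ⟨u, ⟨s, hs, hu⟩, h⟩ => ⟨s, hs, u, hu, h⟩, fun ⟨s, hs, u, hu, h⟩ => ⟨u, ⟨s, hs, hu⟩, h⟩⟩

end Runs

/-- What has to be remembered, at a bag, of a set of arcs: the vertices of the bag with an
in-neighbour and with an out-neighbour, the connected components restricted to the bag, and the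
number of leaves among the vertices that have been left behind. -/
@[ext] structure DPState (n : ℕ) where
  hasIn : Set (Fin n)
  hasOut : Set (Fin n)
  conn : Digraph (Fin n)
  count : ℕ

/-- The events that are processed: possible choices of an arc, and moves to the next bag. -/
structure DPEvent (n : ℕ) where
  isArc : Prop
  tail : Fin n
  head : Fin n
  bag : Set (Fin n)

/-- The digraph `A` with the additional arc `(u, v)`. -/
def addArc {V : Type*} (A : Digraph V) (u v : V) : Digraph V := ⟨fun a b => A.Adj a b ∨ a = u ∧ b = v⟩

/-! ### Connected components of sets of arcs -/

section EqvGen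

variable {V : Type*} {A D T : Digraph V} {r u v a b : V}

/-- A new arc merges the components of its ends and changes nothing else. So the relation restricted
to a bag can be updated from the bag alone. -/
theorem eqvGen_addArc : Relation.EqvGen (addArc A u v).Adj a b ↔ Relation.EqvGen A.Adj a b ∨
    (Relation.EqvGen A.Adj a u ∧ Relation.EqvGen A.Adj v b) ∨
      (Relation.EqvGen A.Adj a v ∧ Relation.EqvGen A.Adj u b) := by
  constructor
  · intro h
    induction h with
    | rel a b h =>
      rcases h with h | ⟨rfl, rfl⟩
      · exact .inl (.rel _ _ h)
      · exact .inr (.inl ⟨.refl _, .refl _⟩)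
    | refl a => exact .inl (.refl _)
    | symm a b _ ih =>
      rcases ih with h | ⟨h, h'⟩ | ⟨h, h'⟩
      · exact .inl h.symm
      · exact .inr (.inr ⟨h'.symm, h.symm⟩)
      · exact .inr (.inl ⟨h'.symm, h.symm⟩)
    | trans a b c _ _ ih ih' =>
      rcases ih with h | ⟨h, h'⟩ | ⟨h, h'⟩ <;> rcases ih' with k | ⟨k, k'⟩ | ⟨k, k'⟩
      · exact .inl (h.trans _ _ _ k)
      · exact .inr (.inl ⟨h.trans _ _ _ k, k'⟩)
      · exact .inr (.inr ⟨h.trans _ _ _ k, k'⟩)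
      · exact .inr (.inl ⟨h, h'.trans _ _ _ k⟩)
      · exact .inr (.inl ⟨h, k'⟩)
      · exact .inl (h.trans _ _ _ k')
      · exact .inr (.inr ⟨h, h'.trans _ _ _ k⟩)
      · exact .inl (h.trans _ _ _ k')
      · exact .inr (.inr ⟨h, k'⟩)
  · have hm : ∀ {a b}, Relation.EqvGen A.Adj a b → Relation.EqvGen (addArc A u v).Adj a b :=
      fun h => h.mono fun _ _ h => .inl h
    have huv : Relation.EqvGen (addArc A u v).Adj u v := .rel _ _ (.inr ⟨rfl, rfl⟩)
    rintro (h | ⟨h, h'⟩ | ⟨h, h'⟩)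
    · exact hm h
    · exact ((hm h).trans _ _ _ huv).trans _ _ _ (hm h')
    · exact ((hm h).trans _ _ _ huv.symm).trans _ _ _ (hm h')

theorem eqvGen_mem_iff {S : Set V} (hS : ∀ a b, A.Adj a b → (a ∈ S ↔ b ∈ S))
    (h : Relation.EqvGen A.Adj a b) : a ∈ S ↔ b ∈ S := by
  induction h with
  | rel a b h => exact hS a b h
  | refl a => exact Iff.rfl
  | symm a b _ ih => exact ih.symm
  | trans a b c _ _ ih ih' => exact ih.trans ih'

theorem eq_of_eqvGen (hA : ∀ b, ¬ A.Adj a b ∧ ¬ A.Adj b a) (h : Relation.EqvGen A.Adj a b) :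
    a = b := by
  have := eqvGen_mem_iff (A := A) (S := {a}) (fun x y hxy => by
    constructor
    · rintro rfl; exact absurd hxy (hA y).1
    · rintro rfl; exact absurd hxy (hA x).2) h
  exact (this.1 rfl).symm

theorem Reach.eqvGen (h : Reach A a b) : Relation.EqvGen A.Adj a b := by
  induction h with
  | refl => exact .refl _
  | tail _ h ih => exact ih.trans _ _ _ (.rel _ _ h)

/-- Without the arc `(u, v)`, the subtree at `v` is a union of components of `A`. Hence the
acyclicity test never rejects an arc of the out-branching that is to be built. -/
theorem IsOutBranching.not_eqvGen (hT : IsOutBranching D r T) (hA : ∀ a b, A.Adj a b → T.Adj a b)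
    (huv : T.Adj u v) (hn : ¬ A.Adj u v) : ¬ Relation.EqvGen A.Adj u v := by
  intro h
  refine hT.not_reach_parent huv ((eqvGen_mem_iff (S := {w | Reach T v w}) (fun a b hab => ?_) h).2
    .refl)
  refine ⟨fun ha => Relation.ReflTransGen.tail ha (hA a b hab), fun hb => ?_⟩
  rcases hT.reach_parent (hA a b hab) hb with rfl | h'
  · exact absurd (hT.unique huv (hA _ _ hab) ▸ hab) hn
  · exact h'

end EqvGen

namespace DPState

variable {n : ℕ}

/-- Choose the arc `(u, v)`. -/
def add (s : DPState n) (u v : Fin n) : DPState n where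
  hasIn := insert v s.hasIn
  hasOut := insert u s.hasOut
  conn := ⟨fun a b => s.conn.Adj a b ∨ (s.conn.Adj a u ∧ s.conn.Adj v b) ∨
    (s.conn.Adj a v ∧ s.conn.Adj u b)⟩
  count := s.count

/-- The arc `(u, v)` may be chosen. -/
def CanAdd (D : Digraph (Fin n)) (r : Fin n) (s : DPState n) (u v : Fin n) : Prop :=
  D.Adj u v ∧ s.conn.Adj u u ∧ s.conn.Adj v v ∧ ¬ s.conn.Adj u v ∧ v ∉ s.hasIn ∧ v ≠ r

/-- Move to the bag `B`. -/
noncomputable def move (s : DPState n) (B : Set (Fin n)) : DPState n where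
  hasIn := s.hasIn ∩ B
  hasOut := s.hasOut ∩ B
  conn := ⟨fun a b => (a ∈ B ∧ b ∈ B) ∧ (s.conn.Adj a b ∨ a = b)⟩
  -- The truncation at `n` is inactive in states that represent a set of arcs, but it bounds the
  -- counter by `n` for all formal states.
  count := min (s.count + {x | s.conn.Adj x x ∧ x ∉ B ∧ x ∉ s.hasOut}.ncard) n

/-- The vertices that are left behind by a move have in-neighbours. -/
def CanMove (r : Fin n) (s : DPState n) (B : Set (Fin n)) : Prop :=
  ∀ x, s.conn.Adj x x → x ∉ B → x ∈ s.hasIn ∨ x = r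

open Classical in
/-- The possible states after an event. -/
noncomputable def next (D : Digraph (Fin n)) (r : Fin n) (e : DPEvent n) (s : DPState n) :
    List (DPState n) :=
  if e.isArc then (if s.CanAdd D r e.tail e.head then [s.add e.tail e.head, s] else [s])
  else (if s.CanMove r e.bag then [s.move e.bag] else [])

/-- The initial state. -/
def initial (n : ℕ) : DPState n := ⟨∅, ∅, ⊥, 0⟩

/-- The state `s` describes the set of arcs `A` when `Y` is the current bag and the vertices in
`F` have been left behind. -/
structure Represents (D : Digraph (Fin n)) (r : Fin n) (Y F : Set (Fin n)) (s : DPState n)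
    (A : Digraph (Fin n)) : Prop where
  conn : ∀ a b, s.conn.Adj a b ↔ a ∈ Y ∧ b ∈ Y ∧ Relation.EqvGen A.Adj a b
  hasIn : ∀ v, v ∈ s.hasIn ↔ v ∈ Y ∧ ∃ u, A.Adj u v
  hasOut : ∀ v, v ∈ s.hasOut ↔ v ∈ Y ∧ ∃ w, A.Adj v w
  count : s.count = {v | v ∈ F ∧ ∀ w, ¬ A.Adj v w}.ncard
  subgraph : ∀ u v, A.Adj u v → D.Adj u v
  seen : ∀ u v, A.Adj u v → (u ∈ F ∨ u ∈ Y) ∧ (v ∈ F ∨ v ∈ Y)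
  disjoint : ∀ v ∈ F, v ∉ Y
  root : ∀ u, ¬ A.Adj u r
  unique : ∀ u u' v, A.Adj u v → A.Adj u' v → u = u'
  parent : ∀ v ∈ F, v ≠ r → ∃ u, A.Adj u v
  -- Acyclicity in the form that is needed at the end: when only `r` lacks an in-neighbour, every
  -- vertex is reachable from `r`.
  rooted : ∀ v, ∃ ρ, Reach A ρ v ∧ ∀ u, ¬ A.Adj u ρ

namespace Represents

variable {D T A : Digraph (Fin n)} {r u v : Fin n} {Y Y' F : Set (Fin n)} {s : DPState n}

theorem initial : Represents D r ∅ ∅ (DPState.initial n) ⊥ where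
  conn a b := by simp [DPState.initial]
  hasIn v := by simp [DPState.initial]
  hasOut v := by simp [DPState.initial]
  count := by simp [DPState.initial]
  subgraph _ _ h := h.elim
  seen _ _ h := h.elim
  disjoint _ h := h.elim
  root _ h := h.elim
  unique _ _ _ h := h.elim
  parent _ h := h.elim
  rooted v := ⟨v, .refl, fun _ h => h.elim⟩

theorem mem_of_conn (h : Represents D r Y F s A) {x : Fin n} : s.conn.Adj x x ↔ x ∈ Y := by
  rw [h.conn]
  exact ⟨fun h => h.1, fun h => ⟨h, h, .refl _⟩⟩

theorem add (h : Represents D r Y F s A) (hc : s.CanAdd D r u v) :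
    Represents D r Y F (s.add u v) (addArc A u v) := by
  obtain ⟨huv, hu, hv, hnc, hin, hvr⟩ := hc
  rw [h.mem_of_conn] at hu hv
  have hne : ¬ Relation.EqvGen A.Adj u v := fun h' => hnc ((h.conn u v).2 ⟨hu, hv, h'⟩)
  have hpar : ∀ w, ¬ A.Adj w v := fun w hw => hin ((h.hasIn v).2 ⟨hv, w, hw⟩)
  refine ⟨fun a b => ?_, fun x => ?_, fun x => ?_, ?_, ?_, ?_, h.disjoint, ?_, ?_, ?_, fun x => ?_⟩
  · simp only [DPState.add, h.conn, eqvGen_addArc]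
    tauto
  · simp only [DPState.add, Set.mem_insert_iff, h.hasIn, addArc]
    constructor
    · rintro (rfl | ⟨hx, w, hw⟩)
      exacts [⟨hv, u, .inr ⟨rfl, rfl⟩⟩, ⟨hx, w, .inl hw⟩]
    · rintro ⟨hx, w, hw | ⟨-, rfl⟩⟩
      exacts [.inr ⟨hx, w, hw⟩, .inl rfl]
  · simp only [DPState.add, Set.mem_insert_iff, h.hasOut, addArc]
    constructor
    · rintro (rfl | ⟨hx, w, hw⟩)
      exacts [⟨hu, v, .inr ⟨rfl, rfl⟩⟩, ⟨hx, w, .inl hw⟩]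
    · rintro ⟨hx, w, hw | ⟨rfl, -⟩⟩
      exacts [.inr ⟨hx, w, hw⟩, .inl rfl]
  · simp only [DPState.add, h.count, addArc]
    congr 1
    ext x
    refine and_congr_right fun hx => forall_congr' fun w => not_congr ?_
    have : x ≠ u := fun e => h.disjoint x hx (e ▸ hu)
    simp [this]
  · rintro a b (hab | ⟨rfl, rfl⟩)
    exacts [h.subgraph a b hab, huv]
  · rintro a b (hab | ⟨rfl, rfl⟩)
    exacts [h.seen a b hab, ⟨.inr hu, .inr hv⟩]
  · rintro a (ha | ⟨-, e⟩)
    exacts [h.root a ha, hvr e.symm]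
  · rintro a a' b (hab | ⟨rfl, rfl⟩) (hab' | ⟨e, e'⟩)
    · exact h.unique a a' b hab hab'
    · exact absurd (e' ▸ hab) (hpar a)
    · exact absurd hab' (hpar a')
    · exact e.symm
  · intro x hx hxr
    obtain ⟨w, hw⟩ := h.parent x hx hxr
    exact ⟨w, .inl hw⟩
  · have hmono : ∀ {a b}, Reach A a b → Reach (addArc A u v) a b :=
      fun h => h.mono fun _ _ h => .inl h
    obtain ⟨ρ, hρ, hρ'⟩ := h.rooted x
    -- If `x` was reached from `v`, it is now reached from the root `τ` of `u`; and `τ ≠ v`, because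
    -- `u` and `v` were in different components.
    by_cases e : ρ = v
    · obtain ⟨τ, hτ, hτ'⟩ := h.rooted u
      refine ⟨τ, ((hmono hτ).tail (.inr ⟨rfl, rfl⟩)).trans (e ▸ hmono hρ), ?_⟩
      rintro w (hw | ⟨-, e'⟩)
      · exact hτ' w hw
      · exact hne (e' ▸ hτ.eqvGen).symm
    · refine ⟨ρ, hmono hρ, ?_⟩
      rintro w (hw | ⟨-, e'⟩)
      exacts [hρ' w hw, e e']

theorem move (h : Represents D r Y F s A) (hc : s.CanMove r Y') (hY : ∀ v ∈ Y', v ∉ F) :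
    Represents D r Y' (F ∪ (Y \ Y')) (s.move Y') A := by
  -- A vertex that is new in the bag has not yet been touched by any chosen arc, so it forms its own
  -- component and has no neighbours.
  have hnew : ∀ {a}, a ∈ Y' → a ∉ Y → ∀ b, ¬ A.Adj a b ∧ ¬ A.Adj b a := fun {a} ha ha' b =>
    ⟨fun hab => (h.seen a b hab).1.elim (hY a ha) ha', fun hab => (h.seen b a hab).2.elim (hY a ha) ha'⟩
  refine ⟨fun a b => ?_, fun x => ?_, fun x => ?_, ?_, h.subgraph, ?_, ?_, h.root, h.unique, ?_,
    h.rooted⟩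
  · simp only [DPState.move, h.conn, and_assoc]
    refine and_congr_right fun ha => and_congr_right fun hb => ⟨?_, fun hab => ?_⟩
    · rintro (⟨-, -, h⟩ | rfl)
      exacts [h, .refl _]
    · by_cases ha' : a ∈ Y
      · by_cases hb' : b ∈ Y
        · exact .inl ⟨ha', hb', hab⟩
        · exact .inr (eq_of_eqvGen (hnew hb hb') hab.symm).symm
      · exact .inr (eq_of_eqvGen (hnew ha ha') hab)
  · simp only [DPState.move, Set.mem_inter_iff, h.hasIn]
    constructor
    · rintro ⟨⟨-, h⟩, h'⟩
      exact ⟨h', h⟩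
    · rintro ⟨hx, w, hw⟩
      exact ⟨⟨by_contra fun hn => (hnew hx hn w).2 hw, w, hw⟩, hx⟩
  · simp only [DPState.move, Set.mem_inter_iff, h.hasOut]
    constructor
    · rintro ⟨⟨-, h⟩, h'⟩
      exact ⟨h', h⟩
    · rintro ⟨hx, w, hw⟩
      exact ⟨⟨by_contra fun hn => (hnew hx hn w).1 hw, w, hw⟩, hx⟩
  · have e : {v | v ∈ F ∪ (Y \ Y') ∧ ∀ w, ¬ A.Adj v w} =
        {v | v ∈ F ∧ ∀ w, ¬ A.Adj v w} ∪ {x | s.conn.Adj x x ∧ x ∉ Y' ∧ x ∉ s.hasOut} := by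
      ext x
      simp only [Set.mem_ofPred_eq, Set.mem_union, Set.mem_sdiff, h.mem_of_conn, h.hasOut, not_and,
        not_exists]
      tauto
    have hd : Disjoint {v | v ∈ F ∧ ∀ w, ¬ A.Adj v w}
        {x | s.conn.Adj x x ∧ x ∉ Y' ∧ x ∉ s.hasOut} := by
      rw [Set.disjoint_left]
      rintro x ⟨hx, -⟩ ⟨hx', -⟩
      exact h.disjoint x hx (h.mem_of_conn.1 hx')
    have hu := Set.ncard_union_eq hd (Set.toFinite _) (Set.toFinite _)
    -- The minimum is inactive, since the sum counts distinct vertices.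
    rw [e, DPState.move, hu, ← h.count, min_eq_left]
    rw [h.count, ← hu]
    exact (Set.ncard_le_card _).trans (by simp)
  · intro a b hab
    have := h.seen a b hab
    simp only [Set.mem_union, Set.mem_sdiff]
    tauto
  · rintro x (hx | ⟨-, hx⟩) hx'
    exacts [hY x hx' hx, hx hx']
  · rintro x (hx | ⟨hx, hx'⟩) hxr
    · exact h.parent x hx hxr
    · exact ((h.hasIn x).1 ((hc x (h.mem_of_conn.2 hx) hx').resolve_right hxr)).2

end Represents

end DPState

/-! ### Soundness and completeness of the dynamic program -/

section DP

variable {n : ℕ} {D T : Digraph (Fin n)} {r : Fin n}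

/-- The possible arcs. -/
def arcEvents (n : ℕ) : List (DPEvent n) :=
  (List.ofFn fun u => List.ofFn fun v => (⟨True, u, v, ∅⟩ : DPEvent n)).flatten

/-- The events at a bag. -/
def bagEvents (r : Fin n) (B : Set (Fin n)) : List (DPEvent n) := ⟨False, r, r, B⟩ :: arcEvents n

theorem isArc_of_mem {e : DPEvent n} (h : e ∈ arcEvents n) : e.isArc := by
  simp only [arcEvents, List.mem_flatten, List.mem_ofFn] at h
  obtain ⟨_, ⟨u, rfl⟩, h⟩ := h
  obtain ⟨v, rfl⟩ := List.mem_ofFn.1 h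
  trivial

theorem mem_arcEvents (u v : Fin n) : (⟨True, u, v, ∅⟩ : DPEvent n) ∈ arcEvents n :=
  List.mem_flatten.2 ⟨_, List.mem_ofFn.2 ⟨u, rfl⟩, List.mem_ofFn.2 ⟨v, rfl⟩⟩

open DPState

theorem exists_represents_of_runs_arcs {Y F : Set (Fin n)} {es : List (DPEvent n)}
    (hes : ∀ e ∈ es, e.isArc) {s t : DPState n} {A : Digraph (Fin n)}
    (hs : Represents D r Y F s A) (h : Runs (next D r) es s t) :
    ∃ A', Represents D r Y F t A' := by
  induction es generalizing s A with
  | nil => exact ⟨A, h ▸ hs⟩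
  | cons e es ih =>
    obtain ⟨u, hu, h⟩ := h
    have he := hes e List.mem_cons_self
    replace ih := fun {s A} => ih (fun e he => hes e (List.mem_cons_of_mem _ he)) (s := s) (A := A)
    rw [next, if_pos he] at hu
    split_ifs at hu with hc
    · rcases List.mem_pair.1 hu with rfl | rfl
      exacts [ih (hs.add hc) h, ih hs h]
    · rw [List.mem_singleton.1 hu] at h
      exact ih hs h

/-- The run chooses every arc of `T` inside the bag that is not yet present; being part of an
out-branching, it passes all the tests. -/
theorem exists_runs_arcs (hT : IsOutBranching D r T) {Y F : Set (Fin n)} {es : List (DPEvent n)}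
    (hes : ∀ e ∈ es, e.isArc) {s : DPState n} {A : Digraph (Fin n)} (hs : Represents D r Y F s A)
    (hA : ∀ a b, A.Adj a b → T.Adj a b) :
    ∃ t A', Runs (next D r) es s t ∧ Represents D r Y F t A' ∧ (∀ a b, A.Adj a b → A'.Adj a b) ∧
      (∀ a b, A'.Adj a b → T.Adj a b) ∧
      ∀ e ∈ es, e.tail ∈ Y → e.head ∈ Y → T.Adj e.tail e.head → A'.Adj e.tail e.head := by
  induction es generalizing s A with
  | nil => exact ⟨s, A, rfl, hs, fun _ _ h => h, hA, by simp⟩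
  | cons e es ih =>
    have he := hes e List.mem_cons_self
    replace ih := fun {s A} => ih (fun e he => hes e (List.mem_cons_of_mem _ he)) (s := s) (A := A)
    by_cases hc : e.tail ∈ Y ∧ e.head ∈ Y ∧ T.Adj e.tail e.head ∧ ¬ A.Adj e.tail e.head
    · obtain ⟨hu, hv, huv, hn⟩ := hc
      have hadd : s.CanAdd D r e.tail e.head := by
        refine ⟨hT.subgraph _ _ huv, hs.mem_of_conn.2 hu, hs.mem_of_conn.2 hv, fun h => ?_,
          fun h => ?_, fun h => hT.root _ (h ▸ huv)⟩
        · exact hT.not_eqvGen hA huv hn ((hs.conn _ _).1 h).2.2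
        · obtain ⟨-, w, hw⟩ := (hs.hasIn _).1 h
          exact hn (hT.unique (hA _ _ hw) huv ▸ hw)
      obtain ⟨t, A', h1, h2, h3, h4, h5⟩ := ih (hs.add hadd) (by
        rintro a b (h | ⟨rfl, rfl⟩)
        exacts [hA a b h, huv])
      refine ⟨t, A', ⟨_, ?_, h1⟩, h2, fun a b h => h3 a b (.inl h), h4, ?_⟩
      · rw [next, if_pos he, if_pos hadd]
        exact List.mem_cons_self
      · rintro f hf
        rcases List.mem_cons.1 hf with rfl | hf
        · exact fun _ _ _ => h3 _ _ (.inr ⟨rfl, rfl⟩)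
        · exact h5 f hf
    · obtain ⟨t, A', h1, h2, h3, h4, h5⟩ := ih hs hA
      refine ⟨t, A', ⟨s, ?_, h1⟩, h2, h3, h4, ?_⟩
      · rw [next, if_pos he]
        split_ifs <;> simp
      · rintro f hf
        rcases List.mem_cons.1 hf with rfl | hf
        · exact fun h6 h7 h8 => h3 _ _ (by tauto)
        · exact h5 f hf

/-- The bags of a path decomposition, with an empty bag before and after. -/
structure IsBagSequence (D : Digraph (Fin n)) (Y : ℕ → Set (Fin n)) (m : ℕ) : Prop where
  first : Y 0 = ∅
  last : Y (m + 1) = ∅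
  vertex : ∀ v, ∃ i ≤ m, v ∈ Y i
  edge : ∀ u v, D.Adj u v → ∃ i ≤ m, u ∈ Y i ∧ v ∈ Y i
  interval : ∀ v i j l, i ≤ j → j ≤ l → v ∈ Y i → v ∈ Y l → v ∈ Y j

/-- The events up to the `i`-th bag. -/
def eventsUpTo (r : Fin n) (Y : ℕ → Set (Fin n)) (i : ℕ) : List (DPEvent n) :=
  ((List.range i).map fun j => bagEvents r (Y (j + 1))).flatten

theorem eventsUpTo_succ (r : Fin n) (Y : ℕ → Set (Fin n)) (i : ℕ) :
    eventsUpTo r Y (i + 1) = eventsUpTo r Y i ++ bagEvents r (Y (i + 1)) := by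
  simp [eventsUpTo, List.range_succ]

/-- The vertices that have been left behind at the `i`-th bag. -/
def leftBehind (Y : ℕ → Set (Fin n)) (i : ℕ) : Set (Fin n) := {v | ∃ j ≤ i, v ∈ Y j} \ Y i

namespace IsBagSequence

variable {Y : ℕ → Set (Fin n)} {m i : ℕ}

theorem notMem_leftBehind (hY : IsBagSequence D Y m) {v : Fin n} (h : v ∈ Y (i + 1)) :
    v ∉ leftBehind Y i := by
  rintro ⟨⟨j, hj, hv⟩, hn⟩
  exact hn (hY.interval v j i (i + 1) hj (Nat.le_succ i) hv h)

theorem leftBehind_succ (hY : IsBagSequence D Y m) :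
    leftBehind Y i ∪ (Y i \ Y (i + 1)) = leftBehind Y (i + 1) := by
  ext v
  constructor
  · rintro (h | ⟨h, h'⟩)
    · obtain ⟨⟨j, hj, hv⟩, -⟩ := id h
      exact ⟨⟨j, by omega, hv⟩, fun h' => hY.notMem_leftBehind h' h⟩
    · exact ⟨⟨i, by omega, h⟩, h'⟩
  · rintro ⟨⟨j, hj, hv⟩, hn⟩
    by_cases h : v ∈ Y i
    · exact .inr ⟨h, hn⟩
    · refine .inl ⟨⟨j, ?_, hv⟩, h⟩
      rcases Nat.lt_succ_iff_lt_or_eq.1 (Nat.lt_succ_of_le hj) with h' | rfl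
      exacts [by omega, absurd hv hn]

theorem leftBehind_last (hY : IsBagSequence D Y m) (v : Fin n) : v ∈ leftBehind Y (m + 1) := by
  obtain ⟨i, hi, hv⟩ := hY.vertex v
  exact ⟨⟨i, by omega, hv⟩, by simp [hY.last]⟩

theorem represents_initial (hY : IsBagSequence D Y m) :
    Represents D r (Y 0) (leftBehind Y 0) (initial n) ⊥ := by
  have h : leftBehind Y 0 = ∅ := by
    ext v
    simp [leftBehind, hY.first]
  rw [h, hY.first]
  exact .initial

theorem exists_represents (hY : IsBagSequence D Y m) {s : DPState n}
    (h : Runs (next D r) (eventsUpTo r Y i) (initial n) s) :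
    ∃ A, Represents D r (Y i) (leftBehind Y i) s A := by
  induction i generalizing s with
  | zero => exact ⟨⊥, (show initial n = s from h) ▸ hY.represents_initial⟩
  | succ i ih =>
    rw [eventsUpTo_succ, runs_append] at h
    obtain ⟨t, h1, u, hu, h2⟩ := h
    obtain ⟨A, hA⟩ := ih h1
    rw [next, if_neg (by simp)] at hu
    split_ifs at hu with hc
    · have := hA.move hc fun v hv => hY.notMem_leftBehind hv
      rw [hY.leftBehind_succ] at this
      exact exists_represents_of_runs_arcs (fun e he => isArc_of_mem he) this
        (List.mem_singleton.1 hu ▸ h2)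
    · simp at hu

/-- After the final empty bag all vertices have been left behind. Thus all but `r` have an
in-neighbour, the root of every vertex is `r`, and the counter has seen every leaf. -/
theorem exists_outBranching (hY : IsBagSequence D Y m) {s : DPState n}
    (h : Runs (next D r) (eventsUpTo r Y (m + 1)) (initial n) s) :
    ∃ T, IsOutBranching D r T ∧ (leaves T).ncard = s.count := by
  obtain ⟨A, hA⟩ := hY.exists_represents h
  refine ⟨A, ⟨hA.subgraph, hA.root, fun v hv => ?_, fun v => ?_⟩, ?_⟩
  · obtain ⟨u, hu⟩ := hA.parent v (hY.leftBehind_last v) hv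
    exact ⟨u, hu, fun w hw => hA.unique w u v hw hu⟩
  · obtain ⟨ρ, h1, h2⟩ := hA.rooted v
    by_cases e : ρ = r
    · exact e ▸ h1
    · obtain ⟨u, hu⟩ := hA.parent ρ (hY.leftBehind_last ρ) e
      exact absurd hu (h2 u)
  · rw [hA.count]
    simp [leaves, hY.leftBehind_last]

theorem exists_runs (hY : IsBagSequence D Y m) (hT : IsOutBranching D r T) (i : ℕ) :
    ∃ s A, Runs (next D r) (eventsUpTo r Y i) (initial n) s ∧
      Represents D r (Y i) (leftBehind Y i) s A ∧ (∀ a b, A.Adj a b → T.Adj a b) ∧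
      ∀ j ≤ i, ∀ u ∈ Y j, ∀ v ∈ Y j, T.Adj u v → A.Adj u v := by
  induction i with
  | zero =>
    refine ⟨initial n, ⊥, rfl, hY.represents_initial, fun _ _ h => h.elim, fun j hj u hu => ?_⟩
    rw [Nat.le_zero.1 hj, hY.first] at hu
    exact hu.elim
  | succ i ih =>
    obtain ⟨s, A, h1, h2, h3, h4⟩ := ih
    -- The arc of `T` into a vertex `x` that is about to leave lies in some bag; were it a later
    -- one, `x` would still be in bag `i + 1`. So this arc has already been chosen.
    have hc : s.CanMove r (Y (i + 1)) := by
      intro x hx hx'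
      by_contra! hn
      obtain ⟨y, hy, -⟩ := hT.indegree x hn.2
      obtain ⟨j, -, hyj, hxj⟩ := hY.edge y x (hT.subgraph _ _ hy)
      rw [h2.mem_of_conn] at hx
      have hj : j ≤ i := by
        by_contra hlt
        exact hx' (hY.interval x i (i + 1) j (by omega) (by omega) hx hxj)
      exact hn.1 ((h2.hasIn x).2 ⟨hx, y, h4 j hj y hyj x hxj hy⟩)
    have h5 := h2.move hc fun v hv => hY.notMem_leftBehind hv
    rw [hY.leftBehind_succ] at h5
    obtain ⟨t, A', h6, h7, h8, h9, h10⟩ :=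
      exists_runs_arcs hT (fun e he => isArc_of_mem he) (es := arcEvents n) h5 h3
    refine ⟨t, A', ?_, h7, h9, fun j hj u hu v hv huv => ?_⟩
    · rw [eventsUpTo_succ, runs_append]
      exact ⟨s, h1, s.move (Y (i + 1)), by simp [next, hc], h6⟩
    · rcases Nat.lt_succ_iff_lt_or_eq.1 (Nat.lt_succ_of_le hj) with h' | rfl
      · exact h8 _ _ (h4 j (by omega) u hu v hv huv)
      · exact h10 _ (mem_arcEvents u v) hu hv huv

theorem exists_runs_count (hY : IsBagSequence D Y m) (hT : IsOutBranching D r T) :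
    ∃ s, Runs (next D r) (eventsUpTo r Y (m + 1)) (initial n) s ∧ s.count = (leaves T).ncard := by
  obtain ⟨s, A, h1, h2, h3, h4⟩ := hY.exists_runs hT (m + 1)
  have : A = T := by
    ext u v
    refine ⟨h3 u v, fun h => ?_⟩
    obtain ⟨j, hj, hu, hv⟩ := hY.edge u v (hT.subgraph _ _ h)
    exact h4 j (by omega) u hu v hv h
  subst this
  exact ⟨s, h1, by simp [h2.count, leaves, hY.leftBehind_last]⟩

end IsBagSequence

end DP
end SpanningLeaf
namespace SpanningLeaf

/-! ### The number of states at a bag -/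

namespace DPState

variable {n : ℕ} {B B' : Set (Fin n)} {s t : DPState n} {D : Digraph (Fin n)} {r u v : Fin n}

/-- The form of the states at the bag `B`. -/
structure IsStateAt (B : Set (Fin n)) (s : DPState n) : Prop where
  hasIn : s.hasIn ⊆ B
  hasOut : s.hasOut ⊆ B
  mem : ∀ a b, s.conn.Adj a b → a ∈ B ∧ b ∈ B
  refl : ∀ a ∈ B, s.conn.Adj a a
  symm : ∀ a b, s.conn.Adj a b → s.conn.Adj b a
  trans : ∀ a b c, s.conn.Adj a b → s.conn.Adj b c → s.conn.Adj a c
  count : s.count ≤ n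

namespace IsStateAt

theorem initial : IsStateAt ∅ (DPState.initial n) where
  hasIn := Set.Subset.rfl
  hasOut := Set.Subset.rfl
  mem _ _ h := h.elim
  refl _ h := h.elim
  symm _ _ h := h.elim
  trans _ _ _ h := h.elim
  count := Nat.zero_le n

theorem add (h : IsStateAt B s) (hc : s.CanAdd D r u v) : IsStateAt B (s.add u v) := by
  have hu := (h.mem _ _ hc.2.1).1
  have hv := (h.mem _ _ hc.2.2.1).1
  refine ⟨Set.insert_subset hv h.hasIn, Set.insert_subset hu h.hasOut, ?_, fun a ha =>
    .inl (h.refl a ha), ?_, ?_, h.count⟩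
  · rintro a b (h' | ⟨h', h''⟩ | ⟨h', h''⟩)
    exacts [h.mem a b h', ⟨(h.mem _ _ h').1, (h.mem _ _ h'').2⟩,
      ⟨(h.mem _ _ h').1, (h.mem _ _ h'').2⟩]
  · rintro a b (h' | ⟨h', h''⟩ | ⟨h', h''⟩)
    exacts [.inl (h.symm _ _ h'), .inr (.inr ⟨h.symm _ _ h'', h.symm _ _ h'⟩),
      .inr (.inl ⟨h.symm _ _ h'', h.symm _ _ h'⟩)]
  · rintro a b c (h1 | ⟨h1, h2⟩ | ⟨h1, h2⟩) (h3 | ⟨h3, h4⟩ | ⟨h3, h4⟩)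
    · exact .inl (h.trans _ _ _ h1 h3)
    · exact .inr (.inl ⟨h.trans _ _ _ h1 h3, h4⟩)
    · exact .inr (.inr ⟨h.trans _ _ _ h1 h3, h4⟩)
    · exact .inr (.inl ⟨h1, h.trans _ _ _ h2 h3⟩)
    · exact .inr (.inl ⟨h1, h4⟩)
    · exact .inl (h.trans _ _ _ h1 h4)
    · exact .inr (.inr ⟨h1, h.trans _ _ _ h2 h3⟩)
    · exact .inl (h.trans _ _ _ h1 h4)
    · exact .inr (.inr ⟨h1, h4⟩)

theorem move (h : IsStateAt B s) : IsStateAt B' (s.move B') where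
  hasIn := Set.inter_subset_right
  hasOut := Set.inter_subset_right
  mem _ _ h := h.1
  refl _ h := ⟨⟨h, h⟩, .inr rfl⟩
  symm _ _ h' := ⟨h'.1.symm, h'.2.imp (h.symm _ _) Eq.symm⟩
  trans a b c h1 h2 := by
    refine ⟨⟨h1.1.1, h2.1.2⟩, ?_⟩
    rcases h1.2 with h3 | rfl
    · rcases h2.2 with h4 | rfl
      exacts [.inl (h.trans _ _ _ h3 h4), .inl h3]
    · exact h2.2
  count := min_le_right _ _

end IsStateAt

/-- The state at a bag with the given sets, classes and number. -/
def ofCode (B : Set (Fin n)) (q : Set B × Set B × (B → B) × Fin (n + 1)) : DPState n where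
  hasIn := (↑) '' q.1
  hasOut := (↑) '' q.2.1
  conn := ⟨fun a b => ∃ (ha : a ∈ B) (hb : b ∈ B), q.2.2.1 ⟨a, ha⟩ = q.2.2.1 ⟨b, hb⟩⟩
  count := q.2.2.2

/-- An equivalence relation on `B` is encoded by a map `B → B` that chooses a representative of each
class. -/
theorem IsStateAt.mem_range_ofCode (h : IsStateAt B s) : s ∈ Set.range (ofCode B) := by
  let S : Setoid B := ⟨fun a b => s.conn.Adj a b, ⟨fun a => h.refl a a.2, h.symm _ _, h.trans _ _ _⟩⟩
  refine ⟨⟨(↑) ⁻¹' s.hasIn, (↑) ⁻¹' s.hasOut, fun a => (Quotient.mk S a).out,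
    ⟨s.count, Nat.lt_succ_of_le h.count⟩⟩, ?_⟩
  ext a b
  · simpa [ofCode] using @h.hasIn a
  · simpa [ofCode] using @h.hasOut a
  · simp only [ofCode, Quotient.out_inj]
    constructor
    · rintro ⟨ha, hb, e⟩
      exact Quotient.exact e
    · intro e
      exact ⟨(h.mem _ _ e).1, (h.mem _ _ e).2, Quotient.sound e⟩
  · rfl

theorem finite_isStateAt (B : Set (Fin n)) : {s | IsStateAt B s}.Finite :=
  (Set.finite_range (ofCode B)).subset fun _ h => h.mem_range_ofCode

/-- Two subsets, a map and a number: `2^b · 2^b · b^b · (n + 1)` codes for a bag of size `b`. -/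
theorem ncard_isStateAt_le {b : ℕ} (hB : B.ncard ≤ b) :
    {s | IsStateAt B s}.ncard ≤ (4 * b) ^ b * (n + 1) := by
  classical
  have h1 : {s | IsStateAt B s}.ncard ≤ (Set.range (ofCode B)).ncard :=
    Set.ncard_le_ncard (fun _ h => h.mem_range_ofCode) (Set.finite_range _)
  have h2 : (Set.range (ofCode B)).ncard ≤ Nat.card (Set B × Set B × (B → B) × Fin (n + 1)) := by
    rw [← Set.image_univ, ← Set.ncard_univ]
    exact Set.ncard_image_le
  have h3 : Nat.card (Set B × Set B × (B → B) × Fin (n + 1)) =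
      (4 * B.ncard) ^ B.ncard * (n + 1) := by
    have : Nat.card (Set B) = 2 ^ B.ncard := by
      rw [Nat.card_eq_fintype_card, Fintype.card_set, ← Nat.card_eq_fintype_card,
        Nat.card_coe_set_eq]
    simp only [Nat.card_prod, this, Nat.card_fun, Nat.card_coe_set_eq, Nat.card_fin, mul_pow,
      ← mul_assoc]
    rw [← mul_pow]
    norm_num
  refine h1.trans (h2.trans (h3.le.trans (Nat.mul_le_mul_right _ ?_)))
  -- Raising the exponent to `b` needs a positive base, hence the separate case `b = 0`.
  rcases Nat.eq_zero_or_pos b with rfl | hb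
  · simp [Nat.le_zero.1 hB]
  · exact (Nat.pow_le_pow_left (by omega) _).trans (Nat.pow_le_pow_right (by omega) hB)

/-- The states at the bags in the list. -/
def statesAt (X : List (Set (Fin n))) : Set (DPState n) := {s | ∃ B ∈ X, IsStateAt B s}

theorem finite_statesAt (X : List (Set (Fin n))) : (statesAt X).Finite := by
  have : statesAt X = ⋃ B ∈ {B | B ∈ X}, {s | IsStateAt B s} := by
    ext s
    simp [statesAt]
  rw [this]
  exact (List.finite_toSet X).biUnion fun B _ => finite_isStateAt B

theorem ncard_statesAt_le {X : List (Set (Fin n))} {b : ℕ} (hX : ∀ B ∈ X, B.ncard ≤ b) :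
    (statesAt X).ncard ≤ X.length * ((4 * b) ^ b * (n + 1)) := by
  induction X with
  | nil => simp [statesAt]
  | cons B X ih =>
    have : statesAt (B :: X) = {s | IsStateAt B s} ∪ statesAt X := by
      ext s
      simp [statesAt]
    rw [this, List.length_cons, Nat.succ_mul, add_comm]
    exact (Set.ncard_union_le _ _).trans (add_le_add
      (ncard_isStateAt_le (hX B List.mem_cons_self))
      (ih fun B hB => hX B (List.mem_cons_of_mem _ hB)))

theorem mem_statesAt_of_mem_next {X : List (Set (Fin n))} {e : DPEvent n}
    (he : e.isArc ∨ e.bag ∈ X) (hs : s ∈ statesAt X) (ht : t ∈ next D r e s) : t ∈ statesAt X := by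
  obtain ⟨B, hB, h⟩ := hs
  rw [next] at ht
  split_ifs at ht with h1 h2 h2
  · rcases List.mem_pair.1 ht with rfl | rfl
    exacts [⟨B, hB, h.add h2⟩, ⟨B, hB, h⟩]
  · exact ⟨B, hB, List.mem_singleton.1 ht ▸ h⟩
  · exact ⟨_, he.resolve_left h1, List.mem_singleton.1 ht ▸ h.move⟩
  · simp at ht

theorem length_next_le (e : DPEvent n) : (next D r e s).length ≤ 2 := by
  rw [next]
  split_ifs <;> simp

end DPState

/-! ### Path decompositions and dynamic programming -/

section Decide

open DPState

variable {n : ℕ} {D : Digraph (Fin n)} {X : List (Finset (Fin n))} {k : ℕ}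

/-- The bags of a path decomposition, followed by an empty bag. -/
def bagList (X : List (Finset (Fin n))) : List (Set (Fin n)) := X.map (↑) ++ [∅]

/-- The events along a path decomposition. -/
def events (r : Fin n) (X : List (Finset (Fin n))) : List (DPEvent n) :=
  ((bagList X).map (bagEvents r)).flatten

/-- The bags of a path decomposition, with empty bags before and after. -/
def bagAt (X : List (Finset (Fin n))) (j : ℕ) : Set (Fin n) := (∅ :: X.map (↑)).getD j ∅

theorem bagAt_succ {j : ℕ} (h : j < X.length) : bagAt X (j + 1) = X[j] := by
  simp [bagAt, h]

theorem bagAt_of_lt {j : ℕ} (h : X.length < j) : bagAt X j = ∅ := by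
  obtain _ | j := j
  · omega
  · simp [bagAt, List.getElem?_eq_none (show X.length ≤ j by omega)]

theorem exists_of_mem_bagAt {v : Fin n} {j : ℕ} (h : v ∈ bagAt X j) :
    ∃ (i : ℕ) (hi : i < X.length), j = i + 1 ∧ v ∈ X[i] := by
  obtain _ | j := j
  · simp [bagAt] at h
  · by_cases hj : j < X.length
    · exact ⟨j, hj, rfl, by simpa [bagAt_succ hj] using h⟩
    · simp [bagAt_of_lt (X := X) (j := j + 1) (by omega)] at h

theorem IsPathDecomposition.isBagSequence (h : IsPathDecomposition D X) :
    IsBagSequence D (bagAt X) X.length where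
  first := by simp [bagAt]
  last := bagAt_of_lt (Nat.lt_succ_self _)
  vertex v := by
    obtain ⟨B, hB, hv⟩ := h.vertex v
    obtain ⟨j, hj, rfl⟩ := List.getElem_of_mem hB
    exact ⟨j + 1, hj, by simpa [bagAt_succ hj] using hv⟩
  edge u v huv := by
    obtain ⟨B, hB, hu, hv⟩ := h.edge u v huv
    obtain ⟨j, hj, rfl⟩ := List.getElem_of_mem hB
    exact ⟨j + 1, hj, by simpa [bagAt_succ hj] using hu, by simpa [bagAt_succ hj] using hv⟩
  interval v i j l hij hjl hi hl := by
    obtain ⟨i, hi', rfl, hi''⟩ := exists_of_mem_bagAt hi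
    obtain ⟨l, hl', rfl, hl''⟩ := exists_of_mem_bagAt hl
    obtain _ | j := j
    · omega
    have hj : j < X.length := by omega
    have := h.interval v ⟨i, hi'⟩ ⟨j, hj⟩ ⟨l, hl'⟩ (Nat.le_of_succ_le_succ hij)
      (Nat.le_of_succ_le_succ hjl) hi'' hl''
    simpa [bagAt_succ hj] using this

theorem events_eq (r : Fin n) : events r X = eventsUpTo r (bagAt X) (X.length + 1) := by
  have : bagList X = (List.range (X.length + 1)).map fun j => bagAt X (j + 1) := by
    refine List.ext_getElem (by simp [bagList]) fun j h1 h2 => ?_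
    have hj : j < X.length + 1 := by simpa [bagList] using h1
    rcases Nat.lt_succ_iff_lt_or_eq.1 hj with h | rfl
    · simp [bagList, bagAt_succ h, List.getElem_append_left (as := X.map (fun B : Finset (Fin n) =>
        (B : Set (Fin n)))) (bs := [∅]) (i := j) (by simpa using h)]
    · simp [bagList, bagAt_of_lt]
  rw [events, this, eventsUpTo, List.map_map]
  rfl

/-- Folding `successors` over the events computes exactly the states that end a run, and these are
matched with out-branchings by soundness and completeness. -/
theorem hasLeafyOutBranching_iff (h : IsPathDecomposition D X) : HasLeafyOutBranching D k ↔
    ∃ r, ∃ s ∈ (events r X).foldl (successors (next D r)) [initial n], k ≤ s.count := by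
  simp only [mem_foldl_successors, List.mem_singleton, exists_eq_left, events_eq]
  refine exists_congr fun r => ⟨fun ⟨T, hT, hk⟩ => ?_, fun ⟨s, hs, hk⟩ => ?_⟩
  · obtain ⟨s, hs, e⟩ := h.isBagSequence.exists_runs_count hT
    exact ⟨s, hs, e ▸ hk⟩
  · obtain ⟨T, hT, e⟩ := h.isBagSequence.exists_outBranching hs
    exact ⟨T, hT, e ▸ hk⟩

theorem isArc_or_mem_of_mem_events {r : Fin n} {e : DPEvent n} (h : e ∈ events r X) :
    e.isArc ∨ e.bag ∈ bagList X := by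
  obtain ⟨_, h1, h2⟩ := List.mem_flatten.1 h
  obtain ⟨B, hB, rfl⟩ := List.mem_map.1 h1
  rcases List.mem_cons.1 h2 with rfl | h3
  exacts [.inr hB, .inl (isArc_of_mem h3)]

theorem length_arcEvents (n : ℕ) : (arcEvents n).length = n * n := by
  simp [arcEvents, List.length_flatten, Function.comp_def]

theorem length_events (r : Fin n) : (events r X).length = (X.length + 1) * (n * n + 1) := by
  simp [events, bagList, bagEvents, List.length_flatten, Function.comp_def, length_arcEvents]
  ring

end Decide
end SpanningLeaf
namespace SpanningLeaf

/-! ### The program for dynamic programming -/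

section

open DPState

variable {ι : Type} {N : ι → ℕ} {a : ι → Val} {n : ι → ℕ}

theorem PolyTime.iff {P Q : ι → Prop} (hP : PolyTime N a fun i => encProp (P i))
    (hQ : PolyTime N a fun i => encProp (Q i)) : PolyTime N a fun i => encProp (P i ↔ Q i) :=
  .congr (.ite hP hQ hQ.not) fun i => by by_cases h : P i <;> simp [h]

theorem PolyTime.set_eq {S T : ∀ i, Set (Fin (n i))} (hn : PolyTime N a fun i => encNat (n i))
    (h : PolyBdd N n) (hS : PolyTime N a fun i => encSet (S i))
    (hT : PolyTime N a fun i => encSet (T i)) : PolyTime N a fun i => encProp (S i = T i) := by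
  refine .congr (.not (.exists (P := fun i v => ¬ (v ∈ S i ↔ v ∈ T i)) hn h (.not (.iff
    (.mem (S := fun q : Σ i, Fin (n i) => S q.1) (v := fun q => q.2)
      (.comp (.tl .id) (hS.reindex Sigma.fst)) (.hd .id) (h.reindex Sigma.fst))
    (.mem (S := fun q : Σ i, Fin (n i) => T q.1) (v := fun q => q.2)
      (.comp (.tl .id) (hT.reindex Sigma.fst)) (.hd .id) (h.reindex Sigma.fst)))))) fun i => ?_
  simp [Set.ext_iff]

theorem PolyTime.digraph_eq {D E : ∀ i, Digraph (Fin (n i))}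
    (hn : PolyTime N a fun i => encNat (n i)) (h : PolyBdd N n)
    (hD : PolyTime N a fun i => encDigraph (D i)) (hE : PolyTime N a fun i => encDigraph (E i)) :
    PolyTime N a fun i => encProp (D i = E i) := by
  let φ := fun q : Σ p : Σ i, Fin (n i), Fin (n p.1) => q.1.1
  refine .congr (.not (.exists (P := fun i u => ∃ v, ¬ ((D i).Adj u v ↔ (E i).Adj u v)) hn h
    (.exists (P := fun (q : Σ i, Fin (n i)) v => ¬ ((D q.1).Adj q.2 v ↔ (E q.1).Adj q.2 v))
      (.comp (.tl .id) (hn.reindex Sigma.fst)) (h.reindex Sigma.fst) (.not (.iff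
    (.adj (D := fun q => D (φ q)) (u := fun q => q.1.2) (v := fun q => q.2)
      (.comp (.tl (.tl .id)) (hD.reindex φ)) (.hd (.tl .id)) (.hd .id) (h.reindex φ))
    (.adj (D := fun q => E (φ q)) (u := fun q => q.1.2) (v := fun q => q.2)
      (.comp (.tl (.tl .id)) (hE.reindex φ)) (.hd (.tl .id)) (.hd .id) (h.reindex φ)))))))
    fun i => ?_
  refine congrArg encProp (propext ?_)
  rw [← Digraph.adj_inj]
  simp [funext_iff]

theorem PolyTime.min {x y : ι → ℕ} (hx : PolyTime N a fun i => encNat (x i))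
    (hy : PolyTime N a fun i => encNat (y i)) (h : PolyBdd N y) :
    PolyTime N a fun i => encNat (Min.min (x i) (y i)) :=
  .congr (.ite (.nat_le hx hy h) hx hy) fun i => by rw [min_def]; split_ifs <;> rfl

/-- Encoding of states. -/
noncomputable def encState {n : ℕ} (s : DPState n) : Val :=
  .cons (encSet s.hasIn) (.cons (encSet s.hasOut) (.cons (encDigraph s.conn) (encNat s.count)))

/-- Encoding of events. -/
noncomputable def encEvent {n : ℕ} (e : DPEvent n) : Val :=
  .cons (encProp e.isArc) (.cons (encNat e.tail) (.cons (encNat e.head) (encSet e.bag)))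

/-! ### Operations on states -/

section State

variable {s t : ∀ i, DPState (n i)} {e : ∀ i, DPEvent (n i)} {D : ∀ i, Digraph (Fin (n i))}
  {r u v : ∀ i, Fin (n i)} {B : ∀ i, Set (Fin (n i))}

theorem PolyTime.state_eq (hn : PolyBdd N n) (hs : PolyTime N a fun i => encState (s i))
    (ht : PolyTime N a fun i => encState (t i)) (hsN : PolyBdd N fun i => (s i).count)
    (htN : PolyBdd N fun i => (t i).count) : PolyTime N a fun i => encProp (s i = t i) := by
  have hc : PolyTime N a fun i => encDigraph (s i).conn := .hd (.tl (.tl hs))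
  have hc' : PolyTime N a fun i => encDigraph (t i).conn := .hd (.tl (.tl ht))
  have hk : PolyTime N a fun i => encNat (s i).count := .tl (.tl (.tl hs))
  have hk' : PolyTime N a fun i => encNat (t i).count := .tl (.tl (.tl ht))
  refine .congr (.and (.set_eq (S := fun i => (s i).hasIn) (T := fun i => (t i).hasIn)
    (hc.order hn) hn (.hd hs) (.hd ht))
    (.and (.set_eq (S := fun i => (s i).hasOut) (T := fun i => (t i).hasOut)
      (hc.order hn) hn (.hd (.tl hs)) (.hd (.tl ht)))
      (.and (.digraph_eq (hc.order hn) hn hc hc')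
        (.and (.nat_le hk hk' htN) (.nat_le hk' hk hsN))))) fun i => ?_
  rw [DPState.ext_iff, Nat.le_antisymm_iff]

theorem PolyTime.fin_eq (hn : PolyBdd N n) (hu : PolyTime N a fun i => encNat (u i))
    (hv : PolyTime N a fun i => encNat (v i)) : PolyTime N a fun i => encProp (u i = v i) :=
  .congr (.and (.nat_le hu hv (hn.mono fun i => (v i).2.le))
    (.nat_le hv hu (hn.mono fun i => (u i).2.le))) fun i => by
      rw [Fin.ext_iff, Nat.le_antisymm_iff]

theorem PolyTime.canAdd (hn : PolyBdd N n) (hD : PolyTime N a fun i => encDigraph (D i))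
    (hr : PolyTime N a fun i => encNat (r i)) (hs : PolyTime N a fun i => encState (s i))
    (hu : PolyTime N a fun i => encNat (u i)) (hv : PolyTime N a fun i => encNat (v i)) :
    PolyTime N a fun i => encProp ((s i).CanAdd (D i) (r i) (u i) (v i)) := by
  have hc : PolyTime N a fun i => encDigraph (s i).conn := .hd (.tl (.tl hs))
  have hI : PolyTime N a fun i => encSet (s i).hasIn := .hd hs
  exact .and (.adj hD hu hv hn) (.and (.adj hc hu hu hn) (.and (.adj hc hv hv hn)
    (.and (.not (.adj hc hu hv hn)) (.and (.not (.mem hI hv hn)) (.not (.fin_eq hn hv hr))))))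

theorem PolyTime.dpAdd (hn : PolyBdd N n) (hs : PolyTime N a fun i => encState (s i))
    (hu : PolyTime N a fun i => encNat (u i)) (hv : PolyTime N a fun i => encNat (v i)) :
    PolyTime N a fun i => encState ((s i).add (u i) (v i)) := by
  have hc : PolyTime N a fun i => encDigraph (s i).conn := .hd (.tl (.tl hs))
  have hins : ∀ {S : ∀ i, Set (Fin (n i))} {w : ∀ i, Fin (n i)},
      (PolyTime N a fun i => encSet (S i)) → (PolyTime N a fun i => encNat (w i)) →
      PolyTime N a fun i => encSet (insert (w i) (S i)) := fun {S w} hS hw =>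
    .set (hc.order hn) hn (.or (P := fun q => q.2 = w q.1)
      (.fin_eq (n := fun q : Σ i, Fin (n i) => n q.1) (u := fun q => q.2) (hn.reindex Sigma.fst)
        (.hd .id) (.comp (.tl .id) (hw.reindex Sigma.fst)))
      (.mem (S := fun q : Σ i, Fin (n i) => S q.1) (v := fun q => q.2)
        (.comp (.tl .id) (hS.reindex Sigma.fst)) (.hd .id) (hn.reindex Sigma.fst)))
  refine .cons (hins (S := fun i => (s i).hasIn) (.hd hs) hv)
    (.cons (hins (S := fun i => (s i).hasOut) (.hd (.tl hs)) hu)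
      (.cons (.digraph (hc.order hn) hn ?_) (.tl (.tl (.tl hs)))))
  let φ := fun q : Σ p : Σ i, Fin (n i), Fin (n p.1) => q.1.1
  let b := fun q : Σ p : Σ i, Fin (n i), Fin (n p.1) =>
    Val.cons (encNat q.2) (Val.cons (encNat q.1.2) (a q.1.1))
  have hc' : PolyTime (fun q => N (φ q)) b fun q => encDigraph (s (φ q)).conn :=
    .comp (.tl (.tl .id)) (hc.reindex φ)
  have hu' : PolyTime (fun q => N (φ q)) b fun q => encNat (u (φ q)) :=
    .comp (.tl (.tl .id)) (hu.reindex φ)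
  have hv' : PolyTime (fun q => N (φ q)) b fun q => encNat (v (φ q)) :=
    .comp (.tl (.tl .id)) (hv.reindex φ)
  have adj : ∀ {x y : ∀ q, Fin (n (φ q))}, (PolyTime (fun q => N (φ q)) b fun q => encNat (x q)) →
    (PolyTime (fun q => N (φ q)) b fun q => encNat (y q)) → PolyTime (fun q => N (φ q)) b fun q =>
      encProp ((s (φ q)).conn.Adj (x q) (y q)) := fun hx hy => .adj hc' hx hy (hn.reindex φ)
  have hx : PolyTime (fun q => N (φ q)) b fun q => encNat q.1.2 := .hd (.tl .id)
  have hy : PolyTime (fun q => N (φ q)) b fun q => encNat q.2 := .hd .id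
  exact .or (adj hx hy) (.or (.and (adj hx hu') (adj hv' hy)) (.and (adj hx hv') (adj hu' hy)))

theorem PolyTime.canMove (hn : PolyBdd N n) (hr : PolyTime N a fun i => encNat (r i))
    (hs : PolyTime N a fun i => encState (s i)) (hB : PolyTime N a fun i => encSet (B i)) :
    PolyTime N a fun i => encProp ((s i).CanMove (r i) (B i)) := by
  have hc : PolyTime N a fun i => encDigraph (s i).conn := .hd (.tl (.tl hs))
  have hI : PolyTime N a fun i => encSet (s i).hasIn := .hd hs
  have hn' := hn.reindex (Sigma.fst (β := fun i => Fin (n i)))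
  refine .congr (.not (.exists (P := fun i x => ((s i).conn.Adj x x ∧ x ∉ B i) ∧
    ¬ (x ∈ (s i).hasIn ∨ x = r i)) (hc.order hn) hn
    (.and (.and (.adj (.comp (.tl .id) (hc.reindex Sigma.fst)) (.hd .id) (.hd .id) hn')
      (.not (.mem (.comp (.tl .id) (hB.reindex Sigma.fst)) (.hd .id) hn')))
      (.not (.or (.mem (.comp (.tl .id) (hI.reindex Sigma.fst)) (.hd .id) hn')
        (.fin_eq hn' (.hd .id) (.comp (.tl .id) (hr.reindex Sigma.fst)))))))) fun i => ?_
  simp only [CanMove, not_exists, not_and, not_not, and_imp]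

theorem PolyTime.dpMove (hn : PolyBdd N n) (hs : PolyTime N a fun i => encState (s i))
    (hB : PolyTime N a fun i => encSet (B i)) (hsN : PolyBdd N fun i => (s i).count) :
    PolyTime N a fun i => encState ((s i).move (B i)) := by
  have hc : PolyTime N a fun i => encDigraph (s i).conn := .hd (.tl (.tl hs))
  have hO : PolyTime N a fun i => encSet (s i).hasOut := .hd (.tl hs)
  have hk : PolyTime N a fun i => encNat (s i).count := .tl (.tl (.tl hs))
  have hn' := hn.reindex (Sigma.fst (β := fun i => Fin (n i)))
  have hinter : ∀ {S : ∀ i, Set (Fin (n i))}, (PolyTime N a fun i => encSet (S i)) →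
      PolyTime N a fun i => encSet (S i ∩ B i) := fun {S} hS =>
    .set (hc.order hn) hn (.and (.mem (.comp (.tl .id) (hS.reindex Sigma.fst)) (.hd .id) hn')
      (.mem (.comp (.tl .id) (hB.reindex Sigma.fst)) (.hd .id) hn'))
  refine .cons (hinter (S := fun i => (s i).hasIn) (.hd hs)) (.cons (hinter hO)
    (.cons (.digraph (hc.order hn) hn ?_) (.min (.add hk (.count (hc.order hn) hn
      (.and (.adj (.comp (.tl .id) (hc.reindex Sigma.fst)) (.hd .id) (.hd .id) hn')
        (.and (.not (.mem (.comp (.tl .id) (hB.reindex Sigma.fst)) (.hd .id) hn'))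
          (.not (.mem (.comp (.tl .id) (hO.reindex Sigma.fst)) (.hd .id) hn'))))) hsN)
      (hc.order hn) hn)))
  let φ := fun q : Σ p : Σ i, Fin (n i), Fin (n p.1) => q.1.1
  let b := fun q : Σ p : Σ i, Fin (n i), Fin (n p.1) =>
    Val.cons (encNat q.2) (Val.cons (encNat q.1.2) (a q.1.1))
  have hc' : PolyTime (fun q => N (φ q)) b fun q => encDigraph (s (φ q)).conn :=
    .comp (.tl (.tl .id)) (hc.reindex φ)
  have hB' : PolyTime (fun q => N (φ q)) b fun q => encSet (B (φ q)) :=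
    .comp (.tl (.tl .id)) (hB.reindex φ)
  exact .and (.and (.mem hB' (.hd (.tl .id)) (hn.reindex φ)) (.mem hB' (.hd .id) (hn.reindex φ)))
    (.or (.adj hc' (.hd (.tl .id)) (.hd .id) (hn.reindex φ))
      (.fin_eq (hn.reindex φ) (.hd (.tl .id)) (.hd .id)))

theorem PolyTime.next (hn : PolyBdd N n) (hD : PolyTime N a fun i => encDigraph (D i))
    (hr : PolyTime N a fun i => encNat (r i)) (he : PolyTime N a fun i => encEvent (e i))
    (hs : PolyTime N a fun i => encState (s i)) (hsN : PolyBdd N fun i => (s i).count) :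
    PolyTime N a fun i => encList ((next (D i) (r i) (e i) (s i)).map encState) := by
  have hu : PolyTime N a fun i => encNat (e i).tail := .hd (.tl he)
  have hv : PolyTime N a fun i => encNat (e i).head := .hd (.tl (.tl he))
  have hB : PolyTime N a fun i => encSet (e i).bag := .tl (.tl (.tl he))
  refine .congr (.ite (P := fun i => (e i).isArc) (.hd he)
    (.ite (.canAdd hn hD hr hs hu hv) (.cons (.dpAdd hn hs hu hv) (.cons hs .nil)) (.cons hs .nil))
    (.ite (.canMove hn hr hs hB) (.cons (.dpMove hn hs hB hsN) .nil) .nil)) fun i => ?_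
  rw [DPState.next]
  split_ifs <;> rfl

end State

/-! ### Events and the complete dynamic program -/

section Decide

variable {r : ∀ i, Fin (n i)} {B : ∀ i, Set (Fin (n i))} {D : ∀ i, Digraph (Fin (n i))}
  {X : ∀ i, List (Finset (Fin (n i)))} {k w : ι → ℕ}

theorem PolyTime.empty (hn : PolyTime N a fun i => encNat (n i)) (h : PolyBdd N n) :
    PolyTime N a fun i => encSet (∅ : Set (Fin (n i))) := .set hn h .false

theorem PolyTime.arcEvents (hn : PolyTime N a fun i => encNat (n i)) (h : PolyBdd N n) :
    PolyTime N a fun i => encList ((arcEvents (n i)).map encEvent) := by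
  have h1 : PolyTime N a fun i => encList (List.ofFn fun u => encList (List.ofFn fun v =>
      encEvent (⟨True, u, v, ∅⟩ : DPEvent (n i)))) := by
    refine .table hn h (.table (.comp (.tl .id) (hn.reindex Sigma.fst)) (h.reindex Sigma.fst)
      (.cons .true (.cons (.hd (.tl .id)) (.cons (.hd .id) (.comp (.tl (.tl .id)) ?_)))))
    exact (PolyTime.empty hn h).reindex fun q : Σ p : Σ i, Fin (n i), Fin (n p.1) => q.1.1
  refine .congr (.flatten (L := fun i => List.ofFn fun u => List.ofFn fun v =>
    encEvent (⟨True, u, v, ∅⟩ : DPEvent (n i))) (h1.congr fun i => ?_) (by simpa using h)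
    ((h.mul h).mono fun i => ?_)) fun i => ?_
  · simp [List.map_ofFn, Function.comp_def]
  · simp [List.length_flatten, Function.comp_def]
  · simp [SpanningLeaf.arcEvents, List.map_flatten, List.map_ofFn, Function.comp_def]

theorem PolyTime.bagList (hn : PolyTime N a fun i => encNat (n i)) (h : PolyBdd N n)
    (hX : PolyTime N a fun i => encBags (X i)) (hlen : PolyBdd N fun i => (X i).length) :
    PolyTime N a fun i => encList ((bagList (X i)).map encSet) := by
  refine .congr (.append (l := fun i => (X i).map fun B : Finset (Fin (n i)) => encSet (B : Set (Fin (n i))))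
    (m := fun i => [encSet (∅ : Set (Fin (n i)))]) hX (by simpa using hlen)
    (.cons (.empty hn h) .nil)) fun i => ?_
  simp [SpanningLeaf.bagList, Function.comp_def]

theorem PolyTime.events (hn : PolyTime N a fun i => encNat (n i)) (h : PolyBdd N n)
    (hr : PolyTime N a fun i => encNat (r i)) (hX : PolyTime N a fun i => encBags (X i))
    (hlen : PolyBdd N fun i => (X i).length) :
    PolyTime N a fun i => encList ((events (r i) (X i)).map encEvent) := by
  have hj : ∀ q : Σ i, Fin ((SpanningLeaf.bagList (X i)).map encSet).length,
      (q.2 : ℕ) < (SpanningLeaf.bagList (X q.1)).length :=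
    fun q => by simpa using q.2.2
  have h1 := PolyTime.map (f := fun i j => encList ((bagEvents (r i)
      ((SpanningLeaf.bagList (X i))[j]'(hj ⟨i, j⟩))).map encEvent)) (.bagList hn h hX hlen)
    ((hlen.add (.const 1)).mono fun i => by simp [SpanningLeaf.bagList]) (.cons (.cons .false
      (.cons (.comp (.tl .id) (hr.reindex Sigma.fst)) (.cons (.comp (.tl .id) (hr.reindex Sigma.fst))
        (.congr (.hd .id) fun q => by simp [Val.hd]))))
      (.comp (.tl .id) ((PolyTime.arcEvents hn h).reindex Sigma.fst)))
  refine .congr (.flatten (L := fun i => (SpanningLeaf.bagList (X i)).map fun B =>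
    (bagEvents (r i) B).map encEvent) (h1.congr fun i => congrArg encList ?_) ?_ ?_) fun i => ?_
  · exact List.ext_getElem (by simp) fun j h1 h2 => by simp
  · exact (hlen.add (.const 1)).mono fun i => by simp [SpanningLeaf.bagList]
  · refine ((hlen.add (.const 1)).mul ((h.mul h).add (.const 1))).mono fun i => ?_
    rw [← length_events (r i), SpanningLeaf.events]
    simp [List.length_flatten, Function.comp_def]
  · simp [SpanningLeaf.events, List.map_flatten, Function.comp_def]

/-- The measure `N` is required to bound the state count `(4b)^b` as well. Relative to it the
dynamic program is polynomial, and the exponential dependence on the width appears only when `N` is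
specified. -/
theorem PolyTime.hasLeafyOutBranching (h : PolyBdd N n)
    (hlen : PolyBdd N fun i => (X i).length)
    (hw : PolyBdd N fun i => (4 * (w i + 1)) ^ (w i + 1)) (hXw : ∀ i, WidthLE (X i) (w i))
    (hDX : ∀ i, IsPathDecomposition (D i) (X i)) (hD : PolyTime N a fun i => encDigraph (D i))
    (hX : PolyTime N a fun i => encBags (X i)) (hk : PolyTime N a fun i => encNat (k i)) :
    PolyTime N a fun i => encProp (HasLeafyOutBranching (D i) (k i)) := by
  have hn := hD.order h
  have hV : ∀ i, ∀ B ∈ SpanningLeaf.bagList (X i), B.ncard ≤ w i + 1 := fun i B hB => by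
    rcases List.mem_append.1 hB with h | h
    · obtain ⟨C, hC, rfl⟩ := List.mem_map.1 h
      simpa using hXw i C hC
    · simp [List.mem_singleton.1 h]
  have hI : ∀ i, IsStateAt ∅ (initial (n i)) := fun i => .initial
  have hbdd : PolyBdd N fun i => (statesAt (SpanningLeaf.bagList (X i))).ncard :=
    ((hlen.add (.const 1)).mul (hw.mul (h.add (.const 1)))).mono fun i =>
      (ncard_statesAt_le (hV i)).trans (by simp [SpanningLeaf.bagList])
  have hcount : ∀ i, ∀ s ∈ statesAt (SpanningLeaf.bagList (X i)), s.count ≤ n i :=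
    fun i s ⟨_, _, hs⟩ => hs.count
  -- The invariant of the main fold: no repetitions, and only states at bags of the decomposition;
  -- it bounds the length of every intermediate list.
  let I : ∀ q : Σ i, Fin (n i), List (DPState (n q.1)) → Prop := fun q l =>
    l.Nodup ∧ ∀ s ∈ l, s ∈ statesAt (SpanningLeaf.bagList (X q.1))
  have hI0 : ∀ q, I q [initial (n q.1)] := fun q => ⟨List.nodup_singleton _, fun s hs =>
    ⟨∅, by simp [SpanningLeaf.bagList], List.mem_singleton.1 hs ▸ hI q.1⟩⟩
  have hI1 : ∀ q : Σ i, Fin (n i), ∀ e ∈ SpanningLeaf.events q.2 (X q.1), ∀ l, I q l →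
      I q (SpanningLeaf.successors (DPState.next (D q.1) q.2) l e) := fun q e he l hl =>
    ⟨nodup_successors, fun t ht => by
      obtain ⟨s, hs, hst⟩ := mem_successors.1 ht
      exact mem_statesAt_of_mem_next (isArc_or_mem_of_mem_events he) (hl.2 s hs) hst⟩
  have hIfold : ∀ q : Σ i, Fin (n i), I q ((SpanningLeaf.events q.2 (X q.1)).foldl
      (SpanningLeaf.successors (DPState.next (D q.1) q.2)) [initial (n q.1)]) := fun q =>
    List.foldlRecOn _ _ (hI0 q) fun l hl e he => hI1 q e he l hl
  have heq : PolyTime (fun q : {q : Σ i, DPState (n i) × DPState (n i) //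
      q.2.1 ∈ statesAt (SpanningLeaf.bagList (X q.1)) ∧
        q.2.2 ∈ statesAt (SpanningLeaf.bagList (X q.1))} => N q.1.1)
      (fun q => Val.cons (encState q.1.2.1) (encState q.1.2.2))
      fun q => encProp (q.1.2.1 = q.1.2.2) := by
    have h' := h.reindex fun q : {q : Σ i, DPState (n i) × DPState (n i) //
      q.2.1 ∈ statesAt (SpanningLeaf.bagList (X q.1)) ∧
        q.2.2 ∈ statesAt (SpanningLeaf.bagList (X q.1))} => q.1.1
    exact .state_eq h' (.hd .id) (.tl .id) (h'.mono fun q => hcount _ _ q.2.1)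
      (h'.mono fun q => hcount _ _ q.2.2)
  have hempty : PolyTime N a fun i => encSet (∅ : Set (Fin (n i))) := .empty hn h
  have hbot : PolyTime N a fun i => encDigraph (⊥ : Digraph (Fin (n i))) := .digraph hn h .false
  have hinit : PolyTime N a fun i => encList ([initial (n i)].map encState) :=
    .cons (.cons hempty (.cons hempty (.cons hbot .nil))) .nil
  have hinit' : PolyTime (fun q : Σ i, Fin (n i) => N q.1) (fun q => Val.cons (encNat q.2) (a q.1))
      fun q => encList ([initial (n q.1)].map encState) :=
    .comp (.tl .id) (hinit.reindex Sigma.fst)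
  have hfold : PolyTime (fun q : Σ i, Fin (n i) => N q.1) (fun q => Val.cons (encNat q.2) (a q.1))
      fun q => encList (((SpanningLeaf.events q.2 (X q.1)).foldl (SpanningLeaf.successors
        (DPState.next (D q.1) q.2)) [initial (n q.1)]).map encState) := by
    refine .foldl (α := fun q => DPEvent (n q.1)) (β := fun q => List (DPState (n q.1)))
      (encα := fun _ => encEvent) (encβ := fun _ l => encList (l.map encState)) I
      (.events (.comp (.tl .id) (hn.reindex Sigma.fst)) (h.reindex Sigma.fst) (.hd .id)
        (.comp (.tl .id) (hX.reindex Sigma.fst)) (hlen.reindex Sigma.fst))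
      ((((hlen.add (.const 1)).mul ((h.mul h).add (.const 1))).reindex Sigma.fst).mono
        fun q => (length_events q.2).le)
      hinit' hI0 hI1 ?_
    · let κ := {q : Σ q : Σ i, Fin (n i), List (DPState (n q.1)) × DPEvent (n q.1) //
        I q.1 q.2.1 ∧ q.2.2 ∈ SpanningLeaf.events q.1.2 (X q.1.1)}
      let φ : κ → ι := fun q => q.1.1.1
      let A : κ → Val := fun q => Val.cons (Val.cons (encEvent q.1.2.2)
        (encList (q.1.2.1.map encState))) (Val.cons (encNat q.1.1.2) (a q.1.1.1))
      let σ := {p : Σ q : κ, DPState (n (φ q)) //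
        p.2 ∈ statesAt (SpanningLeaf.bagList (X (φ p.1)))}
      let ψ : σ → ι := fun p => φ p.1.1
      have hnext : PolyTime (fun p : σ => N (ψ p)) (fun p => Val.cons (encState p.1.2) (A p.1.1))
          fun p => encList ((DPState.next (D (ψ p)) p.1.1.1.1.2 p.1.1.1.2.2 p.1.2).map encState) :=
        .next (h.reindex ψ) (.comp (.tl (.tl (.tl .id))) (hD.reindex ψ)) (.hd (.tl (.tl .id)))
          (.hd (.hd (.tl .id))) (.hd .id) ((h.reindex ψ).mono fun p => hcount _ _ p.2)
      exact PolyTime.successors (ι := κ) (N := fun q => N (φ q)) (a := A)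
        (α := fun q => DPState (n (φ q))) (ε := fun q => DPEvent (n (φ q)))
        (enc := fun _ => encState) (V := fun q => statesAt (SpanningLeaf.bagList (X (φ q))))
        (succ := fun q => DPState.next (D (φ q)) q.1.1.2) (c := 2) (hbdd.reindex φ)
        (fun q => finite_statesAt _) (heq.reindex fun p : {p : Σ q : κ, DPState (n (φ q)) ×
          DPState (n (φ q)) // p.2.1 ∈ statesAt (SpanningLeaf.bagList (X (φ p.1))) ∧
            p.2.2 ∈ statesAt (SpanningLeaf.bagList (X (φ p.1)))} => ⟨⟨φ p.1.1, p.1.2⟩, p.2⟩)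
        (.tl (.hd .id)) (fun q => q.2.1) (fun q s hs t ht =>
          mem_statesAt_of_mem_next (isArc_or_mem_of_mem_events q.2.2) hs ht)
        (fun q e s => length_next_le e) hnext
  refine .congr (.exists (P := fun i v => ∃ s ∈ (SpanningLeaf.events v (X i)).foldl
    (SpanningLeaf.successors (DPState.next (D i) v)) [initial (n i)], k i ≤ s.count) hn h
    (.list_any (enc := fun _ => encState) hfold ?_ ?_)) fun i => by
      rw [← hasLeafyOutBranching_iff (hDX i)]
  · refine (hbdd.reindex Sigma.fst).mono fun q => ?_
    classical
    rw [← List.toFinset_card_of_nodup (hIfold q).1, ← Set.ncard_coe_finset]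
    exact Set.ncard_le_ncard (fun s hs => (hIfold q).2 s (by simpa using hs)) (finite_statesAt _)
  · let κ := {p : Σ q : Σ i, Fin (n i), DPState (n q.1) // p.2 ∈ (SpanningLeaf.events p.1.2
      (X p.1.1)).foldl (SpanningLeaf.successors (DPState.next (D p.1.1) p.1.2)) [initial (n p.1.1)]}
    let φ : κ → ι := fun p => p.1.1.1
    exact .nat_le (.comp (.tl (.tl .id)) (hk.reindex φ)) (.tl (.tl (.tl (.hd .id))))
      ((h.reindex φ).mono fun p => hcount _ _ ((hIfold p.1.1).2 _ p.2))

end Decide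

end

end SpanningLeaf
namespace SpanningLeaf

/-! ### The run of the algorithm -/

/-- Started in `σ`, the program `p` halts within `B` steps in a store that satisfies `Q`. -/
def Ends (p : Prog) (σ : Store) (B : ℕ) (Q : Store → Prop) : Prop :=
  ∃ t ≤ B, ∃ σ', Exec p σ σ' t ∧ Q σ'

/-- On input `a` the program `p` halts within `B` steps with output `b`. -/
def RunsWithin (p : Prog) (a b : Val) (B : ℕ) : Prop := ∃ t ≤ B, p.RunsTo a b t

theorem RunsWithin.mono {p : Prog} {a b : Val} {B C : ℕ} (h : RunsWithin p a b B) (hBC : B ≤ C) :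
    RunsWithin p a b C := by
  obtain ⟨t, ht, h⟩ := h
  exact ⟨t, ht.trans hBC, h⟩

namespace Ends

variable {p q : Prog} {l : List Prog} {σ : Store} {B C : ℕ} {Q R : Store → Prop} {e : Expr} {x : ℕ}

theorem mono (h : Ends p σ B Q) (hBC : B ≤ C) (hQ : ∀ σ', Q σ' → R σ') : Ends p σ C R := by
  obtain ⟨t, ht, σ', h, h'⟩ := h
  exact ⟨t, ht.trans hBC, σ', h, hQ σ' h'⟩

theorem assign (h : Q (Function.update σ x (e.eval σ))) : Ends (.assign x e) σ (e.cost + 1) Q :=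
  ⟨_, le_rfl, _, .assign _ _ _, h⟩

theorem call {b : Val} (hp : RunsWithin p (e.eval σ) b B) (h : Q (Function.update σ x b)) :
    Ends (.call x p e) σ (e.cost + B + 1) Q := by
  obtain ⟨t, ht, σ', hσ, rfl⟩ := hp
  exact ⟨_, by omega, _, .call hσ, h⟩

theorem skip (h : Q σ) : Ends .skip σ 1 Q := ⟨_, le_rfl, _, .skip _, h⟩

theorem seq (h : Ends p σ B fun σ' => Ends q σ' C Q) : Ends (.seq p q) σ (B + C + 1) Q := by
  obtain ⟨s, hs, σ₁, h1, t, ht, σ₂, h2, h⟩ := h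
  exact ⟨_, by omega, _, .seq h1 h2, h⟩

theorem block_cons (h : Ends p σ B fun σ' => Ends (block l) σ' C Q) :
    Ends (block (p :: l)) σ (B + C + 1) Q := seq h

theorem block_singleton (h : Ends p σ B Q) : Ends (block [p]) σ (B + 2) Q := by
  obtain ⟨t, ht, σ', h1, h2⟩ := h
  exact ⟨_, by omega, _, .seq h1 (.skip _), h2⟩

theorem cond {P : Prop} (he : e.eval σ = encProp P) (hp : P → Ends p σ B Q)
    (hq : ¬ P → Ends q σ C Q) : Ends (.cond e p q) σ (e.cost + (B + C) + 1) Q := by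
  by_cases h : P
  · obtain ⟨t, ht, σ', h1, h2⟩ := hp h
    exact ⟨_, by omega, _, .cond_true (by simp [he, encProp, h]) h1, h2⟩
  · obtain ⟨t, ht, σ', h1, h2⟩ := hq h
    exact ⟨_, by omega, _, .cond_false (by simp [he, encProp, h]) h1, h2⟩

theorem loop_done (he : e.eval σ = Val.nil) (h : Q σ) : Ends (.loop e p) σ (e.cost + 1) Q :=
  ⟨_, le_rfl, _, .loop_done he, h⟩

theorem loop_step (he : e.eval σ ≠ Val.nil) (h : Ends p σ B fun σ' => Ends (.loop e p) σ' C Q) :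
    Ends (.loop e p) σ (e.cost + B + C + 1) Q := by
  obtain ⟨s, hs, σ₁, h1, t, ht, σ₂, h2, h⟩ := h
  exact ⟨_, by omega, _, .loop_step he h1 h2, h⟩

end Ends

/-- The body of the main loop. -/
def loopBody (s : Steps) : Prog :=
  block
    [ .call 8 s.spans (.cons (.var 1) (.var 4)),
      .cond (.var 8)
        (block
          [ .call 5 s.removal (.cons (.var 1) (.var 4)),
            .call 6 s.oneOpt (.cons (.var 5) (.var 4)),
            .call 8 s.enoughLeaves (.cons (.var 6) (.var 2)),
            .cond (.var 8) returnYes (block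
              [ .call 8 s.manyBackward (.cons (.var 5) (.cons (.var 6) (.var 2))),
                .cond (.var 8) returnYes (block
                  [ .call 7 s.pathDecomp (.cons (.var 5) (.cons (.var 6) (.var 2))),
                    .call 8 s.dynProg (.cons (.cons (.var 5) (.var 2)) (.var 7)),
                    .cond (.var 8) returnYes .skip ]) ]) ])
        .skip,
      .assign 3 (.tl (.var 3)),
      .assign 4 (.cons .nil (.var 4)) ]

theorem algorithm_eq (s : Steps) : algorithm s = block
    [ .assign 1 (.hd (.var 0)), .assign 2 (.tl (.var 0)), .assign 0 .nil, .assign 3 (.var 1),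
      .assign 4 .nil, .loop (.var 3) (loopBody s) ] := rfl

/-! ### Analysis of the main loop -/

section Run

variable {n : ℕ} {D : Digraph (Fin n)} {r : Fin n}

/-- The steps of the algorithm for the root `r` are performed within `B` steps each. -/
structure RootRuns (s : Steps) (D : Digraph (Fin n)) (k : ℕ) (r : Fin n) (B : ℕ) : Prop where
  spans : RunsWithin s.spans (encInstance D r) (encProp (∀ v, Reach D r v)) B
  removal : (∀ v, Reach D r v) →
    RunsWithin s.removal (encInstance D r) (encDigraph (removeUseless D r)) B
  optimal : (∀ v, Reach D r v) → ∃ T, IsOneOptimal (removeUseless D r) r T ∧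
    RunsWithin s.oneOpt (encInstance (removeUseless D r) r) (encDigraph T) B ∧
    RunsWithin s.enoughLeaves (encInstance T k) (encProp (k ≤ (leaves T).ncard)) B ∧
    -- The later steps are required to halt only where the algorithm reaches them; `Steps.Correct`
    -- promises no more for the path decomposition.
    (¬ k ≤ (leaves T).ncard →
      RunsWithin s.manyBackward (Val.cons (encDigraph (removeUseless D r)) (encInstance T k))
        (encProp (HasManyBackwardHeads (removeUseless D r) T k)) B ∧
      (¬ HasManyBackwardHeads (removeUseless D r) T k →
        ∃ X : List (Finset (Fin n)),
        RunsWithin s.pathDecomp (Val.cons (encDigraph (removeUseless D r)) (encInstance T k))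
          (encBags X) B ∧
        RunsWithin s.dynProg (Val.cons (encInstance (removeUseless D r) k) (encBags X))
          (encProp (HasLeafyOutBranching (removeUseless D r) k)) B))

theorem RootRuns.mono {s : Steps} {k B C : ℕ} (h : RootRuns s D k r B) (hBC : B ≤ C) :
    RootRuns s D k r C where
  spans := h.spans.mono hBC
  removal hr := (h.removal hr).mono hBC
  optimal hr := by
    obtain ⟨T, h1, h2, h3, h4⟩ := h.optimal hr
    refine ⟨T, h1, h2.mono hBC, h3.mono hBC, fun h5 => ?_⟩
    obtain ⟨h6, h7⟩ := h4 h5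
    refine ⟨h6.mono hBC, fun h8 => ?_⟩
    obtain ⟨X, h9, h10⟩ := h7 h8
    exact ⟨X, h9.mono hBC, h10.mono hBC⟩

/-- An out-branching is itself the witness that none of its arcs is useless. -/
theorem isOutBranching_removeUseless_iff {T : Digraph (Fin n)} :
    IsOutBranching (removeUseless D r) r T ↔ IsOutBranching D r T :=
  ⟨fun h => ⟨fun u v huv => (h.subgraph u v huv).1, h.root, h.indegree, h.reach⟩,
    fun h => ⟨fun u v huv => ⟨h.subgraph u v huv, fun h' => h'.2 ⟨T, h, huv⟩⟩, h.root, h.indegree,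
      h.reach⟩⟩

theorem not_isUseless_removeUseless (u v : Fin n) : ¬ IsUseless (removeUseless D r) r u v := by
  rintro ⟨⟨h1, h2⟩, h3⟩
  exact h2 ⟨h1, fun ⟨T, hT, h⟩ => h3 ⟨T, isOutBranching_removeUseless_iff.2 hT, h⟩⟩

theorem HasLeafyOutBranching.of_removeUseless {k : ℕ}
    (h : HasLeafyOutBranching (removeUseless D r) k) : HasLeafyOutBranching D k := by
  obtain ⟨ρ, T, h, hk⟩ := h
  exact ⟨ρ, T, ⟨fun u v huv => (h.subgraph u v huv).1, h.root, h.indegree, h.reach⟩, hk⟩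

theorem hasLeafyOutBranching_iff_exists_root {k : ℕ} : HasLeafyOutBranching D k ↔
    ∃ r, (∀ v, Reach D r v) ∧ HasLeafyOutBranching (removeUseless D r) k := by
  constructor
  · rintro ⟨r, T, hT, hk⟩
    exact ⟨r, fun v => (hT.reach v).mono hT.subgraph, r, T, isOutBranching_removeUseless_iff.2 hT, hk⟩
  · rintro ⟨r, -, h⟩
    exact h.of_removeUseless

/-- The stores in which an iteration of the main loop ends, where `P` says whether the algorithm
returns YES. -/
def AfterBody (σ : Store) (P : Prop) (σ' : Store) : Prop :=
  σ' 1 = σ 1 ∧ σ' 2 = σ 2 ∧ σ' 4 = Val.cons Val.nil (σ 4) ∧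
    (P → σ' 0 = encProp True ∧ σ' 3 = Val.nil) ∧ (¬ P → σ' 0 = Val.nil ∧ σ' 3 = (σ 3).tl)

/-- At most seven subroutines are called, each within `B` steps. The two early answers YES are right
by the out-branching `T` itself and by `hasLeafyOutBranching_of_manyBackwardHeads`. -/
theorem ends_loopBody {s : Steps} {k B : ℕ} (h : RootRuns s D k r B) {σ : Store}
    (h0 : σ 0 = Val.nil) (h1 : σ 1 = encDigraph D) (h2 : σ 2 = encNat k) (h4 : σ 4 = encNat r) :
    Ends (loopBody s) σ (7 * B + 200) (AfterBody σ
      ((∀ v, Reach D r v) ∧ HasLeafyOutBranching (removeUseless D r) k)) := by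
  have hend : ∀ {P : Prop} {σ' : Store}, σ' 1 = σ 1 → σ' 2 = σ 2 → σ' 4 = σ 4 →
      (P → σ' 0 = encProp True ∧ σ' 3 = Val.nil) → (¬ P → σ' 0 = Val.nil ∧ σ' 3 = σ 3) →
      Ends (block [.assign 3 (.tl (.var 3)), .assign 4 (.cons .nil (.var 4))]) σ' 11
        (AfterBody σ P) := fun h1 h2 h4 h h' =>
    .mono (.block_cons (.assign (.block_cons (.assign (.skip (Q := AfterBody σ _) ⟨by simpa,
      by simpa, by simpa [Expr.eval], fun hP => by simp [h hP, Expr.eval, Val.tl],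
      fun hP => by simp [h' hP, Expr.eval]⟩))))) (by simp [Expr.cost]) fun _ h => h
  by_cases hr : ∀ v, Reach D r v
  · obtain ⟨T, hT, h5, h6, h7⟩ := h.optimal hr
    -- After YES the list of rows is `nil`, and so is its tail; the closing assignments therefore do
    -- not restart the loop.
    have hyes : ∀ {σ' : Store} {P : Prop}, P → σ' 1 = σ 1 → σ' 2 = σ 2 → σ' 4 = σ 4 →
        Ends returnYes σ' 10 (fun σ' => Ends (block [.assign 3 (.tl (.var 3)),
          .assign 4 (.cons .nil (.var 4))]) σ' 11 (AfterBody σ P)) := fun hP h1 h2 h4 =>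
      .mono (.block_cons (.assign (.block_singleton (.assign (hend (by simpa) (by simpa)
        (by simpa) (fun _ => by simp [Expr.eval, encProp]) fun h => absurd hP h)))))
        (by simp [Expr.cost]) fun _ h => h
    have hL : k ≤ (leaves T).ncard → HasLeafyOutBranching (removeUseless D r) k :=
      fun h => ⟨r, T, hT.1, h⟩
    have hM : HasManyBackwardHeads (removeUseless D r) T k →
        HasLeafyOutBranching (removeUseless D r) k :=
      hasLeafyOutBranching_of_manyBackwardHeads not_isUseless_removeUseless hT
    refine .mono (.block_cons (.call (B := B) (b := encProp (∀ v, Reach D r v)) ?_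
      (.block_cons (.cond (P := ∀ v, Reach D r v) (C := 0) ?_ (fun _ =>
        .block_cons (.call (B := B) (b := encDigraph (removeUseless D r)) ?_
        (.block_cons (.call (B := B) (b := encDigraph T) ?_
        (.block_cons (.call (B := B) (b := encProp (k ≤ (leaves T).ncard)) ?_
        (.block_singleton (.cond (P := k ≤ (leaves T).ncard) ?_
          (fun h => hyes ⟨hr, hL h⟩ ?_ ?_ ?_) fun h =>
        .block_cons (.call (B := B)
          (b := encProp (HasManyBackwardHeads (removeUseless D r) T k)) ?_
        (.block_singleton (.cond (P := HasManyBackwardHeads (removeUseless D r) T k)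
          (C := 2 * B + 50) ?_
          (fun h => hyes ⟨hr, hM h⟩ ?_ ?_ ?_) fun h' => ?_)))))))))))
      fun h => absurd hr h)))) ?_ fun _ h => h
    rotate_right 2
    · obtain ⟨X, h8, h9⟩ := (h7 h).2 h'
      refine .mono (.block_cons (.call (B := B) (b := encBags X) ?_
        (.block_cons (.call (B := B) (b := encProp (HasLeafyOutBranching (removeUseless D r) k)) ?_
        (.block_singleton (.cond (P := HasLeafyOutBranching (removeUseless D r) k) ?_
          (fun h => hyes ⟨hr, h⟩ ?_ ?_ ?_) fun h =>
          .skip (hend ?_ ?_ ?_ (fun h' => absurd h'.2 h) fun _ => ?_))))))) ?_ fun _ h => h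
      · simpa [Expr.eval, h2, encInstance] using h8
      · simpa [Expr.eval, h2, encInstance] using h9
      all_goals simp [Expr.eval, Expr.cost, h0]
      omega
    · simp [Expr.cost]
      omega
    · simpa [Expr.eval, h1, h4, encInstance] using h.spans
    · simp [Expr.eval]
    · simpa [Expr.eval, h1, h4, encInstance] using h.removal hr
    · simpa [Expr.eval, h1, h4, encInstance] using h5
    · simpa [Expr.eval, h2, h4, encInstance] using h6
    · simp [Expr.eval]
    · simp
    · simp
    · simp
    · simpa [Expr.eval, h2, encInstance] using (h7 h).1
    all_goals simp [Expr.eval]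
  · refine .mono (.block_cons (.call (B := B) (b := encProp (∀ v, Reach D r v)) ?_
      (.block_cons (.cond (P := ∀ v, Reach D r v) (B := 0) ?_ (fun h => absurd h hr)
      (fun _ => .skip (hend ?_ ?_ ?_ (fun h => absurd h.1 hr) fun _ => ?_)))))) ?_ fun _ h => h
    · simpa [Expr.eval, h1, h4, encInstance] using h.spans
    all_goals simp [Expr.eval, Expr.cost, h0]
    omega

/-- The rows in variable 3 serve only as a counter, so their contents `f` are arbitrary. From row
`j` on, the answer concerns the roots `r ≥ j`. -/
theorem ends_loop {s : Steps} {k B : ℕ} (h : ∀ r : Fin n, RootRuns s D k r B) {f : Fin n → Val}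
    {m j : ℕ} (hj : j + m = n) {σ : Store} (h0 : σ 0 = Val.nil) (h1 : σ 1 = encDigraph D)
    (h2 : σ 2 = encNat k) (h3 : σ 3 = encList ((List.ofFn f).drop j)) (h4 : σ 4 = encNat j) :
    Ends (.loop (.var 3) (loopBody s)) σ (m * (7 * B + 202) + 2) fun σ' =>
      σ' 0 = encProp (∃ r : Fin n, j ≤ r ∧ (∀ v, Reach D r v) ∧
        HasLeafyOutBranching (removeUseless D r) k) := by
  induction m generalizing j σ with
  | zero =>
    refine .mono (.loop_done (Q := fun σ' => σ' 0 = encProp (∃ r : Fin n, j ≤ r ∧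
      (∀ v, Reach D r v) ∧ HasLeafyOutBranching (removeUseless D r) k)) ?_ ?_)
      (by simp [Expr.cost]) fun _ h => h
    · rw [Expr.eval, h3, List.drop_of_length_le (by simp; omega)]
      rfl
    · have : ¬ ∃ r : Fin n, j ≤ r ∧ (∀ v, Reach D r v) ∧
          HasLeafyOutBranching (removeUseless D r) k := by
        rintro ⟨r, hr, -⟩
        omega
      simp [h0, encProp, this]
  | succ m ih =>
    have hjn : j < n := by omega
    rw [List.drop_eq_getElem_cons (by simpa using hjn)] at h3
    refine .mono (.loop_step (by simp [Expr.eval, h3, encList])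
      (.mono (ends_loopBody (h ⟨j, hjn⟩) h0 h1 h2 h4) le_rfl fun σ' hσ' => ?_)
      (C := m * (7 * B + 202) + 2)) ?_ fun _ h => h
    · obtain ⟨h1', h2', h4', hyes, hno⟩ := hσ'
      by_cases hP : (∀ v, Reach D ⟨j, hjn⟩ v) ∧ HasLeafyOutBranching (removeUseless D ⟨j, hjn⟩) k
      · obtain ⟨h0', h3'⟩ := hyes hP
        refine .mono (.loop_done h3' (h0'.trans ?_)) (by simp [Expr.cost]) fun _ h => h
        exact congrArg encProp (eq_true ⟨⟨j, hjn⟩, le_rfl, hP⟩).symm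
      · obtain ⟨h0', h3'⟩ := hno hP
        refine .mono (ih (j := j + 1) (by omega) h0' (h1'.trans h1) (h2'.trans h2) ?_ ?_) le_rfl
          fun σ'' h => h.trans (congrArg encProp (propext ?_))
        · rw [h3', h3]
          rfl
        · rw [h4', h4]
          rfl
        · refine exists_congr fun r => ⟨fun ⟨h, h'⟩ => ⟨by omega, h'⟩, fun ⟨h, h'⟩ => ⟨?_, h'⟩⟩
          refine Nat.lt_of_le_of_ne h fun e => hP ?_
          rwa [show r = ⟨j, hjn⟩ from Fin.ext e.symm] at h'
    · simp only [Expr.cost, Nat.succ_mul]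
      omega

theorem runsWithin_algorithm {s : Steps} {k B : ℕ} (h : ∀ r : Fin n, RootRuns s D k r B) :
    RunsWithin (algorithm s) (encInstance D k) (encProp (HasLeafyOutBranching D k))
      (n * (7 * B + 202) + 40) := by
  have : Ends (algorithm s) (Store.start (encInstance D k)) (n * (7 * B + 202) + 40)
      fun σ' => σ' 0 = encProp (HasLeafyOutBranching D k) := by
    rw [algorithm_eq]
    refine .mono (.block_cons (.assign (.block_cons (.assign (.block_cons (.assign
      (.block_cons (.assign (.block_cons (.assign (.block_singleton
      (ends_loop h (f := fun u => encList (List.ofFn fun v => encProp (D.Adj u v)))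
      (j := 0) (m := n) (Nat.zero_add n) ?_ ?_ ?_ ?_ ?_)))))))))))) ?_ fun σ' h => ?_
    · simp [Expr.eval]
    · simp [Expr.eval, Store.start, encInstance, Val.hd]
    · simp [Expr.eval, Store.start, encInstance, Val.tl]
    · simp [Expr.eval, Store.start, encInstance, Val.hd]
      rfl
    · simp [Expr.eval, encNat]
    · simp only [Expr.cost]
      omega
    · rw [h, hasLeafyOutBranching_iff_exists_root]
      simp
  obtain ⟨t, ht, σ, hσ⟩ := this
  exact ⟨t, ht, σ, hσ⟩

theorem Prog.Computes.exists_runsWithin {p : Prog} {a b : Val} (h : p.Computes a b) :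
    ∃ B, RunsWithin p a b B := by
  obtain ⟨t, h⟩ := h
  exact ⟨t, t, le_rfl, h⟩

/-- Some out-branching with root `r` exists, and it survives the removal. -/
theorem reach_removeUseless (hD : ∀ v, Reach D r v) (v : Fin n) : Reach (removeUseless D r) r v :=
  ((isOneOptimal_optimize hD).1.reach v).mono
    (isOutBranching_removeUseless_iff.2 (isOneOptimal_optimize hD).1).subgraph

theorem Steps.Correct.exists_rootRuns {s : Steps} (hs : s.Correct) (D : Digraph (Fin n)) (k : ℕ)
    (r : Fin n) : ∃ B, RootRuns s D k r B := by
  obtain ⟨B₁, h₁⟩ := (hs.spans n D r).exists_runsWithin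
  by_cases hr : ∀ v, Reach D r v
  swap
  · exact ⟨B₁, h₁, fun h => absurd h hr, fun h => absurd h hr⟩
  obtain ⟨B₂, h₂⟩ := (hs.removal n D r hr).exists_runsWithin
  obtain ⟨T, hT, h₃⟩ := hs.oneOpt n _ r (reach_removeUseless hr) not_isUseless_removeUseless
  obtain ⟨B₃, h₃⟩ := h₃.exists_runsWithin
  obtain ⟨B₄, h₄⟩ := (hs.enoughLeaves n T k).exists_runsWithin
  obtain ⟨B₅, h₅⟩ := (hs.manyBackward n _ T r k hT.1).exists_runsWithin
  by_cases h : ¬ k ≤ (leaves T).ncard ∧ ¬ HasManyBackwardHeads (removeUseless D r) T k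
  · obtain ⟨X, hX, -, h₆⟩ := hs.pathDecomp n _ T r k not_isUseless_removeUseless hT h.1 h.2
    obtain ⟨B₆, h₆⟩ := h₆.exists_runsWithin
    obtain ⟨B₇, h₇⟩ := (hs.dynProg n _ X k hX).exists_runsWithin
    exact ⟨B₁ + B₂ + B₃ + B₄ + B₅ + B₆ + B₇, h₁.mono (by omega), fun _ => h₂.mono (by omega),
      fun _ => ⟨T, hT, h₃.mono (by omega), h₄.mono (by omega), fun _ => ⟨h₅.mono (by omega),
        fun _ => ⟨X, h₆.mono (by omega), h₇.mono (by omega)⟩⟩⟩⟩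
  · exact ⟨B₁ + B₂ + B₃ + B₄ + B₅, h₁.mono (by omega), fun _ => h₂.mono (by omega),
      fun _ => ⟨T, hT, h₃.mono (by omega), h₄.mono (by omega), fun h' => ⟨h₅.mono (by omega),
        fun h'' => absurd ⟨h', h''⟩ h⟩⟩⟩

theorem Steps.Correct.computes_algorithm {s : Steps} (hs : s.Correct) (D : Digraph (Fin n))
    (k : ℕ) : (algorithm s).Computes (encInstance D k) (encProp (HasLeafyOutBranching D k)) := by
  choose B hB using hs.exists_rootRuns D k
  -- The sum of the bounds over all roots serves as the common bound.
  obtain ⟨t, -, h⟩ := runsWithin_algorithm fun r =>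
    (hB r).mono (Finset.single_le_sum (f := B) (fun _ _ => Nat.zero_le _) (Finset.mem_univ r))
  exact ⟨t, h⟩

end Run

/-! ### Running times -/

/-- A bound for the numbers that depend on the parameter. -/
def paramBound (k : ℕ) : ℕ := k + 2 + if k ≤ 1 then 0 else (4 * (6 * k ^ 3 + 1)) ^ (6 * k ^ 3 + 1)

theorem RunsWithin.computes {p : Prog} {a b : Val} {B : ℕ} (h : RunsWithin p a b B) :
    p.Computes a b := by
  obtain ⟨t, -, h⟩ := h
  exact ⟨t, h⟩

/-- The same seven programs serve for correctness and for the time bound. What changes is only the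
input family: all path decompositions in one case, those of width at most `6 * k ^ 3` in the other.
-/
theorem exists_steps : ∃ s : Steps, s.Correct ∧ ∃ c, ∀ (n : ℕ) (D : Digraph (Fin n)) (k : ℕ)
    (r : Fin n), RootRuns s D k r (((n + 1) * paramBound k) ^ c) := by
  let ι₁ := Σ n, Digraph (Fin n) × Fin n
  let ι₂ := {q : ι₁ // ∀ v, Reach q.2.1 q.2.2 v}
  let ι₃ := Σ n, Digraph (Fin n) × ℕ
  let ι₄ := Σ n, Digraph (Fin n) × Digraph (Fin n) × ℕ
  let ι₅ := {q : Σ n, Digraph (Fin n) × List (Finset (Fin n)) × ℕ × ℕ //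
    IsPathDecomposition q.2.1 q.2.2.1 ∧ WidthLE q.2.2.1 q.2.2.2.2}
  obtain ⟨p₁, c₁, h₁⟩ := PolyTime.spans (N := fun q : ι₁ => q.1)
    (a := fun q => encInstance q.2.1 q.2.2) .self (.hd .id) (.tl .id)
  obtain ⟨p₂, c₂, h₂⟩ := (PolyTime.usefulArcs (N := fun q : ι₂ => q.1.1)
    (a := fun q => encInstance q.1.2.1 q.1.2.2) .self (.hd .id) (.tl .id)).congr
      fun q => congrArg encDigraph (removeUseless_eq q.2).symm
  obtain ⟨p₃, c₃, h₃⟩ := PolyTime.optimize (N := fun q : ι₂ => q.1.1)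
    (a := fun q => encInstance q.1.2.1 q.1.2.2) .self (.hd .id) (.tl .id)
  obtain ⟨p₄, c₄, h₄⟩ := PolyTime.enoughLeaves (N := fun q : ι₃ => q.1)
    (a := fun q => encInstance q.2.1 q.2.2) .self (.hd .id) (.tl .id)
  obtain ⟨p₅, c₅, h₅⟩ := PolyTime.hasManyBackwardHeads (N := fun q : ι₄ => q.1 + q.2.2.2)
    (a := fun q => Val.cons (encDigraph q.2.1) (encInstance q.2.2.1 q.2.2.2))
    (.of_le fun q => Nat.le_add_right _ _) (.hd .id) (.hd (.tl .id)) (.tl (.tl .id))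
    (.of_le fun q => Nat.le_add_left _ _)
  obtain ⟨p₆, c₆, h₆⟩ := PolyTime.bags (N := fun q : ι₄ => q.1)
    (a := fun q => Val.cons (encDigraph q.2.1) (encInstance q.2.2.1 q.2.2.2))
    .self (.hd .id) (.hd (.tl .id))
  obtain ⟨p₇, c₇, h₇⟩ := PolyTime.hasLeafyOutBranching
    (N := fun q : ι₅ => q.1.1 + q.1.2.2.1.length + (4 * (q.1.2.2.2.2 + 1)) ^ (q.1.2.2.2.2 + 1))
    (a := fun q => Val.cons (encInstance q.1.2.1 q.1.2.2.2.1) (encBags q.1.2.2.1))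
    (X := fun q => q.1.2.2.1) (w := fun q => q.1.2.2.2.2)
    (.of_le fun q => (Nat.le_add_right _ _).trans (Nat.le_add_right _ _))
    (.of_le fun q => (Nat.le_add_left _ _).trans (Nat.le_add_right _ _))
    (.of_le fun q => Nat.le_add_left _ _) (fun q => q.2.2) (fun q => q.2.1) (.hd (.hd .id))
    (.tl .id) (.tl (.hd .id))
  refine ⟨⟨p₁, p₂, p₃, p₄, p₅, p₆, p₇⟩, ⟨fun n D r => RunsWithin.computes (h₁ ⟨n, D, r⟩),
    fun n D r hr => RunsWithin.computes (h₂ ⟨⟨n, D, r⟩, hr⟩),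
    fun n D r hr _ => ⟨_, isOneOptimal_optimize hr, RunsWithin.computes (h₃ ⟨⟨n, D, r⟩, hr⟩)⟩,
    fun n T k => RunsWithin.computes (h₄ ⟨n, T, k⟩),
    fun n D T r k _ => RunsWithin.computes (h₅ ⟨n, D, T, k⟩),
    fun n D T r k _ hT hl hk => ⟨_, isPathDecomposition_bags hT, widthLE_bags hT.1 hl hk,
      RunsWithin.computes (h₆ ⟨n, D, T, k⟩)⟩, fun n D X k hX => RunsWithin.computes
        -- For a decomposition about which nothing is known the trivial width `n` is good enough, as
        -- only termination is at stake.
        (h₇ ⟨⟨n, D, X, k, n⟩, hX, fun B _ => (Finset.card_le_univ B).trans (by simp)⟩)⟩,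
    c₁ + c₂ + c₃ + c₄ + c₅ + c₆ + c₇, fun n D k r => ?_⟩
  have hle : ∀ {m c}, m + 2 ≤ (n + 1) * paramBound k → c ≤ c₁ + c₂ + c₃ + c₄ + c₅ + c₆ + c₇ →
      (m + 2) ^ c ≤ ((n + 1) * paramBound k) ^ (c₁ + c₂ + c₃ + c₄ + c₅ + c₆ + c₇) :=
    fun {m c} h h' => (Nat.pow_le_pow_left h c).trans (Nat.pow_le_pow_right (by omega) h')
  have hnk : n + k + 2 ≤ (n + 1) * paramBound k := by
    have : k + 2 ≤ paramBound k := Nat.le_add_right _ _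
    nlinarith
  have hn : n + 2 ≤ (n + 1) * paramBound k := by omega
  refine ⟨RunsWithin.mono (h₁ ⟨n, D, r⟩) (hle hn (by omega)), fun hr =>
    RunsWithin.mono (h₂ ⟨⟨n, D, r⟩, hr⟩) (hle hn (by omega)), fun hr => ?_⟩
  have hr' := reach_removeUseless hr
  generalize removeUseless D r = E at hr' ⊢
  have hT := isOneOptimal_optimize hr'
  refine ⟨optimize E r, hT, RunsWithin.mono (h₃ ⟨⟨n, E, r⟩, hr'⟩) (hle hn (by omega)),
    RunsWithin.mono (h₄ ⟨n, optimize E r, k⟩) (hle hn (by omega)), fun hl =>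
      ⟨RunsWithin.mono (h₅ ⟨n, E, optimize E r, k⟩) (hle hnk (by omega)), fun hk =>
        ⟨bags E (optimize E r), RunsWithin.mono (h₆ ⟨n, E, optimize E r, k⟩) (hle hn (by omega)),
          RunsWithin.mono (h₇ ⟨⟨n, E, bags E (optimize E r), k, 6 * k ^ 3⟩,
            isPathDecomposition_bags hT, widthLE_bags hT.1 hl hk⟩) (hle ?_ (by omega))⟩⟩⟩
  -- An out-branching has a leaf, so for `k ≤ 1` the dynamic program is never reached; this
  -- justifies the value 0 in `paramBound`.
  have h1 := hT.1.leaves_pos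
  have h2 : ¬ k ≤ 1 := fun h => hl (h.trans h1)
  simp only [paramBound, if_neg h2, bags, List.length_ofFn]
  generalize (4 * (6 * k ^ 3 + 1)) ^ (6 * k ^ 3 + 1) = W
  nlinarith [Nat.zero_le (n * (k + W))]

theorem exists_runsWithin_algorithm : ∃ s : Steps, s.Correct ∧ ∃ c, ∀ (n : ℕ) (D : Digraph (Fin n))
    (k : ℕ), RunsWithin (algorithm s) (encInstance D k) (encProp (HasLeafyOutBranching D k))
      (300 * paramBound k ^ c * (n + 1) ^ (c + 1)) := by
  obtain ⟨s, hs, c, hc⟩ := exists_steps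
  refine ⟨s, hs, c, fun n D k => (runsWithin_algorithm (hc n D k)).mono ?_⟩
  have h1 : 1 ≤ ((n + 1) * paramBound k) ^ c :=
    Nat.one_le_pow _ _ (Nat.mul_pos (by omega) (by unfold paramBound; omega))
  calc n * (7 * ((n + 1) * paramBound k) ^ c + 202) + 40
      ≤ (n + 1) * (300 * ((n + 1) * paramBound k) ^ c) := by nlinarith
    _ = 300 * paramBound k ^ c * (n + 1) ^ (c + 1) := by rw [mul_pow]; ring

theorem paramBound_le (k : ℕ) :
    (paramBound k : ℝ) ≤ 3 * (2 : ℝ) ^ (100 * (k : ℝ) ^ 3 * Real.log k) := by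
  by_cases hk : k ≤ 1
  · rw [paramBound, if_pos hk]
    interval_cases k <;> norm_num
  · have h1 : paramBound k ≤ 3 * k ^ (56 * k ^ 3) := by
      have h2 : 2 ≤ k := by omega
      have h3 : 1 ≤ k ^ 3 := Nat.one_le_pow _ _ (by omega)
      have h5 : (4 * (6 * k ^ 3 + 1)) ^ (6 * k ^ 3 + 1) ≤ k ^ (56 * k ^ 3) := by
        -- For `k ≥ 2` the base is at most `32k³ ≤ k⁸` and the exponent at most `7k³`, whence `56 =
        -- 8 · 7`.
        have h4 : 4 * (6 * k ^ 3 + 1) ≤ k ^ 8 := by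
          have : 2 ^ 5 ≤ k ^ 5 := Nat.pow_le_pow_left h2 5
          calc 4 * (6 * k ^ 3 + 1) ≤ 2 ^ 5 * k ^ 3 := by omega
            _ ≤ k ^ 5 * k ^ 3 := Nat.mul_le_mul_right _ this
            _ = k ^ 8 := by ring
        calc (4 * (6 * k ^ 3 + 1)) ^ (6 * k ^ 3 + 1) ≤ (k ^ 8) ^ (6 * k ^ 3 + 1) :=
              Nat.pow_le_pow_left h4 _
          _ ≤ (k ^ 8) ^ (7 * k ^ 3) := Nat.pow_le_pow_right (Nat.pow_pos (by omega)) (by omega)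
          _ = k ^ (56 * k ^ 3) := by rw [← pow_mul]; ring_nf
      have h6 : k ≤ k ^ (56 * k ^ 3) := Nat.le_self_pow (by omega) k
      rw [paramBound, if_neg hk]
      omega
    have hk0 : (0 : ℝ) < k := by
      exact_mod_cast (by omega : 0 < k)
    have hlog : 0 ≤ Real.log k := Real.log_natCast_nonneg k
    have h2 : (k : ℝ) ^ (56 * k ^ 3) ≤ (2 : ℝ) ^ (100 * (k : ℝ) ^ 3 * Real.log k) := by
      rw [← Real.rpow_natCast, Real.rpow_def_of_pos hk0, Real.rpow_def_of_pos two_pos]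
      refine Real.exp_le_exp.2 ?_
      -- Changing to base 2 costs a factor `1 / log 2`, and `56 ≤ 100 · log 2`.
      have := Real.log_two_gt_d9
      push_cast
      nlinarith [mul_nonneg (pow_nonneg hk0.le 3) hlog]
    calc (paramBound k : ℝ) ≤ 3 * (k : ℝ) ^ (56 * k ^ 3) := by exact_mod_cast h1
      _ ≤ _ := by gcongr

theorem fixedParameterTractable :
    FixedParameterTractable fun _ D k => HasLeafyOutBranching D k := by
  obtain ⟨s, -, c, h⟩ := exists_runsWithin_algorithm
  exact ⟨algorithm s, fun k => 300 * paramBound k ^ c, c + 1, h⟩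

theorem exists_steps_time : ∃ s : Steps, s.Correct ∧ ∃ c : ℕ, ∀ (n : ℕ) (D : Digraph (Fin n))
    (k : ℕ), ∃ t : ℕ,
      (algorithm s).RunsTo (encInstance D k) (encProp (HasLeafyOutBranching D k)) t ∧
      (t : ℝ) ≤ c * (2 : ℝ) ^ ((c : ℝ) * (k : ℝ) ^ 3 * Real.log k) * ((n : ℝ) + 1) ^ c := by
  obtain ⟨s, hs, c, h⟩ := exists_runsWithin_algorithm
  -- One constant has to dominate the factor `300 * 3 ^ c`, the coefficient `100 * c` in the
  -- exponent, and the degree `c + 1`.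
  refine ⟨s, hs, 300 * 3 ^ c + 100 * c + (c + 1), fun n D k => ?_⟩
  obtain ⟨t, ht, hr⟩ := h n D k
  refine ⟨t, hr, ?_⟩
  have hx : 0 ≤ (k : ℝ) ^ 3 * Real.log k := mul_nonneg (by positivity) (Real.log_natCast_nonneg k)
  calc (t : ℝ) ≤ 300 * (paramBound k : ℝ) ^ c * ((n : ℝ) + 1) ^ (c + 1) := by exact_mod_cast ht
    _ ≤ 300 * (3 * (2 : ℝ) ^ (100 * (k : ℝ) ^ 3 * Real.log k)) ^ c * ((n : ℝ) + 1) ^ (c + 1) := by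
      gcongr
      exact paramBound_le k
    _ = (300 * 3 ^ c) * (2 : ℝ) ^ ((100 * c : ℝ) * ((k : ℝ) ^ 3 * Real.log k)) *
        ((n : ℝ) + 1) ^ (c + 1) := by
      rw [mul_pow, ← Real.rpow_mul_natCast two_pos.le]
      ring_nf
    _ ≤ _ := by
      have h1 : ((300 * 3 ^ c + 100 * c + (c + 1) : ℕ) : ℝ) = 300 * 3 ^ c + 100 * c + (c + 1) := by
        push_cast
        ring
      rw [h1, mul_assoc _ ((k : ℝ) ^ 3)]
      have h3 : (0 : ℝ) ≤ 300 * 3 ^ c := by positivity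
      have hc : (0 : ℝ) ≤ c := Nat.cast_nonneg c
      gcongr
      all_goals first | linarith | omega

end SpanningLeaf

open SpanningLeaf
/-- First part: whatever correct programs perform its steps, the algorithm halts with the right
answer on every digraph. Second part: the steps can be programmed so that it takes time
`2 ^ O(k ^ 3 * log k) * n ^ O(1)`; the base `n + 1` only serves to include `n = 0`. -/
theorem mainTheorem1 :
    (∀ s : Steps, s.Correct → ∀ (n : ℕ) (D : Digraph (Fin n)) (k : ℕ),
      (algorithm s).Computes (encInstance D k) (encProp (HasLeafyOutBranching D k))) ∧
    (∃ s : Steps, s.Correct ∧ ∃ c : ℕ, ∀ (n : ℕ) (D : Digraph (Fin n)) (k : ℕ), ∃ t : ℕ,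
      (algorithm s).RunsTo (encInstance D k) (encProp (HasLeafyOutBranching D k)) t ∧
      (t : ℝ) ≤ c * (2 : ℝ) ^ ((c : ℝ) * (k : ℝ) ^ 3 * Real.log k) * ((n : ℝ) + 1) ^ c) ∧
    FixedParameterTractable (fun _ D k => HasLeafyOutBranching D k) :=
  ⟨fun _ hs _ => hs.computes_algorithm, exists_steps_time, fixedParameterTractable⟩
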